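/- **Setting.** Let $\mathcal M=(S,L,\mathbf P,\lambda,\mathcal L)$ be a continuous-time Markov chain with finite state set $S$, stochastic matrix $\mathbf P$, exit rates $\lambda(s)>0$ and labelling $\mathcal L:S\to L$, $L$ finite. Let $\mathcal A=(Q,L,\mathcal X,\Delta,F)$ be a deterministic timed automaton: $Q$ and the set of clocks $\mathcal X$ are finite, $F\subseteq Q$, and $\Delta$ is a finite set of rules $(q,a,g,Y,q')$ with $q,q'\in Q$, $a\in L$, $Y\subseteq\mathcal X$ and guard $g$ a finite conjunction of constraints $x\bowtie c$ ($x\in\mathcal X$, $\bowtie\in\{<,\le,>,\ge\}$, $c\in\mathbb N_0$). It is deterministic (two distinct rules with the same $q$ and $a$ have disjoint guards) and total (for all $q,a$ and $\eta\in\mathrm{Val}=\mathbb R_{\ge0}^{\mathcal X}$ some rule from $q$ on $a$ has a guard satisfied by $\eta$). In configuration $(q,\eta)$, after a delay $t\ge 0$ and on signature $a$, the automaton applies the unique rule $(q,a,g,Y,q')$ with $\eta+t\models g$ and moves to $(q',(\eta+t)[Y:=0])$, where $[Y:=0]$ sets the clocks in $Y$ to $0$. For $(s,q,\eta)\in S\times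 Q\times\mathrm{Val}$ let $\mathsf{prob}(s,q,\eta)$ be the probability, for the chain started in $s$, of the set of timed paths $s_0t_0s_1t_1\dots$ with $s_0=s$ such that the run of $\mathcal A$ from $(q,\eta)$ on the timed word $(\mathcal L(s_n),t_n)_{n\ge0}$ visits $F$ (possibly at step $0$). **Regions.** Let $T_x$ be the largest constant to which the clock $x$ is compared in a guard of $\mathcal A$ ($0$ if there is none) and $T_{\max}=\max_xT_x$ ($0$ if $\mathcal X=\emptyset$). Write $\eta\sim\eta'$ if for every $x$: $\eta(x)>T_x$ iff $\eta'(x)>T_x$; for every $x$ with $\eta(x),\eta'(x)\le T_x$, these values have the same integer part, and one has positive fractional part iff the other does; and for all $x,y$ with $\eta(x),\eta'(x)\le T_x$ and $\eta(y),\eta'(y)\le T_y$, the fractional parts of $\eta(x),\eta(y)$ are ordered ($<,=,>$) like those of $\eta'(x),\eta'(y)$. A valuation $\eta$ is marginal if some $x$ has $\eta(x)\le T_x$ and $\eta(x)\in\mathbb Z$. The product region graph $G$ has the finite vertex set $V=S\times Q\times(\mathrm{Val}/{\sim})$ and an edge $(s,q,r)\to(s',q',r')$ iff $\mathbf P(s,s')>0$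 and there are $\eta\in r$, $\eta'\in r'$, $t>0$ such that $\eta+t$ is not marginal and $\mathcal A$ moves from $(q,\eta)$ to $(q',\eta')$ by delay $t$ on signature $\mathcal L(s)$. A vertex $(s,q,r)$ is final if $q\in F$. Write $[v]=(s,q,[\eta]_\sim)$ for $v=(s,q,\eta)$. **Scheme.** Let $m$ be a positive integer and $\rho=1/m$. Let $D_m$ be the set of $v=(s,q,\eta)$ with $\eta(x)\in[0,T_x]$ and $m\,\eta(x)\in\mathbb Z$ for all $x$; $B_m$ the set of $v\in D_m$ with $[v]$ not final but able to reach a final vertex in $G$; and $B_m^{\max}$ the set of $v\in B_m$ with $\eta(x)=T_x$ for all $x$. For $v=(s,q,\eta)$ put $\lambda(v)=\lambda(s)$, $\mathbf P(v,u)=\mathbf P(s,u)$, $v\oplus\rho=(s,q,\eta\oplus\rho)$ with $(\eta\oplus\rho)(x)=\min\{T_x,\eta(x)+\rho\}$, and $v_u^+=(u,q',\eta[Y:=0])$, where $(q,\mathcal L(s),g,Y,q')$ is the rule enabled at $\eta+t$ for all sufficiently small $t>0$. The system $\Gamma'_m$ for $h:D_m\to\mathbb R$ consists of $h(v)=0$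 if $[v]$ cannot reach a final vertex, $h(v)=1$ if $[v]$ is final, $$h(v)=\frac{1}{1+\rho\lambda(v)}\,h(v\oplus\rho)+\frac{\rho\lambda(v)}{1+\rho\lambda(v)}\sum_{u\in S}\mathbf P(v,u)\,h(v_u^+)\quad\text{if }v\in B_m\setminus B_m^{\max},$$ and $h(v)=\sum_{u\in S}\mathbf P(v,u)\,h(v_u^+)$ if $v\in B_m^{\max}$. Eliminating the known values outside $B_m$ turns it into a matrix equation $\mu=\mathbf C\mu+\mathbf d$ for $\mu\in\mathbb R^{B_m}$: $\mathbf C(v,w)$ is the coefficient of $h(w)$ in the equation for $h(v)$, and $\mathbf d(v)$ is the contribution of the values outside $B_m$. **Constants.** Let $\lambda_{\max},\lambda_{\min}$ be the largest and smallest exit rates, $p_{\min}$ the smallest positive entry of $\mathbf P$, and $$M_1=|\mathcal X|\,\lambda_{\max}T_{\max}\,e^{\lambda_{\max}T_{\max}},\qquad M_3=T_{\max}\cdot2\lambda_{\max}\cdot M_1,\qquad \mathfrak c=e^{-\lambda_{\max}T_{\max}}\cdot p_{\min}\cdot\frac{\lambda_{\min}}{2|V|^2+\lambda_{\min}}.$$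 **Theorem.** If $m>2|V|^2$, then the matrix equation $\mu=\mathbf C\mu+\mathbf d$ has a unique solution $\overline\mu$; equivalently, $\Gamma'_m$ has a unique solution $h:D_m\to\mathbb R$, and $h=\overline\mu$ on $B_m$. Moreover, for all $v\in B_m$, $$\bigl|\overline\mu(v)-\mathsf{prob}(v)\bigr|\le|V|\cdot\mathfrak c^{-|V|}\cdot M_3\,\rho .$$ -/

import Mathlib

open MeasureTheory ProbabilityTheory
open scoped NNReal ENNReal Matrix

noncomputable section

/-! ### Continuous-time Markov chains and their path measure -/

/-- A continuous-time Markov chain with state set `S` and label set `L`. -/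
structure CTMC (S L : Type*) [Fintype S] where
  /-- transition matrix -/
  P : S → S → ℝ
  P_nonneg : ∀ s u, 0 ≤ P s u
  P_sum : ∀ s, ∑ u, P s u = 1
  /-- exit rates -/
  rate : S → ℝ
  rate_pos : ∀ s, 0 < rate s
  /-- labelling function -/
  label : S → L

namespace CTMC

variable {S L : Type*} [Fintype S]

/-- Timed paths `s₀ t₀ s₁ t₁ …`; `(π n).1` is the `n`-th state, `(π n).2` the `n`-th dwell time. -/
abbrev Path (S : Type*) : Type _ := ℕ → S × ℝ≥0

/-- The exponential distribution with rate `λ(s)`, as a measure on `[0, ∞)`. -/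
def dwell (M : CTMC S L) (s : S) : Measure ℝ≥0 :=
  (expMeasure (M.rate s)).map Real.toNNReal

instance (M : CTMC S L) (s : S) : IsProbabilityMeasure (M.dwell s) :=
  haveI := isProbabilityMeasure_expMeasure (M.rate_pos s)
  Measure.isProbabilityMeasure_map measurable_real_toNNReal.aemeasurable

theorem dwell_apply (M : CTMC S L) (s : S) {I : Set ℝ≥0} (hI : MeasurableSet I) :
    M.dwell s I = ∫⁻ t in ((↑) : ℝ≥0 → ℝ) '' I,
      ENNReal.ofReal (M.rate s * Real.exp (-(M.rate s * t))) := by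
  have hI' : MeasurableSet (((↑) : ℝ≥0 → ℝ) '' I) :=
    (MeasurableEmbedding.subtype_coe measurableSet_Ici).measurableSet_image.2 hI
  have h0 : ∀ᵐ x ∂expMeasure (M.rate s), 0 ≤ x := by
    rw [ae_iff, show {a : ℝ | ¬ 0 ≤ a} = Set.Iio 0 by ext; simp, expMeasure, gammaMeasure,
      withDensity_apply _ measurableSet_Iio]
    exact lintegral_exponentialPDF_of_nonpos le_rfl
  rw [dwell, Measure.map_apply measurable_real_toNNReal hI]
  have h1 : (Real.toNNReal ⁻¹' I : Set ℝ) =ᵐ[expMeasure (M.rate s)] ((↑) : ℝ≥0 → ℝ) '' I := by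
    filter_upwards [h0] with x hx
    refine propext ⟨fun h => ⟨_, h, Real.coe_toNNReal x hx⟩, ?_⟩
    rintro ⟨t, ht, rfl⟩
    change Real.toNNReal t ∈ I
    simpa using ht
  rw [measure_congr h1, expMeasure, gammaMeasure, withDensity_apply _ hI']
  refine setLIntegral_congr_fun hI' ?_
  rintro _ ⟨t, _, rfl⟩
  exact exponentialPDF_of_nonneg t.coe_nonneg

variable [MeasurableSpace S] [DiscreteMeasurableSpace S]

/-- From state `s`: choose the next state `u` with probability `P s u`, and then the dwell time
in `u`, exponentially distributed with rate `λ(u)`. -/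
def stepKernel (M : CTMC S L) : Kernel S (S × ℝ≥0) :=
  Kernel.ofFunOfCountable fun s =>
    ∑ u, ENNReal.ofReal (M.P s u) • (Measure.dirac u).prod (M.dwell u)

instance (M : CTMC S L) : IsMarkovKernel M.stepKernel := by
  refine ⟨fun s => ⟨?_⟩⟩
  change (∑ u, ENNReal.ofReal (M.P s u) • (Measure.dirac u).prod (M.dwell u)) Set.univ = 1
  simp only [Measure.finsetSum_apply, Measure.smul_apply, measure_univ, smul_eq_mul, mul_one]
  rw [← ENNReal.ofReal_sum_of_nonneg (fun u _ => M.P_nonneg s u), M.P_sum, ENNReal.ofReal_one]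

/-- The one-step kernel, depending on the last state of a finite history. -/
def historyKernel (M : CTMC S L) (n : ℕ) :
    Kernel ((i : Finset.Iic n) → S × ℝ≥0) (S × ℝ≥0) :=
  M.stepKernel.comap (fun x => (x ⟨n, Finset.mem_Iic.2 le_rfl⟩).1) (by fun_prop)

instance (M : CTMC S L) (n : ℕ) : IsMarkovKernel (M.historyKernel n) := by
  unfold historyKernel; infer_instance

/-- The probability measure on timed paths started in the state `s`. -/
def pathMeasure (M : CTMC S L) (s : S) : Measure (Path S) :=
  Kernel.trajMeasure (X := fun _ => S × ℝ≥0) ((Measure.dirac s).prod (M.dwell s)) M.historyKernel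

instance (M : CTMC S L) (s : S) : IsProbabilityMeasure (M.pathMeasure s) := by
  unfold pathMeasure; infer_instance

theorem pathMeasure_map_zero (M : CTMC S L) (s : S) :
    (M.pathMeasure s).map (fun π => π 0) = (Measure.dirac s).prod (M.dwell s) := by
  have h : (fun π : Path S => π 0) =
      (fun x : (i : Finset.Iic 0) → S × ℝ≥0 => x ⟨0, Finset.mem_Iic.2 le_rfl⟩) ∘
        Preorder.frestrictLe (π := fun _ => S × ℝ≥0) 0 := rfl
  rw [h, ← Measure.map_map (by fun_prop) (by fun_prop), pathMeasure, Kernel.trajMeasure,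
    Measure.map_comp _ _ (by fun_prop), Kernel.traj_map_frestrictLe, Kernel.partialTraj_self,
    Measure.id_comp, Measure.map_map (by fun_prop) (by fun_prop)]
  exact Measure.map_id

theorem pathMeasure_box (M : CTMC S L) (s : S) (σ : ℕ → S) (I : ℕ → Set ℝ≥0)
    (hI : ∀ n, MeasurableSet (I n)) (l : ℕ) :
    M.pathMeasure s {π | ∀ n ≤ l, (π n).1 = σ n ∧ (π n).2 ∈ I n} =
      Set.indicator {s} 1 (σ 0) * (∏ n ∈ Finset.range l,
        ENNReal.ofReal (M.P (σ n) (σ (n + 1))) * M.dwell (σ n) (I n)) * M.dwell (σ l) (I l) := by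
  induction l with
  | zero =>
    have h : {π : Path S | ∀ n ≤ 0, (π n).1 = σ n ∧ (π n).2 ∈ I n} =
        (fun π => π 0) ⁻¹' ({σ 0} ×ˢ I 0) := by
      ext π; simp
    rw [h, ← Measure.map_apply (by fun_prop) ((measurableSet_singleton _).prod (hI 0)),
      pathMeasure_map_zero, Measure.prod_prod, Measure.dirac_apply]
    by_cases hs : σ 0 = s
    · simp [hs]
    · simp [hs, Ne.symm hs]
  | succ l ih =>
    let G : Set ((i : Finset.Iic l) → S × ℝ≥0) := {x | ∀ i, (x i).1 = σ i ∧ (x i).2 ∈ I i}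
    have hG : MeasurableSet G := by
      have : G = Set.pi Set.univ fun i : Finset.Iic l => {σ i} ×ˢ I i := by ext x; simp [G, Set.mem_pi]
      rw [this]
      exact MeasurableSet.univ_pi fun i => (measurableSet_singleton _).prod (hI i)
    have hT : MeasurableSet ({σ (l + 1)} ×ˢ I (l + 1)) := (measurableSet_singleton _).prod (hI _)
    have h0 : {π : Path S | ∀ n ≤ l, (π n).1 = σ n ∧ (π n).2 ∈ I n} =
        Preorder.frestrictLe (π := fun _ => S × ℝ≥0) l ⁻¹' G := by
      ext π; simp [G]
    have h1 : {π : Path S | ∀ n ≤ l + 1, (π n).1 = σ n ∧ (π n).2 ∈ I n} =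
        (fun π => (Preorder.frestrictLe (π := fun _ => S × ℝ≥0) l π, π (l + 1))) ⁻¹'
          (G ×ˢ ({σ (l + 1)} ×ˢ I (l + 1))) := by
      ext π
      simp only [Set.mem_ofPred_eq, Set.mem_preimage, Set.mem_prod, G, Subtype.forall,
        Finset.mem_Iic, Preorder.frestrictLe_apply, Set.mem_singleton_iff]
      constructor
      · exact fun h => ⟨fun n hn => h n (by lia), h _ le_rfl⟩
      · rintro ⟨h, h'⟩ n hn
        rcases Nat.lt_or_ge l n with h2 | h2
        · obtain rfl : n = l + 1 := by lia
          exact h'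
        · exact h n h2
    rw [h1, ← Measure.map_apply (by fun_prop) (hG.prod hT), pathMeasure,
      ← Kernel.map_frestrictLe_trajMeasure_compProd_eq_map_trajMeasure,
      Measure.compProd_apply_prod hG hT]
    have h2 : ∀ x ∈ G, M.historyKernel l x ({σ (l + 1)} ×ˢ I (l + 1)) =
        ENNReal.ofReal (M.P (σ l) (σ (l + 1))) * M.dwell (σ (l + 1)) (I (l + 1)) := by
      intro x hx
      rw [historyKernel, Kernel.comap_apply, (hx ⟨l, _⟩).1]
      change (∑ u, ENNReal.ofReal (M.P (σ l) u) • (Measure.dirac u).prod (M.dwell u)) _ = _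
      rw [Measure.finsetSum_apply, Finset.sum_eq_single (σ (l + 1))]
      · simp
      · intro u _ hu
        simp [Measure.prod_prod, hu]
      · simp
    rw [setLIntegral_congr_fun hG h2, setLIntegral_const, Measure.map_apply (by fun_prop) hG,
      ← h0, ← pathMeasure, ih, Finset.prod_range_succ]
    ring

/-- The characterising property of the path measure: the value on the cylinder set of a template
`σ₀ I₀ … σ_{l-1} I_{l-1} σ_l`. -/
theorem pathMeasure_cylinder (M : CTMC S L) (s : S) (σ : ℕ → S) (I : ℕ → Set ℝ≥0)
    (hI : ∀ n, MeasurableSet (I n)) (l : ℕ) :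
    M.pathMeasure s {π | (∀ n ≤ l, (π n).1 = σ n) ∧ ∀ n < l, (π n).2 ∈ I n} =
      Set.indicator {s} 1 (σ 0) * ∏ n ∈ Finset.range l,
        ENNReal.ofReal (M.P (σ n) (σ (n + 1))) * ∫⁻ t in ((↑) : ℝ≥0 → ℝ) '' I n,
          ENNReal.ofReal (M.rate (σ n) * Real.exp (-(M.rate (σ n) * t))) := by
  have h := M.pathMeasure_box s σ (fun n => if n < l then I n else Set.univ)
    (fun n => by split_ifs; exacts [hI n, MeasurableSet.univ]) l
  simp only [lt_irrefl, if_false, measure_univ, mul_one] at h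
  rw [Finset.prod_congr rfl fun n hn => by
    rw [← M.dwell_apply (σ n) (hI n), ← if_pos (c := n < l) (t := I n) (e := Set.univ)
      (Finset.mem_range.1 hn)]]
  rw [← h]
  congr 1
  ext π
  simp only [Set.mem_ofPred_eq]
  constructor
  · rintro ⟨h1, h2⟩ n hn
    refine ⟨h1 n hn, ?_⟩
    split_ifs with hl
    exacts [h2 n hl, trivial]
  · intro h1
    refine ⟨fun n hn => (h1 n hn).1, fun n hn => ?_⟩
    simpa [hn] using (h1 n hn.le).2

end CTMC

/-! ### Clock valuations, guards, deterministic timed automata -/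

/-- Clock valuations. -/
abbrev Val (X : Type*) : Type _ := X → ℝ≥0

/-- `η + t`. -/
def Val.delay {X : Type*} (η : Val X) (t : ℝ≥0) : Val X := fun x => η x + t

open Classical in
/-- `η[Y := 0]`. -/
def Val.reset {X : Type*} (η : Val X) (Y : Set X) : Val X := fun x => if x ∈ Y then 0 else η x

/-- The comparison symbols of basic clock constraints. -/
inductive Cmp
  | lt
  | le
  | gt
  | ge

/-- The meaning of a comparison symbol. -/
def Cmp.Holds : Cmp → ℝ≥0 → ℝ≥0 → Prop
  | .lt, a, b => a < b
  | .le, a, b => a ≤ b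
  | .gt, a, b => a > b
  | .ge, a, b => a ≥ b

/-- A basic constraint `clock ⋈ bound`. -/
structure Constraint (X : Type*) where
  clock : X
  cmp : Cmp
  bound : ℕ

/-- A guard is a finite conjunction of basic constraints. -/
abbrev Guard (X : Type*) : Type _ := List (Constraint X)

/-- `η ⊨ g`. -/
def Guard.Sat {X : Type*} (g : Guard X) (η : Val X) : Prop :=
  ∀ c ∈ g, c.cmp.Holds (η c.clock) c.bound

/-- A rule `(q, a, g, Y, q')` of a timed automaton. -/
structure Rule (Q L X : Type*) where
  src : Q
  sig : L
  guard : Guard X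
  resets : Set X
  tgt : Q

/-- Deterministic (and total) timed automata with locations `Q`, signatures `L`, clocks `X`. -/
structure DTA (Q L X : Type*) where
  rules : Set (Rule Q L X)
  rules_finite : rules.Finite
  final : Set Q
  deterministic : ∀ r₁ ∈ rules, ∀ r₂ ∈ rules, r₁.src = r₂.src → r₁.sig = r₂.sig →
    (∃ η : Val X, r₁.guard.Sat η ∧ r₂.guard.Sat η) → r₁ = r₂
  total : ∀ (q : Q) (a : L) (η : Val X), ∃ r ∈ rules, r.src = q ∧ r.sig = a ∧ r.guard.Sat η

namespace DTA

variable {Q L X : Type*}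

/-- The unique rule from `q` on signature `a` whose guard is satisfied by `η`. -/
def ruleAt (A : DTA Q L X) (q : Q) (a : L) (η : Val X) : Rule Q L X := (A.total q a η).choose

/-- The one-step transition function `κ((q, η), (a, t))`. -/
def step (A : DTA Q L X) (c : Q × Val X) (w : L × ℝ≥0) : Q × Val X :=
  ((A.ruleAt c.1 w.1 (c.2.delay w.2)).tgt,
    (c.2.delay w.2).reset (A.ruleAt c.1 w.1 (c.2.delay w.2)).resets)

/-- The sequence of configurations of the run on a timed word `w` from configuration `c`. -/
def run (A : DTA Q L X) (c : Q × Val X) (w : ℕ → L × ℝ≥0) : ℕ → Q × Val X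
  | 0 => c
  | n + 1 => A.step (A.run c w n) (w n)

/-- The timed word `w` is accepted from the configuration `c`. -/
def Accepts (A : DTA Q L X) (c : Q × Val X) (w : ℕ → L × ℝ≥0) : Prop :=
  ∃ n, (A.run c w n).1 ∈ A.final

/-- `T_x`: the largest constant to which the clock `x` is compared in a guard (`0` if none). -/
def bound (A : DTA Q L X) (x : X) : ℕ :=
  sSup {c | ∃ r ∈ A.rules, ∃ k ∈ r.guard, k.clock = x ∧ k.bound = c}

/-- `T_max`, the maximum of all `T_x` (`0` if there are no clocks). -/
def maxBound [Fintype X] (A : DTA Q L X) : ℕ := Finset.univ.sup A.bound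

/-! ### Regions -/

/-- Guard-equivalence of valuations. -/
def GuardEquiv (A : DTA Q L X) (η η' : Val X) : Prop :=
  (∀ x, (A.bound x : ℝ≥0) < η x ↔ (A.bound x : ℝ≥0) < η' x) ∧
  ∀ x, η x ≤ A.bound x → η' x ≤ A.bound x →
    ⌊(η x : ℝ)⌋ = ⌊(η' x : ℝ)⌋ ∧ (0 < Int.fract (η x : ℝ) ↔ 0 < Int.fract (η' x : ℝ))

/-- Equivalence `∼` of valuations. -/
def RegionEquiv (A : DTA Q L X) (η η' : Val X) : Prop :=
  A.GuardEquiv η η' ∧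
  ∀ x y, η x ≤ A.bound x → η' x ≤ A.bound x → η y ≤ A.bound y → η' y ≤ A.bound y →
    (Int.fract (η x : ℝ) < Int.fract (η y : ℝ) ↔ Int.fract (η' x : ℝ) < Int.fract (η' y : ℝ)) ∧
    (Int.fract (η x : ℝ) = Int.fract (η y : ℝ) ↔ Int.fract (η' x : ℝ) = Int.fract (η' y : ℝ)) ∧
    (Int.fract (η x : ℝ) > Int.fract (η y : ℝ) ↔ Int.fract (η' x : ℝ) > Int.fract (η' y : ℝ))

theorem GuardEquiv.le_iff {A : DTA Q L X} {η η' : Val X} (h : A.GuardEquiv η η') (x : X) :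
    η x ≤ A.bound x ↔ η' x ≤ A.bound x := by
  simpa only [not_lt] using not_congr (h.1 x)

/-- The setoid of `∼`. -/
def regionSetoid (A : DTA Q L X) : Setoid (Val X) where
  r := A.RegionEquiv
  iseqv :=
    { refl := fun η => ⟨⟨fun _ => Iff.rfl, fun _ _ _ => ⟨rfl, Iff.rfl⟩⟩,
        fun _ _ _ _ _ _ => ⟨Iff.rfl, Iff.rfl, Iff.rfl⟩⟩
      symm := fun h => ⟨⟨fun x => (h.1.1 x).symm, fun x h₁ h₂ =>
          ⟨(h.1.2 x h₂ h₁).1.symm, (h.1.2 x h₂ h₁).2.symm⟩⟩,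
        fun x y h₁ h₂ h₃ h₄ => ⟨(h.2 x y h₂ h₁ h₄ h₃).1.symm, (h.2 x y h₂ h₁ h₄ h₃).2.1.symm,
          (h.2 x y h₂ h₁ h₄ h₃).2.2.symm⟩⟩
      trans := fun {a b c} h k => by
        have e : ∀ x, a x ≤ A.bound x → b x ≤ A.bound x := fun x => (h.1.le_iff x).1
        refine ⟨⟨fun x => (h.1.1 x).trans (k.1.1 x), fun x h₁ h₂ => ?_⟩,
          fun x y h₁ h₂ h₃ h₄ => ?_⟩
        · exact ⟨(h.1.2 x h₁ (e x h₁)).1.trans (k.1.2 x (e x h₁) h₂).1,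
            (h.1.2 x h₁ (e x h₁)).2.trans (k.1.2 x (e x h₁) h₂).2⟩
        · have p := h.2 x y h₁ (e x h₁) h₃ (e y h₃)
          have q := k.2 x y (e x h₁) h₂ (e y h₃) h₄
          exact ⟨p.1.trans q.1, p.2.1.trans q.2.1, p.2.2.trans q.2.2⟩ }

/-- Regions: equivalence classes of `∼`. -/
abbrev Region (A : DTA Q L X) : Type _ := Quotient A.regionSetoid

/-- The region of a valuation. -/
def region (A : DTA Q L X) (η : Val X) : A.Region := Quotient.mk A.regionSetoid η

instance [Finite X] (A : DTA Q L X) : Finite A.Region := by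
  let f : Val X → (X → Prop) × ((x : X) → Fin (A.bound x + 1)) × (X → Prop) ×
      (X → X → Prop × Prop × Prop) := fun η =>
    (fun x => (A.bound x : ℝ≥0) < η x,
      fun x => ⟨min (A.bound x) ⌊(η x : ℝ)⌋₊, Nat.lt_succ_of_le (min_le_left _ _)⟩,
      fun x => 0 < Int.fract (η x : ℝ),
      fun x y => (Int.fract (η x : ℝ) < Int.fract (η y : ℝ),
        Int.fract (η x : ℝ) = Int.fract (η y : ℝ), Int.fract (η x : ℝ) > Int.fract (η y : ℝ)))
  suffices key : ∀ η η', f η = f η' → A.RegionEquiv η η' by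
    refine Finite.of_injective (fun r : A.Region => f r.out) fun r r' h => ?_
    rw [← r.out_eq, ← r'.out_eq]
    exact Quotient.sound (s := A.regionSetoid) (key _ _ h)
  intro η η' h
  simp only [f, Prod.mk.injEq] at h
  obtain ⟨h1, h2, h3, h4⟩ := h
  refine ⟨⟨fun x => (congrFun h1 x).to_iff, fun x hx hx' => ⟨?_, (congrFun h3 x).to_iff⟩⟩,
    fun x y _ _ _ _ => ?_⟩
  · have k := congrArg Fin.val (congrFun h2 x)
    have e : ∀ ζ : Val X, ζ x ≤ A.bound x → ⌊(ζ x : ℝ)⌋₊ ≤ A.bound x := fun ζ hζ =>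
      Nat.floor_le_of_le (by exact_mod_cast hζ)
    simp only [min_eq_right (e η hx), min_eq_right (e η' hx')] at k
    rw [← Int.natCast_floor_eq_floor (η x).coe_nonneg, k,
      Int.natCast_floor_eq_floor (η' x).coe_nonneg]
  · have k := congrFun (congrFun h4 x) y
    simp only [Prod.mk.injEq] at k
    exact ⟨k.1.to_iff, k.2.1.to_iff, k.2.2.to_iff⟩

/-- The region of `η` is marginal. -/
def Marginal (A : DTA Q L X) (η : Val X) : Prop :=
  ∃ x, η x ≤ A.bound x ∧ Int.fract (η x : ℝ) = 0

/-- All valuations `η + t` with small `t > 0` lie in one region. -/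
theorem exists_delay_equiv [Finite X] (A : DTA Q L X) (η : Val X) :
    ∃ t₁ : ℝ≥0, 0 < t₁ ∧ ∀ t t' : ℝ≥0, 0 < t → t < t₁ → 0 < t' → t' < t₁ →
      A.RegionEquiv (η.delay t) (η.delay t') := by
  obtain ⟨e, he, hx⟩ : ∃ e : ℝ≥0, 0 < e ∧ ∀ x, Int.fract (η x : ℝ) + e ≤ 1 := by
    cases nonempty_fintype X
    rcases isEmpty_or_nonempty X with h | h
    · exact ⟨1, one_pos, fun x => h.elim x⟩
    · obtain ⟨y, hy⟩ := Finite.exists_max fun x => Int.fract (η x : ℝ)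
      have h1 : 0 < 1 - Int.fract (η y : ℝ) := sub_pos.2 (Int.fract_lt_one _)
      refine ⟨⟨_, h1.le⟩, h1, fun x => ?_⟩
      have := hy x
      change Int.fract (η x : ℝ) + (1 - Int.fract (η y : ℝ)) ≤ 1
      linarith
  have fl : ∀ (t : ℝ≥0) (x : X), t < e → ⌊((η.delay t) x : ℝ)⌋ = ⌊(η x : ℝ)⌋ := by
    intro t x ht
    have h1 := hx x
    have h2 : (t : ℝ) < e := ht
    have h3 := Int.floor_add_fract (η x : ℝ)
    have h4 := Int.fract_nonneg (η x : ℝ)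
    have h5 := t.coe_nonneg
    rw [Int.floor_eq_iff]
    simp only [Val.delay, NNReal.coe_add]
    constructor <;> linarith
  have fr : ∀ (t : ℝ≥0) (x : X), t < e →
      Int.fract ((η.delay t) x : ℝ) = Int.fract (η x : ℝ) + t := by
    intro t x ht
    have h := fl t x ht
    have h1 := Int.self_sub_floor ((η.delay t) x : ℝ)
    have h2 := Int.self_sub_floor (η x : ℝ)
    rw [h] at h1
    rw [← h1, ← h2]
    simp only [Val.delay, NNReal.coe_add]
    ring
  have gt : ∀ (t : ℝ≥0) (x : X), 0 < t → t < e →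
      ((A.bound x : ℝ≥0) < (η.delay t) x ↔ (A.bound x : ℤ) ≤ ⌊(η x : ℝ)⌋) := by
    intro t x h0 ht
    have h0' : (0 : ℝ) < t := h0
    rw [← NNReal.coe_lt_coe, NNReal.coe_natCast]
    have h3 := Int.floor_add_fract ((η.delay t) x : ℝ)
    rw [fr t x ht, fl t x ht] at h3
    have h4 := Int.fract_nonneg (η x : ℝ)
    have h1 := hx x
    have h2 : (t : ℝ) < e := ht
    constructor
    · intro h
      by_contra hc
      have hc' : ((⌊(η x : ℝ)⌋ + 1 : ℤ) : ℝ) ≤ ((A.bound x : ℤ) : ℝ) := by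
        exact_mod_cast Int.add_one_le_iff.2 (not_le.1 hc)
      push_cast at hc'
      linarith
    · intro h
      have h' : ((A.bound x : ℤ) : ℝ) ≤ (⌊(η x : ℝ)⌋ : ℝ) := by exact_mod_cast h
      push_cast at h'
      linarith
  refine ⟨e, he, fun t t' h0 ht h0' ht' => ⟨⟨fun x => ?_, fun x _ _ => ⟨?_, ?_⟩⟩,
    fun x y _ _ _ _ => ?_⟩⟩
  · rw [gt t x h0 ht, gt t' x h0' ht']
  · rw [fl t x ht, fl t' x ht']
  · have h4 := Int.fract_nonneg (η x : ℝ)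
    have h5 : (0 : ℝ) < t := h0
    have h6 : (0 : ℝ) < t' := h0'
    rw [fr t x ht, fr t' x ht']
    constructor <;> intro _ <;> linarith
  · rw [fr t x ht, fr t' x ht', fr t y ht, fr t' y ht']
    simp

/-- `η⁺`: a representative of the valuations `η + t` with small `t > 0`. -/
def plus [Finite X] (A : DTA Q L X) (η : Val X) : Val X :=
  η.delay ((A.exists_delay_equiv η).choose / 2)

/-- `η ⊕ t`: delay by `t`, truncated at the bounds `T_x`. -/
def oplus (A : DTA Q L X) (η : Val X) (t : ℝ≥0) : Val X := fun x => min (A.bound x : ℝ≥0) (η x + t)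

/-- `η` is on the `m`-grid. -/
def OnGrid (A : DTA Q L X) (m : ℕ+) (η : Val X) : Prop :=
  ∀ x, η x ≤ A.bound x ∧ ∃ k : ℕ, η x * (m : ℕ) = k

theorem OnGrid.oplus {A : DTA Q L X} {m : ℕ+} {η : Val X} (h : A.OnGrid m η) :
    A.OnGrid m (A.oplus η ((m : ℕ) : ℝ≥0)⁻¹) := by
  intro x
  refine ⟨min_le_left _ _, ?_⟩
  obtain ⟨k, hk⟩ := (h x).2
  have hm : ((m : ℕ) : ℝ≥0) ≠ 0 := by exact_mod_cast m.ne_zero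
  refine ⟨min (A.bound x * m) (k + 1), ?_⟩
  simp only [DTA.oplus]
  rw [min_mul_of_nonneg _ _ (zero_le : (0 : ℝ≥0) ≤ (m : ℕ)), add_mul, hk, inv_mul_cancel₀ hm]
  push_cast
  rfl

theorem OnGrid.reset {A : DTA Q L X} {m : ℕ+} {η : Val X} (h : A.OnGrid m η) (Y : Set X) :
    A.OnGrid m (η.reset Y) := by
  intro x
  by_cases hx : x ∈ Y
  · simp only [Val.reset, hx, if_true]
    exact ⟨zero_le, 0, by simp⟩
  · simp only [Val.reset, hx, if_false]
    exact h x

theorem finite_onGrid [Finite X] (A : DTA Q L X) (m : ℕ+) : {η | A.OnGrid m η}.Finite := by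
  refine (Set.Finite.pi' fun x =>
    (Set.finite_Iic (A.bound x * m)).image fun k : ℕ => (k : ℝ≥0) / ((m : ℕ) : ℝ≥0)).subset ?_
  intro η h x
  have hm : ((m : ℕ) : ℝ≥0) ≠ 0 := by exact_mod_cast m.ne_zero
  obtain ⟨k, hk⟩ := (h x).2
  refine ⟨k, ?_, ?_⟩
  · have : (k : ℝ≥0) ≤ ((A.bound x * m : ℕ) : ℝ≥0) := by
      rw [← hk, Nat.cast_mul]
      gcongr
      exact (h x).1
    exact_mod_cast this
  · simp only [← hk]
    exact mul_div_cancel_right₀ _ hm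

end DTA

/-! ### The product of a CTMC and a DTA -/

namespace Product

variable {S L Q X : Type*} [Fintype S]

/-- The set of paths from `s` whose timed label word is accepted from `(q, η)`. -/
def acceptedPaths (M : CTMC S L) (A : DTA Q L X) (v : S × Q × Val X) : Set (CTMC.Path S) :=
  {π | (π 0).1 = v.1 ∧ A.Accepts v.2 fun n => (M.label (π n).1, (π n).2)}

/-- The acceptance probability `prob(s, q, η)`. -/
def prob [MeasurableSpace S] [DiscreteMeasurableSpace S] (M : CTMC S L) (A : DTA Q L X)
    (v : S × Q × Val X) : ℝ :=
  (M.pathMeasure v.1).real (acceptedPaths M A v)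

/-- Vertices of the product region graph `G`. -/
abbrev Vertex (S : Type*) (A : DTA Q L X) : Type _ := S × Q × A.Region

/-- Edges of `G`. -/
def Edge (M : CTMC S L) (A : DTA Q L X) (a b : Vertex S A) : Prop :=
  0 < M.P a.1 b.1 ∧ ∃ (η η' : Val X) (t : ℝ≥0), A.region η = a.2.2 ∧ A.region η' = b.2.2 ∧ 0 < t ∧
    ¬ A.Marginal (η.delay t) ∧ (b.2.1, η') = A.step (a.2.1, η) (M.label a.1, t)

/-- The vertex `(s, q, [η]_∼)`. -/
def vertex (A : DTA Q L X) (v : S × Q × Val X) : Vertex S A := (v.1, v.2.1, A.region v.2.2)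

/-- A vertex of `G` is final. -/
def IsFinal {A : DTA Q L X} (a : Vertex S A) : Prop := a.2.1 ∈ A.final

/-- The vertex `a` can reach some final vertex in `G`. -/
def ReachesFinal (M : CTMC S L) (A : DTA Q L X) (a : Vertex S A) : Prop :=
  ∃ b, Relation.ReflTransGen (Edge M A) a b ∧ IsFinal b

/-! ### The discretisation -/

/-- `D_m`: the triples `(s, q, η)` with `η` on the `m`-grid. -/
abbrev Grid (S : Type*) (A : DTA Q L X) (m : ℕ+) : Type _ :=
  {v : S × Q × Val X // A.OnGrid m v.2.2}

instance [Finite Q] [Finite X] (A : DTA Q L X) (m : ℕ+) : Finite (Grid S A m) := by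
  have h : {v : S × Q × Val X | A.OnGrid m v.2.2}.Finite := by
    refine (Set.Finite.prod (Set.finite_univ (α := S))
      (Set.Finite.prod (Set.finite_univ (α := Q)) (A.finite_onGrid m))).subset ?_
    intro v hv
    exact ⟨trivial, trivial, hv⟩
  exact h.to_subtype

/-- `v ⊕ ρ`, where `ρ = 1 / m`. -/
def Grid.delay {A : DTA Q L X} {m : ℕ+} (v : Grid S A m) : Grid S A m :=
  ⟨(v.1.1, v.1.2.1, A.oplus v.1.2.2 ((m : ℕ) : ℝ≥0)⁻¹), v.2.oplus⟩

/-- `v⁺_u`: the rule is the one enabled at `η⁺`, but it is applied to `η`. -/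
def Grid.jump [Finite X] (M : CTMC S L) {A : DTA Q L X} {m : ℕ+} (v : Grid S A m) (u : S) :
    Grid S A m :=
  ⟨(u, (A.ruleAt v.1.2.1 (M.label v.1.1) (A.plus v.1.2.2)).tgt,
    v.1.2.2.reset (A.ruleAt v.1.2.1 (M.label v.1.1) (A.plus v.1.2.2)).resets), v.2.reset _⟩

/-- `v ∈ B_m`: the vertex of `v` is not final and can reach some final vertex. -/
def InB (M : CTMC S L) (A : DTA Q L X) (m : ℕ+) (v : Grid S A m) : Prop :=
  ¬ IsFinal (vertex A v.1) ∧ ReachesFinal M A (vertex A v.1)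

/-- The condition which singles out `B_m^max` inside `B_m`: `η(x) = T_x` for all clocks `x`. -/
def AtMax {A : DTA Q L X} {m : ℕ+} (v : Grid S A m) : Prop := ∀ x, v.1.2.2 x = A.bound x

open Classical in
/-- The right-hand side of the equation of `Γ'_m` for `h[v]` with `v ∈ B_m`. It is linear in the
vector `h` of discrete values. -/
def rhs [Finite X] (M : CTMC S L) (A : DTA Q L X) (m : ℕ+) (h : Grid S A m → ℝ)
    (v : Grid S A m) : ℝ :=
  if AtMax v then ∑ u, M.P v.1.1 u * h (v.jump M u)
  else
    1 / (1 + (m : ℝ)⁻¹ * M.rate v.1.1) * h v.delay +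
      (m : ℝ)⁻¹ * M.rate v.1.1 / (1 + (m : ℝ)⁻¹ * M.rate v.1.1) *
        ∑ u, M.P v.1.1 u * h (v.jump M u)

/-- The system of linear equations `Γ'_m` on vectors `h` over `D_m`. -/
structure IsSolution [Finite X] (M : CTMC S L) (A : DTA Q L X) (m : ℕ+)
    (h : Grid S A m → ℝ) : Prop where
  zero : ∀ v, ¬ ReachesFinal M A (vertex A v.1) → h v = 0
  one : ∀ v, IsFinal (vertex A v.1) → h v = 1
  eq : ∀ v, InB M A m v → h v = rhs M A m h v

/-- `B_m` as an index type. -/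
abbrev B (M : CTMC S L) (A : DTA Q L X) (m : ℕ+) : Type _ := {v : Grid S A m // InB M A m v}

instance [Finite Q] [Finite X] (M : CTMC S L) (A : DTA Q L X) (m : ℕ+) : Fintype (B M A m) :=
  Fintype.ofFinite _

open Classical in
/-- The matrix `C` of `Γ'_m`: its entry at `(v, w)` is the coefficient of `h[w]` in the right-hand
side of the equation for `h[v]`, that is, the value of the linear form at the `w`-th unit vector. -/
def matC [Finite X] (M : CTMC S L) (A : DTA Q L X) (m : ℕ+) : Matrix (B M A m) (B M A m) ℝ :=
  Matrix.of fun v w => rhs M A m (Pi.single w.1 1) v.1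

open Classical in
/-- The vector `d` of `Γ'_m`: the contribution to the right-hand side of the equation for `h[v]` of
the known values outside `B_m` (`1` at final vertices, `0` where no final vertex can be reached). -/
def vecD [Finite X] (M : CTMC S L) (A : DTA Q L X) (m : ℕ+) : B M A m → ℝ :=
  fun v => rhs M A m (fun w => if IsFinal (vertex A w.1) then 1 else 0) v.1

/-! ### Constants -/

/-- `λ_max`. -/
def rateMax (M : CTMC S L) : ℝ := ⨆ s, M.rate s

/-- `λ_min`. -/
def rateMin (M : CTMC S L) : ℝ := ⨅ s, M.rate s

/-- `p_min`: the smallest positive transition probability. -/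
def pMin (M : CTMC S L) : ℝ := sInf {p | 0 < p ∧ ∃ s u, M.P s u = p}

/-- `|V|`: the number of vertices of `G`. -/
def cardV (S : Type*) (A : DTA Q L X) : ℕ := Nat.card (Vertex S A)

/-- `M₁ = |X| · λ_max · T_max · exp (λ_max · T_max)`. -/
def M₁ [Fintype X] (M : CTMC S L) (A : DTA Q L X) : ℝ :=
  Fintype.card X * (rateMax M * A.maxBound) * Real.exp (rateMax M * A.maxBound)

/-- `M₃ = T_max · 2 λ_max · M₁`. -/
def M₃ [Fintype X] (M : CTMC S L) (A : DTA Q L X) : ℝ := A.maxBound * (2 * rateMax M * M₁ M A)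

/-- `𝔠 = exp (-λ_max T_max) · p_min · λ_min / (2 |V|² + λ_min)`. -/
def constC [Fintype X] (M : CTMC S L) (A : DTA Q L X) : ℝ :=
  Real.exp (-(rateMax M * A.maxBound)) * pMin M *
    (rateMin M / (2 * (cardV S A : ℝ) ^ 2 + rateMin M))

end Product

end

/-! The scheme is a finite-difference approximation of the integral equation satisfied by the
acceptance probability, and the error bound is consistency plus stability.

Consistency. Conditioning on the first jump gives the integral equation (`prob_eq_integral`). Two
runs that start in the same location from η and η' and see the same delays can separate only if a
jump falls into a time window during which some clock has passed a constant from one start but not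
from the other. `gap` is the total length of these windows. Since jumps occur at rate at most λ_max,
the acceptance probabilities differ by at most λ_max · `gap` (`abs_probBy_sub_le`, and
`abs_prob_sub_le` in the limit), so they are Lipschitz in the clocks with constant λ_max |X| T_max ≤
M₁. Between two grid points the enabled rule does not change, so exact equation and scheme differ by
O(ρ²) per step (`abs_prob_sub_rhs_le`), and not at all where every clock sits at its bound
(`prob_of_atMax`).

Stability. The absolute error vanishes outside B_m and satisfies the homogeneous equations as
inequalities, up to ε (`IsErrorBound`). Read as a random walk, the scheme leaves B_m with
probability at least 𝔠^|V| along the following strategy: wait until all clocks are at their bounds,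
then imitate a repetition-free path of G to a final vertex. Such a path is followed by a concrete
run (`exists_run`). Its real jump times are replaced by windows of ⌊m/|V|⌋ grid times, arranged by
integer and fractional parts (`exists_windows`), so that every choice of jumps inside the windows
leads to the same comparisons of clocks with constants, hence to the same rules (`Tracks.cmpEquiv`).
Per edge, waiting for the window contributes exp(-λ_max T_max), jumping inside it λ_min/(2|V|² +
λ_min), and choosing the right successor p_min: together 𝔠. At most |V| - 1 edges and the initial
wait give the exponent |V| (`IsErrorBound.le_sub_pow`). Applied at a point of maximal error E this
reads 𝔠^|V| E ≤ |V| (T_max + 1) m ε, which is the bound once ε = O(ρ²) is inserted. With ε = 0 it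
gives uniqueness, and existence follows by finite dimension. -/

namespace DTA

/-! ### Enabled rules and comparison of clocks with constants -/

variable {Q L X : Type*} {A : DTA Q L X}

theorem ruleAt_mem (A : DTA Q L X) (q : Q) (a : L) (η : Val X) : A.ruleAt q a η ∈ A.rules :=
  (A.total q a η).choose_spec.1

theorem ruleAt_src (A : DTA Q L X) (q : Q) (a : L) (η : Val X) : (A.ruleAt q a η).src = q :=
  (A.total q a η).choose_spec.2.1

theorem ruleAt_sig (A : DTA Q L X) (q : Q) (a : L) (η : Val X) : (A.ruleAt q a η).sig = a :=
  (A.total q a η).choose_spec.2.2.1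

theorem ruleAt_sat (A : DTA Q L X) (q : Q) (a : L) (η : Val X) : (A.ruleAt q a η).guard.Sat η :=
  (A.total q a η).choose_spec.2.2.2

theorem ruleAt_eq_iff {q : Q} {a : L} {η : Val X} {r : Rule Q L X} :
    A.ruleAt q a η = r ↔ r ∈ A.rules ∧ r.src = q ∧ r.sig = a ∧ r.guard.Sat η := by
  constructor
  · rintro rfl
    exact ⟨A.ruleAt_mem q a η, A.ruleAt_src q a η, A.ruleAt_sig q a η, A.ruleAt_sat q a η⟩
  · rintro ⟨h1, h2, h3, h4⟩
    exact A.deterministic _ (A.ruleAt_mem q a η) _ h1 ((A.ruleAt_src q a η).trans h2.symm)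
      ((A.ruleAt_sig q a η).trans h3.symm) ⟨η, A.ruleAt_sat q a η, h4⟩

theorem bound_le_bound {r : Rule Q L X} (hr : r ∈ A.rules) {k : Constraint X}
    (hk : k ∈ r.guard) : k.bound ≤ A.bound k.clock := by
  refine le_csSup ?_ ⟨r, hr, k, hk, rfl, rfl⟩
  refine Set.Finite.bddAbove (Set.Finite.subset
    (A.rules_finite.biUnion fun r _ => (List.finite_toSet r.guard).image Constraint.bound) ?_)
  rintro c ⟨r', hr', k', hk', -, rfl⟩
  exact Set.mem_biUnion hr' ⟨k', hk', rfl⟩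

/-- Two valuations compare in the same way with all constants up to the clock bounds. -/
def CmpEquiv (A : DTA Q L X) (η η' : Val X) : Prop :=
  ∀ x, ∀ c : ℕ, c ≤ A.bound x → (η x ≤ c ↔ η' x ≤ c) ∧ (η x < c ↔ η' x < c)

theorem CmpEquiv.sat_iff {η η' : Val X} (h : A.CmpEquiv η η') {r : Rule Q L X}
    (hr : r ∈ A.rules) : r.guard.Sat η ↔ r.guard.Sat η' := by
  refine forall₂_congr fun k hk => ?_
  obtain ⟨h1, h2⟩ := h k.clock k.bound (bound_le_bound hr hk)
  cases k.cmp
  · exact h2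
  · exact h1
  · simpa only [Cmp.Holds, gt_iff_lt, not_le] using not_congr h1
  · simpa only [Cmp.Holds, ge_iff_le, not_lt] using not_congr h2

theorem CmpEquiv.ruleAt_eq {η η' : Val X} (h : A.CmpEquiv η η') (q : Q) (a : L) :
    A.ruleAt q a η = A.ruleAt q a η' :=
  ruleAt_eq_iff.2 ⟨A.ruleAt_mem q a η', A.ruleAt_src q a η', A.ruleAt_sig q a η',
    (h.sat_iff (A.ruleAt_mem q a η')).2 (A.ruleAt_sat q a η')⟩

/-- Up to the bound, the relations y < c and y ≤ c are decided by the integer part of y and by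
whether its fractional part is positive; beyond the bound every relevant constant is exceeded. -/
theorem GuardEquiv.cmpEquiv {η η' : Val X} (h : A.GuardEquiv η η') : A.CmpEquiv η η' := by
  intro x c hc
  have hc' : (c : ℝ≥0) ≤ A.bound x := by exact_mod_cast hc
  by_cases hx : η x ≤ A.bound x
  · have hx' := (h.le_iff x).1 hx
    obtain ⟨h1, h2⟩ := h.2 x hx hx'
    have key : ∀ y : ℝ≥0, (y < c ↔ ⌊(y : ℝ)⌋ < (c : ℤ)) ∧
        (y ≤ c ↔ ⌊(y : ℝ)⌋ < (c : ℤ) ∨ (⌊(y : ℝ)⌋ = (c : ℤ) ∧ ¬ 0 < Int.fract (y : ℝ))) := by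
      intro y
      have e1 : y < c ↔ ⌊(y : ℝ)⌋ < (c : ℤ) := by
        rw [Int.floor_lt, ← NNReal.coe_lt_coe]; simp
      refine ⟨e1, ?_⟩
      rw [le_iff_lt_or_eq, e1]
      refine or_congr_right ⟨?_, ?_⟩
      · rintro rfl
        simp
      · rintro ⟨h3, h4⟩
        have h5 := Int.floor_add_fract (y : ℝ)
        have h6 := Int.fract_nonneg (y : ℝ)
        rw [h3, le_antisymm (not_lt.1 h4) h6] at h5
        apply NNReal.coe_injective
        simpa using h5.symm
    rw [(key (η x)).1, (key (η x)).2, (key (η' x)).1, (key (η' x)).2, h1, h2]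
    exact ⟨Iff.rfl, Iff.rfl⟩
  · have hx' := mt (h.le_iff x).2 hx
    rw [not_le] at hx hx'
    have e1 := hc'.trans_lt hx
    have e2 := hc'.trans_lt hx'
    exact ⟨iff_of_false e1.not_ge e2.not_ge, iff_of_false e1.not_gt e2.not_gt⟩

/-- `A.plus η` is one particular small delay of η. All small positive delays lie in its region, so
its rule may be read off at any of them. -/
theorem exists_ruleAt_plus [Finite X] (A : DTA Q L X) (η : Val X) :
    ∃ t₁ : ℝ≥0, 0 < t₁ ∧ ∀ t : ℝ≥0, 0 < t → t < t₁ → ∀ q a,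
      A.ruleAt q a (A.plus η) = A.ruleAt q a (η.delay t) := by
  obtain ⟨h1, h2⟩ := (A.exists_delay_equiv η).choose_spec
  refine ⟨_, h1, fun t ht ht' q a => ?_⟩
  exact (h2 _ t (half_pos h1) (NNReal.half_lt_self h1.ne') ht ht').1.cmpEquiv.ruleAt_eq q a

theorem bound_le_maxBound [Fintype X] (A : DTA Q L X) (x : X) : A.bound x ≤ A.maxBound :=
  Finset.le_sup (f := A.bound) (Finset.mem_univ x)

end DTA

theorem Val.delay_delay {X : Type*} (η : Val X) (s t : ℝ≥0) :
    (η.delay s).delay t = η.delay (s + t) := by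
  funext x
  simp only [Val.delay, add_assoc]

/-! ### The Markov property at the first jump -/

namespace CTMC

/-- Prepend a state with its dwell time to a timed path. -/
def consPath {S : Type*} (x : S × ℝ≥0) (π : Path S) : Path S
  | 0 => x
  | n + 1 => π n

theorem measurable_consPath {S : Type*} [MeasurableSpace S] (s : S) :
    Measurable fun p : ℝ≥0 × Path S => consPath (s, p.1) p.2 := by
  refine measurable_pi_iff.2 fun n => ?_
  cases n with
  | zero => exact measurable_const.prodMk measurable_fst
  | succ n => exact (measurable_pi_apply n).comp measurable_snd

/-- The family of all measurable boxes. -/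
def boxes (S : Type*) : Set (Set (Path S)) :=
  {D | ∃ (σ : ℕ → S) (I : ℕ → Set ℝ≥0) (l : ℕ), (∀ n, MeasurableSet (I n)) ∧
    D = {π | ∀ n ≤ l, (π n).1 = σ n ∧ (π n).2 ∈ I n}}

/-- If two boxes share a path, their state sequences agree on the shorter range, so the intersection
is again a box, with the longer state sequence. -/
theorem isPiSystem_boxes {S : Type*} : IsPiSystem (boxes S) := by
  have key : ∀ (σ σ' : ℕ → S) (I I' : ℕ → Set ℝ≥0) (l l' : ℕ), l ≤ l' →
      (∀ n, MeasurableSet (I n)) → (∀ n, MeasurableSet (I' n)) →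
      ({π : Path S | ∀ n ≤ l, (π n).1 = σ n ∧ (π n).2 ∈ I n} ∩
        {π | ∀ n ≤ l', (π n).1 = σ' n ∧ (π n).2 ∈ I' n}).Nonempty →
      ({π : Path S | ∀ n ≤ l, (π n).1 = σ n ∧ (π n).2 ∈ I n} ∩
        {π | ∀ n ≤ l', (π n).1 = σ' n ∧ (π n).2 ∈ I' n}) ∈ boxes S := by
    rintro σ σ' I I' l l' hl hI hI' ⟨π₀, h1, h2⟩
    refine ⟨σ', fun n => if n ≤ l then I n ∩ I' n else I' n, l', fun n => ?_, ?_⟩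
    · dsimp only
      split_ifs
      exacts [(hI n).inter (hI' n), hI' n]
    · ext π
      constructor
      · rintro ⟨h3, h4⟩ n hn
        refine ⟨(h4 n hn).1, ?_⟩
        dsimp only
        split_ifs with h
        exacts [⟨(h3 n h).2, (h4 n hn).2⟩, (h4 n hn).2]
      · intro h3
        refine ⟨fun n hn => ?_, fun n hn => ⟨(h3 n hn).1, ?_⟩⟩
        · have h4 := h3 n (hn.trans hl)
          simp only [if_pos hn] at h4
          exact ⟨by rw [h4.1, ← (h2 n (hn.trans hl)).1, (h1 n hn).1], h4.2.1⟩
        · have h4 := (h3 n hn).2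
          dsimp only at h4
          split_ifs at h4
          exacts [h4.2, h4]
  rintro _ ⟨σ, I, l, hI, rfl⟩ _ ⟨σ', I', l', hI', rfl⟩ h
  rcases le_total l l' with hl | hl
  · exact key _ _ _ _ _ _ hl hI hI' h
  · rw [Set.inter_comm] at h ⊢
    exact key _ _ _ _ _ _ hl hI' hI h

variable {S L : Type*} [Fintype S] [MeasurableSpace S] [DiscreteMeasurableSpace S]

/-- The law of the path which remains after the first jump out of `s`. -/
noncomputable def tailMeasure (M : CTMC S L) (s : S) : Measure (Path S) :=
  ∑ u, ENNReal.ofReal (M.P s u) • M.pathMeasure u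

theorem tailMeasure_apply (M : CTMC S L) (s : S) (D : Set (Path S)) :
    M.tailMeasure s D = ∑ u, ENNReal.ofReal (M.P s u) * M.pathMeasure u D := by
  simp only [tailMeasure, Measure.finsetSum_apply, Measure.smul_apply, smul_eq_mul]

instance (M : CTMC S L) (s : S) : IsProbabilityMeasure (M.tailMeasure s) := by
  refine ⟨?_⟩
  simp only [tailMeasure_apply, measure_univ, mul_one]
  rw [← ENNReal.ofReal_sum_of_nonneg (fun u _ => M.P_nonneg s u), M.P_sum, ENNReal.ofReal_one]

/-- A box prescribes all states up to its length. An event about the n-th coordinate is therefore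
split over the finitely many state histories up to n; each piece is a box that restricts only the
n-th dwell time. -/
theorem generateFrom_boxes :
    (MeasurableSpace.pi : MeasurableSpace (Path S)) = MeasurableSpace.generateFrom (boxes S) := by
  apply le_antisymm
  · refine iSup_le fun n => ?_
    rintro _ ⟨D, hD, rfl⟩
    have : ((fun π : Path S => π n) ⁻¹' D) = ⋃ τ : Fin (n + 1) → S,
        {π : Path S | ∀ j ≤ n, (π j).1 = (fun j => τ (Fin.ofNat (n + 1) j)) j ∧
          (π j).2 ∈ (fun j => if j = n then {t | (τ (Fin.last n), t) ∈ D} else Set.univ) j} := by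
      ext π
      simp only [Set.mem_preimage, Set.mem_iUnion, Set.mem_ofPred_eq]
      constructor
      · intro h
        refine ⟨fun j => (π j).1, fun j hj => ⟨?_, ?_⟩⟩
        · simp [Nat.mod_eq_of_lt (Nat.lt_succ_of_le hj)]
        · split_ifs with hjn
          · subst hjn
            simpa using h
          · trivial
      · rintro ⟨τ, hτ⟩
        obtain ⟨h1, h2⟩ := hτ n le_rfl
        rw [if_pos rfl] at h2
        have h3 : Fin.ofNat (n + 1) n = Fin.last n := by
          ext; simp
        rw [h3] at h1
        rw [← Prod.mk.eta (p := π n), h1]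
        exact h2
    rw [this]
    refine MeasurableSet.iUnion fun τ => MeasurableSpace.measurableSet_generateFrom
      ⟨_, _, n, fun j => ?_, rfl⟩
    dsimp only
    split_ifs
    · exact measurable_prodMk_left hD
    · exact MeasurableSet.univ
  · refine MeasurableSpace.generateFrom_le ?_
    rintro _ ⟨σ, I, l, hI, rfl⟩
    have : {π : Path S | ∀ n ≤ l, (π n).1 = σ n ∧ (π n).2 ∈ I n} =
        ⋂ n, ⋂ (_ : n ≤ l), (fun π : Path S => π n) ⁻¹' ({σ n} ×ˢ I n) := by
      ext π
      simp
    rw [this]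
    exact MeasurableSet.iInter fun n => MeasurableSet.iInter fun _ =>
      measurable_pi_apply n ((measurableSet_singleton _).prod (hI n))

/-- The Markov property at the first jump. -/
theorem pathMeasure_eq_map_consPath (M : CTMC S L) (s : S) :
    M.pathMeasure s =
      ((M.dwell s).prod (M.tailMeasure s)).map fun p => consPath (s, p.1) p.2 := by
  have hm := measurable_consPath s
  have : IsProbabilityMeasure
      (((M.dwell s).prod (M.tailMeasure s)).map fun p => consPath (s, p.1) p.2) :=
    Measure.isProbabilityMeasure_map hm.aemeasurable
  refine MeasureTheory.ext_of_generate_finite (boxes S) generateFrom_boxes isPiSystem_boxes ?_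
    (by simp only [measure_univ])
  rintro D ⟨σ, I, l, hI, rfl⟩
  have hD : MeasurableSet {π : Path S | ∀ n ≤ l, (π n).1 = σ n ∧ (π n).2 ∈ I n} := by
    rw [generateFrom_boxes]
    exact MeasurableSpace.measurableSet_generateFrom ⟨σ, I, l, hI, rfl⟩
  rw [Measure.map_apply hm hD, pathMeasure_box M s σ I hI]
  by_cases hs : σ 0 = s
  · cases l with
    | zero =>
      have : (fun p : ℝ≥0 × Path S => consPath (s, p.1) p.2) ⁻¹'
          {π : Path S | ∀ n ≤ 0, (π n).1 = σ n ∧ (π n).2 ∈ I n} = I 0 ×ˢ Set.univ := by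
        ext p
        simp [consPath, hs]
      rw [this, Measure.prod_prod, measure_univ]
      simp [hs]
    | succ l =>
      have : (fun p : ℝ≥0 × Path S => consPath (s, p.1) p.2) ⁻¹'
          {π : Path S | ∀ n ≤ l + 1, (π n).1 = σ n ∧ (π n).2 ∈ I n} =
          I 0 ×ˢ {π : Path S | ∀ n ≤ l, (π n).1 = σ (n + 1) ∧ (π n).2 ∈ I (n + 1)} := by
        ext p
        simp only [Set.mem_preimage, Set.mem_ofPred_eq, Set.mem_prod]
        constructor
        · intro h
          exact ⟨(h 0 (Nat.zero_le _)).2, fun n hn => h (n + 1) (Nat.succ_le_succ hn)⟩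
        · rintro ⟨h1, h2⟩ n hn
          cases n with
          | zero => exact ⟨hs.symm, h1⟩
          | succ n => exact h2 n (Nat.le_of_succ_le_succ hn)
      rw [this, Measure.prod_prod, tailMeasure_apply, Finset.sum_eq_single (σ 1)]
      · rw [pathMeasure_box M (σ 1) (fun n => σ (n + 1)) (fun n => I (n + 1))
          (fun n => hI (n + 1)), Finset.prod_range_succ']
        simp only [hs, zero_add, Set.indicator_of_mem (Set.mem_singleton _), Pi.one_apply,
          one_mul]
        ring
      · intro u _ hu
        rw [pathMeasure_box M u (fun n => σ (n + 1)) (fun n => I (n + 1))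
          (fun n => hI (n + 1))]
        simp [Ne.symm hu]
      · simp
  · have : (fun p : ℝ≥0 × Path S => consPath (s, p.1) p.2) ⁻¹'
        {π : Path S | ∀ n ≤ l, (π n).1 = σ n ∧ (π n).2 ∈ I n} = ∅ := by
      refine Set.eq_empty_of_forall_notMem fun p hp => hs ?_
      exact (hp 0 (Nat.zero_le _)).1.symm
    rw [this]
    simp [hs]

theorem measurable_real_consPath (M : CTMC S L) (s u : S) {D : Set (Path S)}
    (hD : MeasurableSet D) :
    Measurable fun t => (M.pathMeasure u).real {π | consPath (s, t) π ∈ D} :=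
  (measurable_measure_prodMk_left (ν := M.pathMeasure u)
    (measurable_consPath s hD)).ennreal_toReal

/-- Tonelli's theorem for the product of the law of the first dwell time with the law of the
remaining path. -/
theorem pathMeasure_real_eq_integral (M : CTMC S L) (s : S) {D : Set (Path S)}
    (hD : MeasurableSet D) :
    (M.pathMeasure s).real D =
      ∫ t, ∑ u, M.P s u * (M.pathMeasure u).real {π | consPath (s, t) π ∈ D} ∂M.dwell s := by
  have hm := measurable_consPath s
  have h1 : ∀ t, M.tailMeasure s {π | consPath (s, t) π ∈ D} =
      ENNReal.ofReal (∑ u, M.P s u * (M.pathMeasure u).real {π | consPath (s, t) π ∈ D}) := by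
    intro t
    rw [tailMeasure_apply, ENNReal.ofReal_sum_of_nonneg
      (fun u _ => mul_nonneg (M.P_nonneg s u) measureReal_nonneg)]
    refine Finset.sum_congr rfl fun u _ => ?_
    rw [ENNReal.ofReal_mul (M.P_nonneg s u), ofReal_measureReal]
  have h2 : M.pathMeasure s D = ∫⁻ t, ENNReal.ofReal
      (∑ u, M.P s u * (M.pathMeasure u).real {π | consPath (s, t) π ∈ D}) ∂M.dwell s := by
    rw [M.pathMeasure_eq_map_consPath s, Measure.map_apply hm hD, Measure.prod_apply (hm hD)]
    exact lintegral_congr h1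
  rw [integral_eq_lintegral_of_nonneg_ae, Measure.real, h2]
  · exact ae_of_all _ fun t => Finset.sum_nonneg
      fun u _ => mul_nonneg (M.P_nonneg s u) measureReal_nonneg
  · exact (Finset.measurable_sum _ fun u _ =>
      (M.measurable_real_consPath s u hD).const_mul _).aestronglyMeasurable

end CTMC

/-! ### Measurability of runs and the integral equation for acceptance -/

namespace DTA

variable {S Q L X : Type*}

theorem run_succ_eq (A : DTA Q L X) (c : Q × Val X) (w : ℕ → L × ℝ≥0) (n : ℕ) :
    A.run c w (n + 1) = A.run (A.step c (w 0)) (fun k => w (k + 1)) n := by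
  induction n with
  | zero => rfl
  | succ n ih => rw [run, ih]; rfl

theorem Guard.measurableSet_sat (g : Guard X) : MeasurableSet {η : Val X | g.Sat η} := by
  have : {η : Val X | g.Sat η} =
      ⋂ c ∈ {c | c ∈ g}, {η : Val X | c.cmp.Holds (η c.clock) c.bound} := by
    ext η
    simp [Guard.Sat]
  rw [this]
  refine MeasurableSet.biInter (List.finite_toSet g).countable fun c _ => ?_
  have hc : Measurable fun η : Val X => η c.clock := measurable_pi_apply _
  cases h : c.cmp
  · exact measurableSet_lt hc measurable_const
  · exact measurableSet_le hc measurable_const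
  · exact measurableSet_lt measurable_const hc
  · exact measurableSet_le measurable_const hc

/-- There are finitely many rules, and the rule that fires is characterised by its source, signature
and guard; the preimage thus splits into one measurable piece per rule. -/
theorem measurable_step [MeasurableSpace S] [DiscreteMeasurableSpace S] [MeasurableSpace Q]
    [DiscreteMeasurableSpace Q] (A : DTA Q L X) (f : S → L) :
    Measurable fun p : (Q × Val X) × (S × ℝ≥0) => A.step p.1 (f p.2.1, p.2.2) := by
  intro D hD
  have hd : Measurable fun p : (Q × Val X) × (S × ℝ≥0) => p.1.2.delay p.2.2 :=
    measurable_pi_iff.2 fun x =>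
      ((measurable_pi_apply x).comp (measurable_snd.comp measurable_fst)).add
        (measurable_snd.comp measurable_snd)
  have hr : ∀ Y : Set X, Measurable fun η : Val X => η.reset Y := by
    intro Y
    refine measurable_pi_iff.2 fun x => ?_
    by_cases hx : x ∈ Y
    · simp only [Val.reset, hx, if_true]
      exact measurable_const
    · simp only [Val.reset, hx, if_false]
      exact measurable_pi_apply x
  have : (fun p : (Q × Val X) × (S × ℝ≥0) => A.step p.1 (f p.2.1, p.2.2)) ⁻¹' D =
      ⋃ r ∈ A.rules, {p | p.1.1 ∈ ({r.src} : Set Q) ∧ p.2.1 ∈ {s | f s = r.sig} ∧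
        p.1.2.delay p.2.2 ∈ {η : Val X | r.guard.Sat η} ∧
        (r.tgt, (p.1.2.delay p.2.2).reset r.resets) ∈ D} := by
    ext p
    simp only [Set.mem_preimage, Set.mem_iUnion, Set.mem_ofPred_eq, Set.mem_singleton_iff]
    constructor
    · intro h
      exact ⟨_, A.ruleAt_mem p.1.1 (f p.2.1) (p.1.2.delay p.2.2), (A.ruleAt_src _ _ _).symm,
        (A.ruleAt_sig _ _ _).symm, A.ruleAt_sat _ _ _, h⟩
    · rintro ⟨r, h1, h2, h3, h4, h5⟩
      have h6 : A.ruleAt p.1.1 (f p.2.1) (p.1.2.delay p.2.2) = r :=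
        ruleAt_eq_iff.2 ⟨h1, h2.symm, h3.symm, h4⟩
      simpa only [step, h6] using h5
  rw [this]
  refine MeasurableSet.biUnion A.rules_finite.countable fun r _ => ?_
  refine ((measurable_fst.comp measurable_fst) (MeasurableSet.of_discrete (s := {r.src}))).inter
    (((measurable_fst.comp measurable_snd)
      (MeasurableSet.of_discrete (s := {s | f s = r.sig}))).inter
    ((hd (Guard.measurableSet_sat r.guard)).inter ?_))
  exact (measurable_const.prodMk ((hr r.resets).comp hd)) hD

theorem measurable_run [MeasurableSpace S] [DiscreteMeasurableSpace S] [MeasurableSpace Q]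
    [DiscreteMeasurableSpace Q] (A : DTA Q L X) (f : S → L) (c : Q × Val X) (n : ℕ) :
    Measurable fun π : CTMC.Path S => A.run c (fun k => (f (π k).1, (π k).2)) n := by
  induction n with
  | zero => exact measurable_const
  | succ n ih => exact (A.measurable_step f).comp (ih.prodMk (measurable_pi_apply n))

end DTA

namespace Product

variable {S L Q X : Type*} [Fintype S]

/-- The paths whose label word is accepted from the configuration `c`. -/
def accepting (M : CTMC S L) (A : DTA Q L X) (c : Q × Val X) : Set (CTMC.Path S) :=
  {π | A.Accepts c fun n => (M.label (π n).1, (π n).2)}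

/-- The paths whose label word is accepted from the configuration `c` within `n` steps. -/
def acceptingBy (M : CTMC S L) (A : DTA Q L X) (n : ℕ) (c : Q × Val X) : Set (CTMC.Path S) :=
  {π | ∃ k ≤ n, (A.run c (fun n => (M.label (π n).1, (π n).2)) k).1 ∈ A.final}

theorem accepting_eq_iUnion (M : CTMC S L) (A : DTA Q L X) (c : Q × Val X) :
    accepting M A c = ⋃ n, acceptingBy M A n c := by
  ext π
  simp only [accepting, acceptingBy, DTA.Accepts, Set.mem_ofPred_eq, Set.mem_iUnion]
  exact ⟨fun ⟨n, hn⟩ => ⟨n, n, le_rfl, hn⟩, fun ⟨_, k, _, hk⟩ => ⟨k, hk⟩⟩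

theorem acceptingBy_mono (M : CTMC S L) (A : DTA Q L X) (c : Q × Val X) :
    Monotone fun n => acceptingBy M A n c :=
  fun _ _ h _ ⟨k, hk, hk'⟩ => ⟨k, hk.trans h, hk'⟩

theorem consPath_mem_accepting {M : CTMC S L} {A : DTA Q L X} {q : Q} {η : Val X} (hq : q ∉ A.final)
    (s : S) (t : ℝ≥0) (π : CTMC.Path S) :
    CTMC.consPath (s, t) π ∈ accepting M A (q, η) ↔
      π ∈ accepting M A (A.step (q, η) (M.label s, t)) := by
  constructor
  · rintro ⟨n, hn⟩
    cases n with
    | zero => exact absurd hn hq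
    | succ n =>
      rw [DTA.run_succ_eq] at hn
      exact ⟨n, hn⟩
  · rintro ⟨n, hn⟩
    refine ⟨n + 1, ?_⟩
    rw [DTA.run_succ_eq]
    exact hn

theorem consPath_mem_acceptingBy {M : CTMC S L} {A : DTA Q L X} {q : Q} {η : Val X}
    (hq : q ∉ A.final) (s : S) (t : ℝ≥0) (π : CTMC.Path S) (n : ℕ) :
    CTMC.consPath (s, t) π ∈ acceptingBy M A (n + 1) (q, η) ↔
      π ∈ acceptingBy M A n (A.step (q, η) (M.label s, t)) := by
  constructor
  · rintro ⟨k, hk, hk'⟩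
    cases k with
    | zero => exact absurd hk' hq
    | succ k =>
      rw [DTA.run_succ_eq] at hk'
      exact ⟨k, Nat.le_of_succ_le_succ hk, hk'⟩
  · rintro ⟨k, hk, hk'⟩
    refine ⟨k + 1, Nat.succ_le_succ hk, ?_⟩
    rw [DTA.run_succ_eq]
    exact hk'

theorem sum_mul_mem_Icc (M : CTMC S L) (s : S) {f : S → ℝ} (h0 : ∀ u, 0 ≤ f u)
    (h1 : ∀ u, f u ≤ 1) : ∑ u, M.P s u * f u ∈ Set.Icc (0 : ℝ) 1 := by
  refine ⟨Finset.sum_nonneg fun u _ => mul_nonneg (M.P_nonneg s u) (h0 u), ?_⟩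
  rw [← M.P_sum s]
  exact Finset.sum_le_sum fun u _ => mul_le_of_le_one_right (M.P_nonneg s u) (h1 u)

variable [MeasurableSpace S] [DiscreteMeasurableSpace S]

theorem measurableSet_acceptingBy (M : CTMC S L) (A : DTA Q L X) (n : ℕ)
    (c : Q × Val X) : MeasurableSet (acceptingBy M A n c) := by
  let _ : MeasurableSpace Q := ⊤
  have : acceptingBy M A n c = ⋃ k, ⋃ (_ : k ≤ n),
      (fun π => A.run c (fun n => (M.label (π n).1, (π n).2)) k) ⁻¹' (Prod.fst ⁻¹' A.final) := by
    ext π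
    simp [acceptingBy]
  rw [this]
  exact MeasurableSet.iUnion fun k => MeasurableSet.iUnion fun _ =>
    A.measurable_run M.label c k (measurable_fst (MeasurableSet.of_discrete))

theorem measurableSet_accepting (M : CTMC S L) (A : DTA Q L X) (c : Q × Val X) :
    MeasurableSet (accepting M A c) := by
  rw [accepting_eq_iUnion]
  exact MeasurableSet.iUnion fun n => measurableSet_acceptingBy M A n c

/-- The probability of acceptance within `n` steps. -/
noncomputable def probBy (M : CTMC S L) (A : DTA Q L X) (n : ℕ) (v : S × Q × Val X) : ℝ :=
  (M.pathMeasure v.1).real (acceptingBy M A n v.2)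

/-- The prescribed initial state is almost sure under the path measure. Dropping it leaves an event
that behaves well under prepending a first jump. -/
theorem prob_eq (M : CTMC S L) (A : DTA Q L X) (v : S × Q × Val X) :
    prob M A v = (M.pathMeasure v.1).real (accepting M A v.2) := by
  have h1 : MeasurableSet (acceptedPaths M A v) :=
    ((measurable_fst.comp (measurable_pi_apply 0))
      (MeasurableSet.of_discrete (s := {v.1}))).inter (measurableSet_accepting M A v.2)
  rw [prob, Measure.real, Measure.real, CTMC.pathMeasure_eq_map_consPath,
    Measure.map_apply (CTMC.measurable_consPath _) h1,
    Measure.map_apply (CTMC.measurable_consPath _) (measurableSet_accepting M A v.2)]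
  congr 2
  ext p
  exact ⟨fun h => h.2, fun h => ⟨rfl, h⟩⟩

theorem prob_nonneg (M : CTMC S L) (A : DTA Q L X) (v : S × Q × Val X) : 0 ≤ prob M A v :=
  measureReal_nonneg

theorem prob_le_one (M : CTMC S L) (A : DTA Q L X) (v : S × Q × Val X) : prob M A v ≤ 1 :=
  measureReal_le_one

theorem probBy_nonneg (M : CTMC S L) (A : DTA Q L X) (n : ℕ) (v : S × Q × Val X) :
    0 ≤ probBy M A n v :=
  measureReal_nonneg

theorem probBy_le_one (M : CTMC S L) (A : DTA Q L X) (n : ℕ) (v : S × Q × Val X) :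
    probBy M A n v ≤ 1 :=
  measureReal_le_one

/-- Continuity from below. It makes statements about the acceptance probability accessible to
induction on the number of steps. -/
theorem tendsto_probBy (M : CTMC S L) (A : DTA Q L X) (v : S × Q × Val X) :
    Filter.Tendsto (fun n => probBy M A n v) Filter.atTop (nhds (prob M A v)) := by
  rw [prob_eq, accepting_eq_iUnion]
  exact (ENNReal.tendsto_toReal (measure_ne_top _ _)).comp
    (tendsto_measure_iUnion_atTop (acceptingBy_mono M A v.2))

theorem prob_of_final (M : CTMC S L) {A : DTA Q L X} {v : S × Q × Val X} (hv : v.2.1 ∈ A.final) :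
    prob M A v = 1 := by
  have : accepting M A v.2 = Set.univ := Set.eq_univ_of_forall fun π => ⟨0, hv⟩
  rw [prob_eq, this, probReal_univ]

theorem probBy_of_final (M : CTMC S L) {A : DTA Q L X} (n : ℕ) {v : S × Q × Val X}
    (hv : v.2.1 ∈ A.final) : probBy M A n v = 1 := by
  have : acceptingBy M A n v.2 = Set.univ :=
    Set.eq_univ_of_forall fun π => ⟨0, Nat.zero_le _, hv⟩
  rw [probBy, this, probReal_univ]

theorem probBy_zero (M : CTMC S L) {A : DTA Q L X} {v : S × Q × Val X}
    (hv : v.2.1 ∉ A.final) : probBy M A 0 v = 0 := by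
  have : acceptingBy M A 0 v.2 = ∅ := by
    refine Set.eq_empty_of_forall_notMem fun π ⟨k, hk, hk'⟩ => hv ?_
    obtain rfl := Nat.le_zero.1 hk
    exact hk'
  rw [probBy, this, measureReal_empty]

theorem measurable_prob_step (M : CTMC S L) {A : DTA Q L X} {q : Q} (hq : q ∉ A.final)
    (s u : S) (η : Val X) :
    Measurable fun t => prob M A (u, A.step (q, η) (M.label s, t)) := by
  have h := M.measurable_real_consPath s u (measurableSet_accepting M A (q, η))
  simp only [consPath_mem_accepting hq] at h
  simp only [prob_eq]
  exact h

theorem measurable_probBy_step (M : CTMC S L) {A : DTA Q L X} {q : Q} (hq : q ∉ A.final)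
    (s u : S) (η : Val X) (n : ℕ) :
    Measurable fun t => probBy M A n (u, A.step (q, η) (M.label s, t)) := by
  have h := M.measurable_real_consPath s u (measurableSet_acceptingBy M A (n + 1) (q, η))
  simp only [consPath_mem_acceptingBy hq] at h
  exact h

theorem prob_eq_integral (M : CTMC S L) {A : DTA Q L X} {q : Q} (hq : q ∉ A.final)
    (s : S) (η : Val X) :
    prob M A (s, q, η) =
      ∫ t, ∑ u, M.P s u * prob M A (u, A.step (q, η) (M.label s, t)) ∂M.dwell s := by
  have h := M.pathMeasure_real_eq_integral s (measurableSet_accepting M A (q, η))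
  simp only [consPath_mem_accepting hq] at h
  simp only [prob_eq]
  exact h

theorem probBy_eq_integral (M : CTMC S L) {A : DTA Q L X} {q : Q} (hq : q ∉ A.final)
    (s : S) (η : Val X) (n : ℕ) :
    probBy M A (n + 1) (s, q, η) =
      ∫ t, ∑ u, M.P s u * probBy M A n (u, A.step (q, η) (M.label s, t)) ∂M.dwell s := by
  have h := M.pathMeasure_real_eq_integral s (measurableSet_acceptingBy M A (n + 1) (q, η))
  simp only [consPath_mem_acceptingBy hq] at h
  exact h

theorem integrable_sum_probBy (M : CTMC S L) {A : DTA Q L X} {q : Q} (hq : q ∉ A.final)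
    (s : S) (η : Val X) (n : ℕ) :
    Integrable (fun t => ∑ u, M.P s u * probBy M A n (u, A.step (q, η) (M.label s, t)))
      (M.dwell s) := by
  refine Integrable.of_mem_Icc 0 1 (Finset.measurable_sum _ fun u _ =>
    (measurable_probBy_step M hq s u η n).const_mul _).aemeasurable (ae_of_all _ fun t => ?_)
  exact sum_mul_mem_Icc M s (fun u => probBy_nonneg M A n _) fun u => probBy_le_one M A n _

end Product

/-! ### Integrals against the exponential dwell time -/

namespace CTMC

variable {S L : Type*} [Fintype S]

instance (M : CTMC S L) (s : S) : NullSingletonClass (M.dwell s) := by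
  refine ⟨fun t => ?_⟩
  rw [M.dwell_apply s (measurableSet_singleton t), Set.image_singleton]
  exact setLIntegral_measure_zero _ _ Real.volume_singleton

theorem integral_dwell (M : CTMC S L) (s : S) {f : ℝ≥0 → ℝ} (hf : Measurable f) :
    ∫ t, f t ∂M.dwell s =
      ∫ t in Set.Ici (0 : ℝ), M.rate s * Real.exp (-(M.rate s * t)) * f t.toNNReal := by
  have h1 : Measurable (exponentialPDF (M.rate s)) :=
    (measurable_exponentialPDFReal _).ennreal_ofReal
  have h2 : expMeasure (M.rate s) = volume.withDensity (exponentialPDF (M.rate s)) := rfl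
  rw [dwell, integral_map measurable_real_toNNReal.aemeasurable hf.aestronglyMeasurable, h2,
    integral_withDensity_eq_integral_toReal_smul h1
      (ae_of_all _ fun x => by simp [exponentialPDF]), ← integral_indicator measurableSet_Ici]
  refine integral_congr_ae (ae_of_all _ fun x => ?_)
  by_cases hx : 0 ≤ x
  · have h3 : 0 ≤ M.rate s * Real.exp (-(M.rate s * x)) :=
      mul_nonneg (M.rate_pos s).le (Real.exp_pos _).le
    simp only [Set.indicator_of_mem (Set.mem_Ici.2 hx), exponentialPDF_of_nonneg hx,
      ENNReal.toReal_ofReal h3, smul_eq_mul]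
  · simp only [Set.indicator_of_notMem (mt Set.mem_Ici.1 hx),
      exponentialPDF_of_neg (not_le.1 hx), ENNReal.toReal_zero, zero_smul]

theorem integral_dwell_of_support (M : CTMC S L) (s : S) {f : ℝ≥0 → ℝ} (hf : Measurable f)
    {a b : ℝ} (ha : 0 ≤ a) (hab : a ≤ b) (h : ∀ t : ℝ≥0, (t : ℝ) ∉ Set.Icc a b → f t = 0) :
    ∫ t, f t ∂M.dwell s =
      ∫ t in a..b, M.rate s * Real.exp (-(M.rate s * t)) * f t.toNNReal := by
  rw [M.integral_dwell s hf, intervalIntegral.integral_of_le hab, ← integral_Icc_eq_integral_Ioc]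
  refine (setIntegral_eq_of_subset_of_forall_sdiff_eq_zero measurableSet_Ici
    (fun t ht => ha.trans ht.1) fun t ht => ?_)
  rw [h _ (by rw [Real.coe_toNNReal t ht.1]; exact ht.2), mul_zero]

theorem dwell_real_Icc (M : CTMC S L) (s : S) {a b : ℝ} (ha : 0 ≤ a) (hab : a ≤ b) :
    ∫ t : ℝ≥0, (Set.Icc a b).indicator 1 (t : ℝ) ∂M.dwell s =
      Real.exp (-(M.rate s * a)) - Real.exp (-(M.rate s * b)) := by
  rw [M.integral_dwell_of_support s (f := fun t : ℝ≥0 => (Set.Icc a b).indicator 1 (t : ℝ))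
    ((measurable_one.indicator measurableSet_Icc).comp measurable_coe_nnreal_real) ha hab
    fun t ht => Set.indicator_of_notMem ht _]
  rw [intervalIntegral.integral_congr
    (g := fun t => M.rate s * Real.exp (-(M.rate s * t))) fun t ht => ?_]
  · rw [intervalIntegral.integral_eq_sub_of_hasDerivAt
      (f := fun t => -Real.exp (-(M.rate s * t)))]
    · ring
    · intro t _
      have := (((hasDerivAt_id t).const_mul (M.rate s)).neg.exp).neg
      refine this.congr_deriv ?_
      simp only [id, Pi.neg_apply]
      ring
    · exact Continuous.intervalIntegrable (by fun_prop) _ _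
  · rw [Set.uIcc_of_le hab] at ht
    simp only [Real.coe_toNNReal t (ha.trans ht.1), Set.indicator_of_mem ht, Pi.one_apply, mul_one]

theorem integral_dwell_pos_part (M : CTMC S L) (s : S) {b : ℝ} (hb : 0 ≤ b) :
    ∫ t : ℝ≥0, max (b - t) 0 ∂M.dwell s =
      b - (1 - Real.exp (-(M.rate s * b))) / M.rate s := by
  have h0 := (M.rate_pos s).ne'
  rw [M.integral_dwell_of_support s (by fun_prop) le_rfl hb fun t ht => max_eq_right ?_]
  · rw [intervalIntegral.integral_congr
      (g := fun t => M.rate s * Real.exp (-(M.rate s * t)) * (b - t)) fun t ht => ?_]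
    · rw [intervalIntegral.integral_eq_sub_of_hasDerivAt
        (f := fun t => -Real.exp (-(M.rate s * t)) * (b - t) +
          Real.exp (-(M.rate s * t)) / M.rate s)]
      · simp only [mul_zero, neg_zero, Real.exp_zero, sub_zero, sub_self]
        ring
      · intro t _
        have h1 := ((hasDerivAt_id t).const_mul (M.rate s)).neg.exp
        have h2 := (h1.neg.mul ((hasDerivAt_id t).const_sub b)).add (h1.div_const (M.rate s))
        refine h2.congr_deriv ?_
        simp only [id, Pi.neg_apply]
        field_simp
        ring
      · exact Continuous.intervalIntegrable (by fun_prop) _ _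
    · rw [Set.uIcc_of_le hb] at ht
      simp only [Real.coe_toNNReal t ht.1, max_eq_left (sub_nonneg.2 ht.2)]
  · by_contra hc
    exact ht ⟨t.coe_nonneg, by linarith [not_le.1 hc]⟩

theorem integrable_indicator_Icc (M : CTMC S L) (s : S) (a b : ℝ) :
    Integrable (fun t : ℝ≥0 => (Set.Icc a b).indicator (1 : ℝ → ℝ) (t : ℝ)) (M.dwell s) := by
  refine Integrable.of_mem_Icc 0 1
    ((measurable_one.indicator measurableSet_Icc).comp measurable_coe_nnreal_real).aemeasurable
    (ae_of_all _ fun t => ?_)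
  by_cases ht : (t : ℝ) ∈ Set.Icc a b
  · simp only [Set.indicator_of_mem ht, Pi.one_apply, Set.mem_Icc, zero_le_one, le_refl, and_self]
  · simp only [Set.indicator_of_notMem ht, Set.mem_Icc, zero_le_one, le_refl, and_self]

theorem integrable_pos_part (M : CTMC S L) (s : S) (b : ℝ) :
    Integrable (fun t : ℝ≥0 => max (b - t) 0) (M.dwell s) := by
  refine Integrable.of_mem_Icc 0 (max b 0) (by fun_prop) (ae_of_all _ fun t => ?_)
  exact ⟨le_max_right _ _, max_le_max_right _ (sub_le_self _ t.coe_nonneg)⟩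

/-- The cost of jumping inside the window `[a, b]`, plus `Λ` times the part of it still ahead at the
jump, is on average at most `Λ` times its length. -/
theorem integral_window_le (M : CTMC S L) (s : S) {Λ : ℝ} (hΛ : M.rate s ≤ Λ) {a b : ℝ}
    (ha : 0 ≤ a) (hab : a ≤ b) :
    ∫ t : ℝ≥0, ((Set.Icc a b).indicator 1 (t : ℝ) + Λ * (max (b - t) 0 - max (a - t) 0))
      ∂M.dwell s ≤ Λ * (b - a) := by
  have h0 := M.rate_pos s
  have hi : Integrable (fun t : ℝ≥0 => Λ * (max (b - t) 0 - max (a - t) 0)) (M.dwell s) :=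
    ((M.integrable_pos_part s b).sub (M.integrable_pos_part s a)).const_mul Λ
  rw [integral_add (M.integrable_indicator_Icc s a b) hi,
    integral_const_mul, integral_sub (M.integrable_pos_part s b) (M.integrable_pos_part s a),
    M.dwell_real_Icc s ha hab, M.integral_dwell_pos_part s ha,
    M.integral_dwell_pos_part s (ha.trans hab)]
  -- `u` is the probability of a jump inside the window, and `u / λ(s)` is the expected length of
  -- the part of the window that has elapsed by the time of the jump. As λ(s) ≤ Λ, the elapsed part
  -- pays for the jump.
  set u := Real.exp (-(M.rate s * a)) - Real.exp (-(M.rate s * b)) with hu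
  have hu0 : 0 ≤ u := by
    refine sub_nonneg.2 (Real.exp_le_exp.2 ?_)
    nlinarith
  have h1 : u ≤ Λ * (u / M.rate s) := by
    rw [mul_div_assoc', le_div_iff₀ h0, mul_comm]
    exact mul_le_mul_of_nonneg_right hΛ hu0
  have h2 : b - (1 - Real.exp (-(M.rate s * b))) / M.rate s -
      (a - (1 - Real.exp (-(M.rate s * a))) / M.rate s) = b - a - u / M.rate s := by
    rw [hu]; ring
  rw [h2]
  linarith

end CTMC

/-! ### Lipschitz dependence of the acceptance probability on the clocks -/

namespace DTA

variable {Q L X : Type*}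

/-- How much of the waiting time separates `η` from `η'` by a clock passing a constant. -/
noncomputable def gap [Fintype X] (A : DTA Q L X) (η η' : Val X) : ℝ :=
  ∑ x, ∑ c ∈ Finset.Icc 1 (A.bound x), |max ((c : ℝ) - η x) 0 - max ((c : ℝ) - η' x) 0|

theorem gap_nonneg [Fintype X] (A : DTA Q L X) (η η' : Val X) : 0 ≤ A.gap η η' :=
  Finset.sum_nonneg fun _ _ => Finset.sum_nonneg fun _ _ => abs_nonneg _

theorem gap_reset_le [Fintype X] (A : DTA Q L X) (η η' : Val X) (Y : Set X) :
    A.gap (η.reset Y) (η'.reset Y) ≤ A.gap η η' := by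
  refine Finset.sum_le_sum fun x _ => Finset.sum_le_sum fun c _ => ?_
  by_cases hx : x ∈ Y
  · simp [Val.reset, hx]
  · simp [Val.reset, hx]

/-- A clock has at most T_max windows, one per positive constant up to its bound, and truncation at
0 only shortens them. -/
theorem gap_le [Fintype X] (A : DTA Q L X) {η η' : Val X} {d : ℝ}
    (h : ∀ x, |(η x : ℝ) - η' x| ≤ d) : A.gap η η' ≤ Fintype.card X * A.maxBound * d := by
  have h1 : ∀ x, ∑ c ∈ Finset.Icc 1 (A.bound x),
      |max ((c : ℝ) - η x) 0 - max ((c : ℝ) - η' x) 0| ≤ A.maxBound * d := by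
    intro x
    have h2 : ∀ c ∈ Finset.Icc 1 (A.bound x),
        |max ((c : ℝ) - η x) 0 - max ((c : ℝ) - η' x) 0| ≤ d := by
      intro c _
      refine (abs_max_sub_max_le_abs _ _ _).trans ?_
      rw [sub_sub_sub_cancel_left, abs_sub_comm]
      exact h x
    refine (Finset.sum_le_card_nsmul _ _ _ h2).trans ?_
    rw [Nat.card_Icc, Nat.add_sub_cancel, nsmul_eq_mul]
    have hd : 0 ≤ d := (abs_nonneg _).trans (h x)
    have h3 : (A.bound x : ℝ) ≤ A.maxBound := by exact_mod_cast A.bound_le_maxBound x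
    exact mul_le_mul_of_nonneg_right h3 hd
  refine (Finset.sum_le_card_nsmul _ _ _ fun x _ => h1 x).trans ?_
  rw [nsmul_eq_mul, Finset.card_univ, mul_assoc]

theorem gap_eq_zero [Fintype X] {A : DTA Q L X} {η η' : Val X}
    (h : ∀ x, η x = η' x ∨ (A.bound x ≤ η x ∧ A.bound x ≤ η' x)) : A.gap η η' = 0 := by
  refine Finset.sum_eq_zero fun x _ => Finset.sum_eq_zero fun c hc => ?_
  rcases h x with h | ⟨h1, h2⟩
  · simp [h]
  · have hc : (c : ℝ) ≤ A.bound x := by exact_mod_cast (Finset.mem_Icc.1 hc).2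
    have h1' : (A.bound x : ℝ) ≤ η x := by exact_mod_cast h1
    have h2' : (A.bound x : ℝ) ≤ η' x := by exact_mod_cast h2
    rw [max_eq_right (by linarith), max_eq_right (by linarith)]
    simp

end DTA

namespace DTA

variable {Q L X : Type*} {A : DTA Q L X}

/-- Outside the closed window of c, both clocks are strictly below c or both strictly above it. The
constant 0 needs no window, because every clock is positive after a positive delay. -/
theorem cmpEquiv_delay {η η' : Val X} {t : ℝ≥0} (ht : 0 < t)
    (h : ∀ x, ∀ c ∈ Finset.Icc 1 (A.bound x), (t : ℝ) ∉
      Set.Icc (max ((c : ℝ) - max (η x : ℝ) (η' x)) 0) (max ((c : ℝ) - min (η x : ℝ) (η' x)) 0)) :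
    A.CmpEquiv (η.delay t) (η'.delay t) := by
  have ht' : (0 : ℝ) < t := ht
  intro x c hc
  simp only [Val.delay, ← NNReal.coe_le_coe, ← NNReal.coe_lt_coe, NNReal.coe_add,
    NNReal.coe_natCast]
  have h1 := (η x).coe_nonneg
  have h2 := (η' x).coe_nonneg
  rcases Nat.eq_zero_or_pos c with rfl | hc0
  · simp only [Nat.cast_zero]
    constructor <;> exact iff_of_false (by linarith) (by linarith)
  · have h3 := h x c (Finset.mem_Icc.2 ⟨hc0, hc⟩)
    rw [Set.mem_Icc, not_and_or, not_le, not_le] at h3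
    have h4 := le_max_left (η x : ℝ) (η' x)
    have h5 := le_max_right (η x : ℝ) (η' x)
    have h6 := min_le_left (η x : ℝ) (η' x)
    have h7 := min_le_right (η x : ℝ) (η' x)
    rcases h3 with h3 | h3
    · rcases lt_max_iff.1 h3 with h3 | h3
      · constructor <;> exact iff_of_true (by linarith) (by linarith)
      · linarith
    · have h3 := (max_lt_iff.1 h3).1
      constructor <;> exact iff_of_false (by linarith) (by linarith)

end DTA

/-- Identifies a summand of `gap` with the length of the corresponding window, truncated at time 0.
-/
theorem abs_pos_part_sub_pos_part (c a b : ℝ) :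
    |max (c - a) 0 - max (c - b) 0| = max (c - min a b) 0 - max (c - max a b) 0 := by
  rcases le_total a b with h | h
  · rw [min_eq_left h, max_eq_right h, abs_of_nonneg]
    exact sub_nonneg.2 (max_le_max_right _ (by linarith))
  · rw [min_eq_right h, max_eq_left h, abs_sub_comm, abs_of_nonneg]
    exact sub_nonneg.2 (max_le_max_right _ (by linarith))

theorem pos_part_pos_part_sub (d : ℝ) {t : ℝ} (ht : 0 ≤ t) :
    max (max d 0 - t) 0 = max (d - t) 0 := by
  rcases le_total d 0 with h | h
  · rw [max_eq_right h, max_eq_right (by linarith), max_eq_right (by linarith)]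
  · rw [max_eq_left h]

namespace Product

variable {S L Q X : Type*} [Fintype S]

theorem rate_le_rateMax (M : CTMC S L) (s : S) : M.rate s ≤ rateMax M :=
  le_ciSup (Set.finite_range M.rate).bddAbove s

theorem rateMin_le_rate (M : CTMC S L) (s : S) : rateMin M ≤ M.rate s :=
  ciInf_le (Set.finite_range M.rate).bddBelow s

theorem rateMax_pos (M : CTMC S L) (s : S) : 0 < rateMax M :=
  (M.rate_pos s).trans_le (rate_le_rateMax M s)

theorem abs_sum_mul_sub_sum_mul_le (M : CTMC S L) (s : S) {f g : S → ℝ} {d : ℝ}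
    (h : ∀ u, |f u - g u| ≤ d) : |∑ u, M.P s u * f u - ∑ u, M.P s u * g u| ≤ d := by
  rw [← Finset.sum_sub_distrib]
  refine (Finset.abs_sum_le_sum_abs _ _).trans ?_
  calc ∑ u, |M.P s u * f u - M.P s u * g u| ≤ ∑ u, M.P s u * d := by
        refine Finset.sum_le_sum fun u _ => ?_
        rw [← mul_sub, abs_mul, abs_of_nonneg (M.P_nonneg s u)]
        exact mul_le_mul_of_nonneg_left (h u) (M.P_nonneg s u)
    _ = d := by rw [← Finset.sum_mul, M.P_sum, one_mul]

variable [MeasurableSpace S] [DiscreteMeasurableSpace S]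

/-- Induction on the number of steps. If the first delay avoids all windows, both runs fire the same
rule and the remaining gap bounds the difference; if it hits a window, the difference is at most 1.
By `integral_window_le` the expected total cost of each window is at most λ_max times its length, so
the constant does not grow with `n`. -/
theorem abs_probBy_sub_le [Fintype X] (M : CTMC S L) (A : DTA Q L X) (n : ℕ) (s : S) (q : Q)
    (η η' : Val X) :
    |probBy M A n (s, q, η) - probBy M A n (s, q, η')| ≤ rateMax M * A.gap η η' := by
  have hnn : ∀ ζ ζ', 0 ≤ rateMax M * A.gap ζ ζ' := fun ζ ζ' =>
    mul_nonneg (rateMax_pos M s).le (A.gap_nonneg ζ ζ')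
  induction n generalizing s q η η' with
  | zero =>
    by_cases hq : q ∈ A.final
    · rw [probBy_of_final M 0 (v := (s, q, η)) hq, probBy_of_final M 0 (v := (s, q, η')) hq,
        sub_self, abs_zero]
      exact hnn _ _
    · rw [probBy_zero M (v := (s, q, η)) hq, probBy_zero M (v := (s, q, η')) hq,
        sub_self, abs_zero]
      exact hnn _ _
  | succ n ih =>
    by_cases hq : q ∈ A.final
    · rw [probBy_of_final M _ (v := (s, q, η)) hq, probBy_of_final M _ (v := (s, q, η')) hq,
        sub_self, abs_zero]
      exact hnn _ _
    rw [probBy_eq_integral M hq, probBy_eq_integral M hq,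
      ← integral_sub (integrable_sum_probBy M hq s η n) (integrable_sum_probBy M hq s η' n)]
    refine abs_integral_le_integral_abs.trans ?_
    let lo : X → ℕ → ℝ := fun x c => max ((c : ℝ) - max (η x : ℝ) (η' x)) 0
    let hi : X → ℕ → ℝ := fun x c => max ((c : ℝ) - min (η x : ℝ) (η' x)) 0
    have hlo : ∀ x c, 0 ≤ lo x c := fun x c => le_max_right _ _
    have hlh : ∀ x c, lo x c ≤ hi x c := fun x c =>
      max_le_max_right _ (sub_le_sub_left min_le_max _)
    -- What the window of `x` and `c` is charged for a jump at time `t`: 1 for a hit, plus λ_max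
    -- times the part of the window still ahead.
    let W : X → ℕ → ℝ≥0 → ℝ := fun x c t => (Set.Icc (lo x c) (hi x c)).indicator 1 (t : ℝ) +
      rateMax M * (max (hi x c - t) 0 - max (lo x c - t) 0)
    have hW1 : ∀ x c t, 0 ≤ max (hi x c - (t : ℝ≥0)) 0 - max (lo x c - t) 0 := fun x c t =>
      sub_nonneg.2 (max_le_max_right _ (sub_le_sub_right (hlh x c) _))
    have hind : ∀ x c (t : ℝ≥0), 0 ≤ (Set.Icc (lo x c) (hi x c)).indicator (1 : ℝ → ℝ) (t : ℝ) :=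
      fun x c t => Set.indicator_nonneg (fun _ _ => zero_le_one) _
    have hW : ∀ x c t, 0 ≤ W x c t := fun x c t =>
      add_nonneg (hind x c t) (mul_nonneg (rateMax_pos M s).le (hW1 x c t))
    have hWi : ∀ x c, Integrable (W x c) (M.dwell s) := fun x c =>
      (M.integrable_indicator_Icc s _ _).add
        (((M.integrable_pos_part s _).sub (M.integrable_pos_part s _)).const_mul _)
    have hpt : ∀ᵐ t ∂M.dwell s,
        |∑ u, M.P s u * probBy M A n (u, A.step (q, η) (M.label s, t)) -
          ∑ u, M.P s u * probBy M A n (u, A.step (q, η') (M.label s, t))| ≤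
        ∑ x, ∑ c ∈ Finset.Icc 1 (A.bound x), W x c t := by
      -- After delay 0 a comparison with the constant 0 could still separate the valuations.
      have h0 : ∀ᵐ t ∂M.dwell s, t ≠ 0 := by
        rw [ae_iff]
        simp only [not_not, Set.ofPred_eq_eq_singleton]
        exact measure_singleton 0
      filter_upwards [h0] with t ht
      by_cases hbad : ∀ x, ∀ c ∈ Finset.Icc 1 (A.bound x), (t : ℝ) ∉ Set.Icc (lo x c) (hi x c)
      · have hr := (DTA.cmpEquiv_delay (pos_iff_ne_zero.2 ht) hbad).ruleAt_eq q (M.label s)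
        refine (abs_sum_mul_sub_sum_mul_le M s (d := rateMax M *
          A.gap (η.delay t) (η'.delay t)) fun u => ?_).trans ?_
        · simp only [DTA.step, hr]
          exact (ih _ _ _ _).trans
            (mul_le_mul_of_nonneg_left (A.gap_reset_le _ _ _) (rateMax_pos M s).le)
        · rw [DTA.gap, Finset.mul_sum]
          refine Finset.sum_le_sum fun x _ => ?_
          rw [Finset.mul_sum]
          refine Finset.sum_le_sum fun c _ => ?_
          have e : |max ((c : ℝ) - (η.delay t) x) 0 - max ((c : ℝ) - (η'.delay t) x) 0| =
              max (hi x c - t) 0 - max (lo x c - t) 0 := by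
            rw [abs_pos_part_sub_pos_part, pos_part_pos_part_sub _ t.coe_nonneg,
              pos_part_pos_part_sub _ t.coe_nonneg]
            simp only [Val.delay, NNReal.coe_add, min_add_add_right, max_add_add_right,
              sub_add_eq_sub_sub]
          rw [e]
          exact le_add_of_nonneg_left (hind x c t)
      · push Not at hbad
        obtain ⟨x, c, hc, hxc⟩ := hbad
        have h1 : 1 ≤ W x c t := by
          simp only [W, Set.indicator_of_mem hxc, Pi.one_apply]
          exact le_add_of_nonneg_right (mul_nonneg (rateMax_pos M s).le (hW1 x c t))
        have h2 : W x c t ≤ ∑ x, ∑ c ∈ Finset.Icc 1 (A.bound x), W x c t :=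
          (Finset.single_le_sum (f := fun c => W x c t) (fun c _ => hW x c t) hc).trans
            (Finset.single_le_sum (f := fun x => ∑ c ∈ Finset.Icc 1 (A.bound x), W x c t)
              (fun x _ => Finset.sum_nonneg fun c _ => hW x c t) (Finset.mem_univ x))
        refine le_trans ?_ (h1.trans h2)
        have i1 := sum_mul_mem_Icc M s
          (f := fun u => probBy M A n (u, A.step (q, η) (M.label s, t)))
          (fun u => probBy_nonneg M A n _) fun u => probBy_le_one M A n _
        have i2 := sum_mul_mem_Icc M s
          (f := fun u => probBy M A n (u, A.step (q, η') (M.label s, t)))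
          (fun u => probBy_nonneg M A n _) fun u => probBy_le_one M A n _
        rw [abs_le]
        constructor <;> linarith [i1.1, i1.2, i2.1, i2.2]
    refine (integral_mono_ae ((integrable_sum_probBy M hq s η n).sub
      (integrable_sum_probBy M hq s η' n)).abs (integrable_finsetSum _ fun x _ =>
        integrable_finsetSum _ fun c _ => hWi x c) hpt).trans ?_
    rw [integral_finsetSum _ fun x _ => integrable_finsetSum _ fun c _ => hWi x c, DTA.gap,
      Finset.mul_sum]
    refine Finset.sum_le_sum fun x _ => ?_
    rw [integral_finsetSum _ fun c _ => hWi x c, Finset.mul_sum]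
    refine Finset.sum_le_sum fun c _ => ?_
    rw [abs_pos_part_sub_pos_part]
    exact M.integral_window_le s (rate_le_rateMax M s) (hlo x c) (hlh x c)

theorem abs_prob_sub_le [Fintype X] (M : CTMC S L) (A : DTA Q L X) (s : S) (q : Q)
    (η η' : Val X) :
    |prob M A (s, q, η) - prob M A (s, q, η')| ≤ rateMax M * A.gap η η' :=
  le_of_tendsto ((tendsto_probBy M A _).sub (tendsto_probBy M A _)).abs
    (Filter.Eventually.of_forall fun n => abs_probBy_sub_le M A n s q η η')

/-- No window separates two values beyond the bound of a clock, so such values are interchangeable.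
This is what permits truncating clocks at T_x. -/
theorem prob_congr [Fintype X] (M : CTMC S L) (A : DTA Q L X) (s : S) (q : Q) {η η' : Val X}
    (h : ∀ x, η x = η' x ∨ (A.bound x ≤ η x ∧ A.bound x ≤ η' x)) :
    prob M A (s, q, η) = prob M A (s, q, η') := by
  have h1 := abs_prob_sub_le M A s q η η'
  rw [DTA.gap_eq_zero h, mul_zero] at h1
  exact sub_eq_zero.1 (abs_eq_zero.1 (le_antisymm h1 (abs_nonneg _)))

/-- From a vertex which cannot reach a final one, acceptance has probability `0`. -/
theorem prob_of_not_reachesFinal [Fintype X] (M : CTMC S L) (A : DTA Q L X) (v : S × Q × Val X)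
    (hv : ¬ ReachesFinal M A (vertex A v)) : prob M A v = 0 := by
  suffices h : ∀ n, probBy M A n v = 0 by
    have := tendsto_probBy M A v
    simp only [h] at this
    exact tendsto_nhds_unique this tendsto_const_nhds
  intro n
  induction n generalizing v with
  | zero => exact probBy_zero M fun hq => hv ⟨_, Relation.ReflTransGen.refl, hq⟩
  | succ n ih =>
    obtain ⟨s, q, η⟩ := v
    have hq : q ∉ A.final := fun hq => hv ⟨_, Relation.ReflTransGen.refl, hq⟩
    rw [probBy_eq_integral M hq]
    refine integral_eq_zero_of_ae ?_
    -- These delays include 0 and every delay that makes some clock integral. They form a null set,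
    -- and any other delay yields an edge of G whenever the successor state has positive
    -- probability.
    have hcount : ({0} ∪ ⋃ x, Set.range fun c : ℕ => (c : ℝ≥0) - η x).Countable :=
      (Set.countable_singleton 0).union (Set.countable_iUnion fun x => Set.countable_range _)
    have h0 : ∀ᵐ t ∂M.dwell s, t ∉ ({0} ∪ ⋃ x, Set.range fun c : ℕ => (c : ℝ≥0) - η x) := by
      rw [ae_iff]
      simp only [not_not]
      exact hcount.measure_zero _
    filter_upwards [h0] with t ht
    simp only [Set.mem_union, Set.mem_singleton_iff, Set.mem_iUnion, Set.mem_range, not_or,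
      not_exists] at ht
    refine Finset.sum_eq_zero fun u _ => ?_
    by_cases hP : 0 < M.P s u
    · rw [ih, mul_zero]
      rintro ⟨b, hb, hb'⟩
      suffices hm : ¬ A.Marginal (η.delay t) by
        have he : Edge M A (vertex A (s, q, η))
            (vertex A (u, A.step (q, η) (M.label s, t))) :=
          ⟨hP, η, _, t, rfl, rfl, pos_iff_ne_zero.2 ht.1, hm, rfl⟩
        exact hv ⟨b, Relation.ReflTransGen.head he hb, hb'⟩
      rintro ⟨x, -, hx⟩
      obtain ⟨z, hz⟩ := Int.fract_eq_zero_iff.1 hx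
      have hz0 : 0 ≤ z := by
        have : (0 : ℝ) ≤ z := hz ▸ NNReal.coe_nonneg _
        exact_mod_cast this
      refine ht.2 x z.toNat ?_
      have : ((z.toNat : ℕ) : ℝ≥0) = η x + t := by
        apply NNReal.coe_injective
        rw [NNReal.coe_natCast]
        have : ((z.toNat : ℤ) : ℝ) = z := by rw [Int.toNat_of_nonneg hz0]
        rw [← hz.trans (by simp [Val.delay] : (((η.delay t) x : ℝ≥0) : ℝ) = ((η x + t : ℝ≥0) : ℝ))]
        exact_mod_cast this
      rw [this, add_tsub_cancel_left]
    · rw [le_antisymm (not_lt.1 hP) (M.P_nonneg s u), zero_mul]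

end Product

/-! ### The local discretisation error -/

namespace DTA

variable {Q L X : Type*} {A : DTA Q L X}

/-- If η(x) = k/m and 0 < r < 1/m, then η(x) + r < c and η(x) + r ≤ c both say k < mc, independently
of r. -/
theorem OnGrid.cmpEquiv_delay {m : ℕ+} {η : Val X} (h : A.OnGrid m η) {t t' : ℝ≥0} (ht : 0 < t)
    (htm : t * (m : ℕ) < 1) (ht' : 0 < t') (htm' : t' * (m : ℕ) < 1) :
    A.CmpEquiv (η.delay t) (η.delay t') := by
  have hm : (0 : ℝ) < (m : ℕ) := by exact_mod_cast m.pos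
  have key : ∀ (r : ℝ≥0) (x : X) (k c : ℕ), η x * (m : ℕ) = k → 0 < r → r * (m : ℕ) < 1 →
      (((η.delay r) x ≤ c ↔ k < m * c) ∧ ((η.delay r) x < c ↔ k < m * c)) := by
    intro r x k c hk hr hrm
    have hk' : (η x : ℝ) * (m : ℕ) = k := by exact_mod_cast congrArg NNReal.toReal hk
    have hr' : (0 : ℝ) < r := hr
    have hrm' : (r : ℝ) * (m : ℕ) < 1 := by exact_mod_cast hrm
    have hrm0 : 0 < (r : ℝ) * (m : ℕ) := mul_pos hr' hm
    have e1 : (η.delay r) x < c ↔ (k : ℝ) + r * (m : ℕ) < m * c := by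
      rw [← NNReal.coe_lt_coe, ← mul_lt_mul_iff_left₀ hm, ← hk']
      simp only [Val.delay, NNReal.coe_add, NNReal.coe_natCast, add_mul]
      rw [mul_comm (c : ℝ)]
    have e2 : (η.delay r) x ≤ c ↔ (k : ℝ) + r * (m : ℕ) ≤ m * c := by
      rw [← NNReal.coe_le_coe, ← mul_le_mul_iff_left₀ hm, ← hk']
      simp only [Val.delay, NNReal.coe_add, NNReal.coe_natCast, add_mul]
      rw [mul_comm (c : ℝ)]
    have h1 : k < m * c → (k : ℝ) + 1 ≤ m * c := fun h => by exact_mod_cast h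
    have h2 : (k : ℝ) < m * c → k < m * c := fun h => by exact_mod_cast h
    rw [e1, e2]
    exact ⟨⟨fun h => h2 (by linarith), fun h => by linarith [h1 h]⟩,
      ⟨fun h => h2 (by linarith), fun h => by linarith [h1 h]⟩⟩
  intro x c _
  obtain ⟨k, hk⟩ := (h x).2
  obtain ⟨h1, h2⟩ := key t x k c hk ht htm
  obtain ⟨h3, h4⟩ := key t' x k c hk ht' htm'
  exact ⟨h1.trans h3.symm, h2.trans h4.symm⟩

theorem OnGrid.ruleAt_plus [Finite X] {m : ℕ+} {η : Val X} (h : A.OnGrid m η) {t : ℝ≥0}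
    (ht : 0 < t) (htm : t * (m : ℕ) < 1) (q : Q) (a : L) :
    A.ruleAt q a (A.plus η) = A.ruleAt q a (η.delay t) := by
  obtain ⟨t₁, h1, h2⟩ := A.exists_ruleAt_plus η
  have h3 : 0 < min t (t₁ / 2) := lt_min ht (half_pos h1)
  rw [h2 _ h3 ((min_le_right _ _).trans_lt (NNReal.half_lt_self h1.ne')) q a]
  exact (h.cmpEquiv_delay h3 (lt_of_le_of_lt (by gcongr; exact min_le_left _ _) htm)
    ht htm).ruleAt_eq q a

theorem cmpEquiv_of_lt {η η' : Val X} (h : ∀ x, A.bound x < η x) (h' : ∀ x, A.bound x < η' x) :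
    A.CmpEquiv η η' := by
  intro x c hc
  have hc' : (c : ℝ≥0) ≤ A.bound x := by exact_mod_cast hc
  have e1 := hc'.trans_lt (h x)
  have e2 := hc'.trans_lt (h' x)
  exact ⟨iff_of_false e1.not_ge e2.not_ge, iff_of_false e1.not_gt e2.not_gt⟩

theorem ruleAt_plus_of_eq_bound [Finite X] {η : Val X} (h : ∀ x, η x = A.bound x) {t : ℝ≥0}
    (ht : 0 < t) (q : Q) (a : L) : A.ruleAt q a (A.plus η) = A.ruleAt q a (η.delay t) := by
  obtain ⟨t₁, h1, h2⟩ := A.exists_ruleAt_plus η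
  have key : ∀ r : ℝ≥0, 0 < r → ∀ x, A.bound x < (η.delay r) x := by
    intro r hr x
    rw [Val.delay, h x]
    exact lt_add_of_pos_right _ hr
  rw [h2 _ (half_pos h1) (NNReal.half_lt_self h1.ne') q a]
  exact (cmpEquiv_of_lt (key _ (half_pos h1)) (key _ ht)).ruleAt_eq q a

end DTA

theorem one_div_one_add_sub_exp_neg {x : ℝ} (hx : 0 ≤ x) :
    |1 / (1 + x) - Real.exp (-x)| ≤ x ^ 2 / 2 := by
  have h1 : Real.exp (-x) ≤ 1 / (1 + x) := by
    rw [Real.exp_neg, ← one_div]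
    exact one_div_le_one_div_of_le (by linarith) (by linarith [Real.add_one_le_exp x])
  have h2 : 1 - x ^ 2 / 2 ≤ (1 + x) * Real.exp (-x) := by
    -- The derivative is y (1 - exp(-y)) ≥ 0.
    have hm : MonotoneOn (fun y : ℝ => (1 + y) * Real.exp (-y) + y ^ 2 / 2) (Set.Ici 0) := by
      refine monotoneOn_of_deriv_nonneg (convex_Ici 0) (by fun_prop) (by fun_prop) ?_
      intro y hy
      rw [interior_Ici, Set.mem_Ioi] at hy
      have hd : HasDerivAt (fun y : ℝ => (1 + y) * Real.exp (-y) + y ^ 2 / 2)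
          (1 * Real.exp (-y) + (1 + y) * (Real.exp (-y) * -1) + (2 : ℕ) * y ^ (2 - 1) * 1 / 2) y :=
        (((hasDerivAt_id y).const_add 1).mul (hasDerivAt_id y).neg.exp).add
          (((hasDerivAt_id y).pow 2).div_const 2)
      rw [hd.deriv]
      have he : Real.exp (-y) ≤ 1 := Real.exp_le_one_iff.2 (by linarith)
      norm_num
      nlinarith
    have := hm (Set.mem_Ici.2 le_rfl) (Set.mem_Ici.2 hx) hx
    norm_num at this
    linarith
  rw [abs_of_nonneg (by linarith), sub_le_iff_le_add, div_le_iff₀ (by linarith)]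
  nlinarith [pow_nonneg hx 3, sq_nonneg x]

namespace Product

variable {S L Q X : Type*} [Fintype S] [MeasurableSpace S] [DiscreteMeasurableSpace S]

/-- At the largest grid point the acceptance probability satisfies the discretised equation. -/
theorem prob_of_atMax [Fintype X] (M : CTMC S L) (A : DTA Q L X) {m : ℕ+} (v : Grid S A m)
    (hq : v.1.2.1 ∉ A.final) (hv : AtMax v) :
    prob M A v.1 = ∑ u, M.P v.1.1 u * prob M A (v.jump M u).1 := by
  obtain ⟨⟨s, q, η⟩, hη⟩ := v
  change ∀ x, η x = A.bound x at hv
  rw [prob_eq_integral M hq]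
  have h0 : ∀ᵐ t ∂M.dwell s, t ≠ 0 := by
    rw [ae_iff]
    simp only [not_not, Set.ofPred_eq_eq_singleton]
    exact measure_singleton 0
  have h1 : (fun t => ∑ u, M.P s u * prob M A (u, A.step (q, η) (M.label s, t))) =ᵐ[M.dwell s]
      fun _ => ∑ u, M.P s u * prob M A (Grid.jump M (⟨(s, q, η), hη⟩ : Grid S A m) u).1 := by
    filter_upwards [h0] with t ht
    have hr := A.ruleAt_plus_of_eq_bound hv (pos_iff_ne_zero.2 ht) q (M.label s)
    refine Finset.sum_congr rfl fun u _ => ?_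
    simp only [DTA.step, Grid.jump, hr]
    -- The scheme resets η instead of η + t. The clocks that are not reset are at or beyond their
    -- bounds in both, so nothing is lost.
    refine congrArg (M.P s u * ·) (prob_congr M A _ _ fun x => ?_)
    by_cases hx : x ∈ (A.ruleAt q (M.label s) (η.delay t)).resets
    · left
      simp [Val.reset, hx]
    · right
      simp only [Val.reset, hx, if_false, Val.delay, hv x]
      exact ⟨le_self_add, le_rfl⟩
  rw [integral_congr_ae h1, integral_const, probReal_univ, one_smul]

/-- The integral over the first delay is cut at ρ. The exponential law is memoryless, so the part
after ρ is a fresh start from η + ρ. -/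
theorem prob_eq_add_exp_mul [Fintype X] (M : CTMC S L) (A : DTA Q L X) (s : S) {q : Q}
    (hq : q ∉ A.final) (η : Val X) (ρ : ℝ≥0) :
    IntervalIntegrable (fun t => M.rate s * Real.exp (-(M.rate s * t)) *
      ∑ u, M.P s u * prob M A (u, A.step (q, η) (M.label s, t.toNNReal))) volume 0 ρ ∧
    prob M A (s, q, η) = (∫ t in (0 : ℝ)..ρ, M.rate s * Real.exp (-(M.rate s * t)) *
      ∑ u, M.P s u * prob M A (u, A.step (q, η) (M.label s, t.toNNReal))) +
      Real.exp (-(M.rate s * ρ)) * prob M A (s, q, η.delay ρ) := by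
  have hF : ∀ ζ : Val X, Measurable fun t =>
      ∑ u, M.P s u * prob M A (u, A.step (q, ζ) (M.label s, t)) := fun ζ =>
    Finset.measurable_sum _ fun u _ => (measurable_prob_step M hq s u ζ).const_mul _
  set G : ℝ → ℝ := fun t => M.rate s * Real.exp (-(M.rate s * t)) *
    ∑ u, M.P s u * prob M A (u, A.step (q, η) (M.label s, t.toNNReal)) with hG
  have hint : IntegrableOn G (Set.Ioi 0) := by
    have h1 : IntegrableOn (fun t => M.rate s * Real.exp (-(M.rate s * t))) (Set.Ioi 0) := by
      have := (exp_neg_integrableOn_Ioi 0 (M.rate_pos s)).const_mul (M.rate s)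
      simp only [neg_mul] at this
      exact this
    refine Integrable.mul_bdd (c := 1) h1
      ((hF η).comp measurable_real_toNNReal).aestronglyMeasurable (ae_of_all _ fun t => ?_)
    have := sum_mul_mem_Icc M s
      (f := fun u => prob M A (u, A.step (q, η) (M.label s, t.toNNReal)))
      (fun u => prob_nonneg M A _) fun u => prob_le_one M A _
    rw [Real.norm_eq_abs, abs_of_nonneg this.1]
    exact this.2
  have hint1 : IntegrableOn G (Set.Ioc 0 ρ) := hint.mono_set Set.Ioc_subset_Ioi_self
  have hint2 : IntegrableOn G (Set.Ioi ρ) := hint.mono_set (Set.Ioi_subset_Ioi ρ.coe_nonneg)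
  refine ⟨(intervalIntegrable_iff_integrableOn_Ioc_of_le ρ.coe_nonneg).2 hint1, ?_⟩
  have h2 : ∫ t in Set.Ioi (ρ : ℝ), G t =
      Real.exp (-(M.rate s * ρ)) * prob M A (s, q, η.delay ρ) := by
    rw [prob_eq_integral M hq, M.integral_dwell s (hF (η.delay ρ)), integral_Ici_eq_integral_Ioi,
      ← integral_const_mul, ← integral_indicator measurableSet_Ioi,
      ← integral_indicator measurableSet_Ioi, ← integral_add_right_eq_self _ (ρ : ℝ)]
    refine integral_congr_ae (ae_of_all _ fun t => ?_)
    by_cases ht : 0 < t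
    · have h3 : (t + ρ).toNNReal = ρ + t.toNNReal := by
        rw [Real.toNNReal_add ht.le ρ.coe_nonneg, Real.toNNReal_coe, add_comm]
      simp only [Set.indicator, Set.mem_Ioi, ht, lt_add_iff_pos_left, if_true, hG, h3]
      rw [show -(M.rate s * (t + ρ)) = -(M.rate s * ρ) + -(M.rate s * t) by ring, Real.exp_add]
      simp only [DTA.step, Val.delay_delay]
      ring
    · simp only [Set.indicator, Set.mem_Ioi, ht, lt_add_iff_pos_left, if_false]
  rw [← h2, prob_eq_integral M hq, M.integral_dwell s (hF η), integral_Ici_eq_integral_Ioi,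
    ← Set.Ioc_union_Ioi_eq_Ioi ρ.coe_nonneg,
    setIntegral_union (Set.Ioc_disjoint_Ioi le_rfl) measurableSet_Ioi hint1 hint2,
    intervalIntegral.integral_of_le ρ.coe_nonneg]

/-- The local discretisation error. -/
theorem abs_prob_sub_rhs_le [Fintype X] (M : CTMC S L) (A : DTA Q L X) {m : ℕ+} (v : Grid S A m)
    (hq : v.1.2.1 ∉ A.final) (hv : ¬ AtMax v) :
    |prob M A v.1 - rhs M A m (fun w => prob M A w.1) v| ≤
      rateMax M * (rateMax M * (Fintype.card X * A.maxBound)) * (m : ℝ)⁻¹ ^ 2 := by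
  obtain ⟨⟨s, q, η⟩, hη⟩ := v
  set v : Grid S A m := ⟨(s, q, η), hη⟩ with hvdef
  change q ∉ A.final at hq
  -- Some clock is below its bound, so its bound is at least 1. Hence λ_max ≤ K, which lets both
  -- errors below be measured by K.
  have hXT : (1 : ℝ) ≤ Fintype.card X * A.maxBound := by
    simp only [AtMax, not_forall] at hv
    obtain ⟨x, hx⟩ := hv
    have h1 : 1 ≤ A.bound x := by
      by_contra hc
      have h0 : A.bound x = 0 := by omega
      refine hx (le_antisymm (hη x).1 ?_)
      rw [h0, Nat.cast_zero]
      exact zero_le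
    have h2 := h1.trans (A.bound_le_maxBound x)
    have h3 : 0 < Fintype.card X := Fintype.card_pos_iff.2 ⟨x⟩
    exact_mod_cast Nat.mul_pos h3 h2
  set ρ : ℝ≥0 := ((m : ℕ) : ℝ≥0)⁻¹ with hρ
  have hm0 : ((m : ℕ) : ℝ≥0) ≠ 0 := by exact_mod_cast m.ne_zero
  have hρr : ((m : ℝ))⁻¹ = (ρ : ℝ) := by simp [hρ]
  set l := M.rate s with hl
  have hl0 : 0 < l := M.rate_pos s
  have hlΛ : l ≤ rateMax M := rate_le_rateMax M s
  set K := rateMax M * (Fintype.card X * A.maxBound : ℝ) with hK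
  have hKΛ : rateMax M ≤ K := le_mul_of_one_le_right (hl0.le.trans hlΛ) hXT
  have hK0 : 0 ≤ K := (hl0.le.trans hlΛ).trans hKΛ
  set A₀ := ∑ u, M.P s u * prob M A (v.jump M u).1 with hA₀
  have hA01 : A₀ ∈ Set.Icc (0 : ℝ) 1 := sum_mul_mem_Icc M s (fun u => prob_nonneg M A _)
    fun u => prob_le_one M A _
  set B₀ := prob M A v.delay.1 with hB₀
  have hB : prob M A (s, q, η.delay ρ) = B₀ := by
    refine prob_congr M A s q fun x => ?_
    simp only [Val.delay, DTA.oplus, ← hρ]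
    rcases le_total ((A.bound x : ℝ≥0)) (η x + ρ) with h | h
    · right
      rw [min_eq_left h]
      exact ⟨h, le_rfl⟩
    · left
      rw [min_eq_right h]
  obtain ⟨hI, hsplit⟩ := prob_eq_add_exp_mul M A s hq η ρ
  rw [hB, ← hl] at hsplit
  rw [← hl] at hI
  have hE : IntervalIntegrable (fun t => l * Real.exp (-(l * t)) * A₀) volume 0 ρ :=
    Continuous.intervalIntegrable (by fun_prop) _ _
  have hEv : ∫ t in (0 : ℝ)..ρ, l * Real.exp (-(l * t)) * A₀ =
      (1 - Real.exp (-(l * ρ))) * A₀ := by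
    rw [intervalIntegral.integral_mul_const, intervalIntegral.integral_eq_sub_of_hasDerivAt
      (f := fun t => -Real.exp (-(l * t)))]
    · simp only [mul_zero, neg_zero, Real.exp_zero]
      ring
    · intro t _
      have := (((hasDerivAt_id t).const_mul l).neg.exp).neg
      refine this.congr_deriv ?_
      simp only [id, Pi.neg_apply]
      ring
    · exact Continuous.intervalIntegrable (by fun_prop) _ _
  -- First error: on (0, ρ) the rule is that of η⁺, and resetting η instead of η + t costs at most K
  -- t, which integrates to l K ρ² / 2.
  have hdiff : |(∫ t in (0 : ℝ)..ρ, l * Real.exp (-(l * t)) *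
      ∑ u, M.P s u * prob M A (u, A.step (q, η) (M.label s, t.toNNReal))) -
      (1 - Real.exp (-(l * ρ))) * A₀| ≤ l * K * ρ ^ 2 / 2 := by
    rw [← hEv, ← intervalIntegral.integral_sub hI hE, ← Real.norm_eq_abs]
    have hb : ∫ t in (0 : ℝ)..ρ, l * K * t = l * K * ρ ^ 2 / 2 := by
      rw [intervalIntegral.integral_const_mul, integral_id]
      ring
    rw [← hb]
    refine intervalIntegral.norm_integral_le_of_norm_le ρ.coe_nonneg ?_
      (Continuous.intervalIntegrable (by fun_prop) _ _)
    have hne : ∀ᵐ t : ℝ, t ≠ ρ := by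
      rw [ae_iff]
      simp only [not_not, Set.ofPred_eq_eq_singleton]
      exact measure_singleton _
    filter_upwards [hne] with t htρ ht
    have ht0 : 0 < t := ht.1
    have ht1 : t < ρ := lt_of_le_of_ne ht.2 htρ
    have htn : 0 < t.toNNReal := Real.toNNReal_pos.2 ht0
    have htm : t.toNNReal * (m : ℕ) < 1 := by
      have : t.toNNReal < ρ := by
        rw [← NNReal.coe_lt_coe, Real.coe_toNNReal t ht0.le]
        exact ht1
      calc t.toNNReal * (m : ℕ) < ρ * (m : ℕ) :=
            mul_lt_mul_of_pos_right this (pos_iff_ne_zero.2 hm0)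
        _ = 1 := inv_mul_cancel₀ hm0
    have hr := hη.ruleAt_plus htn htm q (M.label s)
    rw [Real.norm_eq_abs, ← mul_sub, abs_mul, abs_of_nonneg (by positivity), mul_assoc l K t]
    have h1 : l * Real.exp (-(l * t)) ≤ l :=
      mul_le_of_le_one_right hl0.le (Real.exp_le_one_iff.2 (by nlinarith))
    refine mul_le_mul h1 ?_ (abs_nonneg _) hl0.le
    refine abs_sum_mul_sub_sum_mul_le M s fun u => ?_
    simp only [DTA.step, Grid.jump, hvdef, ← hr]
    refine (abs_prob_sub_le M A _ _ _ _).trans ?_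
    rw [hK, mul_assoc]
    refine mul_le_mul_of_nonneg_left ?_ (hl0.le.trans hlΛ)
    refine (A.gap_reset_le _ _ _).trans (A.gap_le fun x => ?_)
    simp only [Val.delay, NNReal.coe_add, add_sub_cancel_left,
      Real.coe_toNNReal t ht0.le, abs_of_nonneg ht0.le, le_refl]
  have hrhs : rhs M A m (fun w => prob M A w.1) v =
      1 / (1 + l * ρ) * B₀ + l * ρ / (1 + l * ρ) * A₀ := by
    rw [rhs, if_neg hv, hρr, mul_comm (ρ : ℝ)]
  have hx0 : 0 ≤ l * ρ := mul_nonneg hl0.le ρ.coe_nonneg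
  have hx1 : (1 + l * ρ) ≠ 0 := by positivity
  have hBA : |A₀ - B₀| ≤ 1 := by
    have h1 := prob_nonneg M A v.delay.1
    have h2 := prob_le_one M A v.delay.1
    rw [abs_le]
    constructor <;> linarith [hA01.1, hA01.2]
  have hexp := one_div_one_add_sub_exp_neg hx0
  -- Second error: the weight exp(-lρ) of not jumping is replaced by 1/(1 + lρ).
  have h2 : |(1 / (1 + l * ρ) - Real.exp (-(l * ρ))) * (A₀ - B₀)| ≤ l * K * ρ ^ 2 / 2 := by
    rw [abs_mul]
    calc _ ≤ (l * ρ) ^ 2 / 2 * 1 :=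
          mul_le_mul hexp hBA (abs_nonneg _) (by positivity)
      _ = l * l * (ρ ^ 2 / 2) := by ring
      _ ≤ l * K * (ρ ^ 2 / 2) := by
          refine mul_le_mul_of_nonneg_right ?_ (by positivity)
          exact mul_le_mul_of_nonneg_left (hlΛ.trans hKΛ) hl0.le
      _ = _ := by ring
  have h3 : prob M A v.1 - rhs M A m (fun w => prob M A w.1) v =
      ((∫ t in (0 : ℝ)..ρ, l * Real.exp (-(l * t)) *
      ∑ u, M.P s u * prob M A (u, A.step (q, η) (M.label s, t.toNNReal))) -
      (1 - Real.exp (-(l * ρ))) * A₀) +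
      (1 / (1 + l * ρ) - Real.exp (-(l * ρ))) * (A₀ - B₀) := by
    have h4 : l * ρ / (1 + l * ρ) = 1 - 1 / (1 + l * ρ) := by
      field_simp
      ring
    rw [hrhs, h4, show prob M A v.1 = _ from hsplit]
    ring
  rw [h3, hρr]
  refine (abs_add_le _ _).trans ?_
  have h5 : l * K * (ρ : ℝ) ^ 2 ≤ rateMax M * K * (ρ : ℝ) ^ 2 := by gcongr
  linarith

end Product

/-! ### Regions are preserved by matching delays and by resets -/

theorem floor_fract_add_of_lt {a t : ℝ} (h : Int.fract a + Int.fract t < 1) :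
    ⌊a + t⌋ = ⌊a⌋ + ⌊t⌋ ∧ Int.fract (a + t) = Int.fract a + Int.fract t := by
  have h1 := Int.floor_add_fract a
  have h2 := Int.floor_add_fract t
  have h3 := Int.fract_nonneg a
  have h4 := Int.fract_nonneg t
  have h5 : ⌊a + t⌋ = ⌊a⌋ + ⌊t⌋ := by
    rw [Int.floor_eq_iff]
    push_cast
    constructor <;> linarith
  refine ⟨h5, ?_⟩
  rw [← Int.self_sub_floor (a + t), h5]
  push_cast
  linarith

theorem floor_fract_add_of_le {a t : ℝ} (h : 1 ≤ Int.fract a + Int.fract t) :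
    ⌊a + t⌋ = ⌊a⌋ + ⌊t⌋ + 1 ∧ Int.fract (a + t) = Int.fract a + Int.fract t - 1 := by
  have h1 := Int.floor_add_fract a
  have h2 := Int.floor_add_fract t
  have h3 := Int.fract_lt_one a
  have h4 := Int.fract_lt_one t
  have h5 : ⌊a + t⌋ = ⌊a⌋ + ⌊t⌋ + 1 := by
    rw [Int.floor_eq_iff]
    push_cast
    constructor <;> linarith
  refine ⟨h5, ?_⟩
  rw [← Int.self_sub_floor (a + t), h5]
  push_cast
  linarith

namespace DTA

variable {Q L X : Type*} {A : DTA Q L X}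

theorem bound_lt_iff_of_fract_pos {a : ℝ≥0} {n : ℕ} (h : 0 < Int.fract (a : ℝ)) :
    (n : ℝ≥0) < a ↔ (n : ℤ) ≤ ⌊(a : ℝ)⌋ := by
  rw [Int.le_floor, ← NNReal.coe_lt_coe, NNReal.coe_natCast, Int.cast_natCast]
  refine ⟨le_of_lt, fun h1 => lt_of_le_of_ne h1 fun h2 => ?_⟩
  rw [← h2, Int.fract_natCast] at h
  exact lt_irrefl _ h

/-- A criterion adapted to non-marginal valuations: with positive fractional part the integer part
alone tells whether the bound is exceeded, and strict comparisons in both directions determine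
equality of fractional parts. -/
theorem regionEquiv_of_forall {η η' : Val X}
    (h1 : ∀ x, (A.bound x < η x ∧ A.bound x < η' x) ∨ (⌊(η x : ℝ)⌋ = ⌊(η' x : ℝ)⌋ ∧
      0 < Int.fract (η x : ℝ) ∧ 0 < Int.fract (η' x : ℝ)))
    (h2 : ∀ x y, η x ≤ A.bound x → η y ≤ A.bound y →
      (Int.fract (η x : ℝ) < Int.fract (η y : ℝ) ↔
        Int.fract (η' x : ℝ) < Int.fract (η' y : ℝ))) : A.RegionEquiv η η' := by
  refine ⟨⟨fun x => ?_, fun x hx hx' => ?_⟩, fun x y hx _ hy _ => ⟨h2 x y hx hy, ?_, h2 y x hy hx⟩⟩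
  · rcases h1 x with ⟨h, h'⟩ | ⟨h, h', h''⟩
    · exact iff_of_true h h'
    · rw [bound_lt_iff_of_fract_pos h', bound_lt_iff_of_fract_pos h'', h]
  · rcases h1 x with ⟨h, -⟩ | ⟨h, h', h''⟩
    · exact absurd h hx.not_gt
    · exact ⟨h, iff_of_true h' h''⟩
  · have e1 := h2 x y hx hy
    have e2 := h2 y x hy hx
    constructor <;> intro h
    · exact le_antisymm (not_lt.1 (mt e2.2 h.not_gt)) (not_lt.1 (mt e1.2 h.not_lt))
    · exact le_antisymm (not_lt.1 (mt e2.1 h.not_gt)) (not_lt.1 (mt e1.1 h.not_lt))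

theorem RegionEquiv.fract_lt_iff {η η' : Val X} (h : A.RegionEquiv η η') {x y : X}
    (hx : η x ≤ A.bound x) (hy : η y ≤ A.bound y) :
    Int.fract (η x : ℝ) < Int.fract (η y : ℝ) ↔ Int.fract (η' x : ℝ) < Int.fract (η' y : ℝ) :=
  (h.2 x y hx ((h.1.le_iff x).1 hx) hy ((h.1.le_iff y).1 hy)).1

theorem RegionEquiv.marginal {η η' : Val X} (h : A.RegionEquiv η η') (hm : A.Marginal η) :
    A.Marginal η' := by
  obtain ⟨x, hx, hx'⟩ := hm
  have h1 := (h.1.le_iff x).1 hx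
  refine ⟨x, h1, le_antisymm (not_lt.1 (mt (h.1.2 x hx h1).2.2 ?_)) (Int.fract_nonneg _)⟩
  rw [hx']
  exact lt_irrefl _

/-- A reset clock has fractional part 0; its order relative to another clock is whether that clock
has positive fractional part, which the region records. -/
theorem RegionEquiv.reset {η η' : Val X} (h : A.RegionEquiv η η') (Y : Set X) :
    A.RegionEquiv (η.reset Y) (η'.reset Y) := by
  have hfr : ∀ x, η x ≤ A.bound x → (0 < Int.fract (η x : ℝ) ↔ 0 < Int.fract (η' x : ℝ)) :=
    fun x hx => (h.1.2 x hx ((h.1.le_iff x).1 hx)).2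
  have key : ∀ x y, (η.reset Y) x ≤ A.bound x → (η.reset Y) y ≤ A.bound y →
      (Int.fract ((η.reset Y) x : ℝ) < Int.fract ((η.reset Y) y : ℝ) ↔
        Int.fract ((η'.reset Y) x : ℝ) < Int.fract ((η'.reset Y) y : ℝ)) := by
    intro x y hx hy
    by_cases hxY : x ∈ Y <;> by_cases hyY : y ∈ Y
    · simp [Val.reset, hxY, hyY]
    · simp only [Val.reset, hyY, if_false] at hy
      simpa [Val.reset, hxY, hyY] using hfr y hy
    · simp [Val.reset, hxY, hyY, (Int.fract_nonneg _).not_gt]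
    · simp only [Val.reset, hxY, hyY, if_false] at hx hy
      simpa [Val.reset, hxY, hyY] using h.fract_lt_iff hx hy
  refine ⟨⟨fun x => ?_, fun x hx hx' => ?_⟩, fun x y hx _ hy _ =>
    ⟨key x y hx hy, ?_, key y x hy hx⟩⟩
  · by_cases hxY : x ∈ Y
    · simp [Val.reset, hxY]
    · simpa [Val.reset, hxY] using h.1.1 x
  · by_cases hxY : x ∈ Y
    · simp [Val.reset, hxY]
    · simp only [Val.reset, hxY, if_false] at hx hx' ⊢
      exact h.1.2 x hx hx'
  · have e1 := key x y hx hy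
    have e2 := key y x hy hx
    constructor <;> intro h
    · exact le_antisymm (not_lt.1 (mt e2.2 h.not_gt)) (not_lt.1 (mt e1.2 h.not_lt))
    · exact le_antisymm (not_lt.1 (mt e2.1 h.not_gt)) (not_lt.1 (mt e1.1 h.not_lt))

/-- Delays into a non-marginal region can be matched from every valuation of a region. -/
theorem RegionEquiv.exists_delay [Finite X] {η η' : Val X} (h : A.RegionEquiv η η') {t : ℝ≥0}
    (ht : 0 < t) (hm : ¬ A.Marginal (η.delay t)) :
    ∃ t' : ℝ≥0, 0 < t' ∧ A.RegionEquiv (η.delay t) (η'.delay t') := by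
  cases nonempty_fintype X
  have hm' : ∀ x, (η.delay t) x ≤ A.bound x → 0 < Int.fract ((η.delay t) x : ℝ) := fun x hx =>
    lt_of_le_of_ne (Int.fract_nonneg _) fun hc => hm ⟨x, hx, hc.symm⟩
  have hcoe : ∀ (ζ : Val X) (r : ℝ≥0) x, ((ζ.delay r) x : ℝ) = ζ x + r := fun ζ r x => rfl
  have hact : ∀ x, (η.delay t) x ≤ A.bound x → η x ≤ A.bound x := fun x hx =>
    le_self_add.trans hx
  rcases (Int.fract_nonneg (t : ℝ)).eq_or_lt with hf | hf
  -- An integral delay shifts integer parts and keeps fractional parts, so the same delay works for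
  -- η'.
  · have e : ∀ a : ℝ, ⌊a + t⌋ = ⌊a⌋ + ⌊(t : ℝ)⌋ ∧ Int.fract (a + t) = Int.fract a := by
      intro a
      have := floor_fract_add_of_lt (a := a) (t := t) (by
        rw [← hf, add_zero]; exact Int.fract_lt_one a)
      rwa [← hf, add_zero] at this
    refine ⟨t, ht, regionEquiv_of_forall (fun x => ?_) fun x y hx hy => ?_⟩
    · by_cases hx : (η.delay t) x ≤ A.bound x
      · right
        have h1 := hact x hx
        have h2 := h.1.2 x h1 ((h.1.le_iff x).1 h1)
        have h3 := hm' x hx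
        rw [hcoe, (e _).2] at h3
        rw [hcoe, hcoe, (e _).1, (e _).1, (e _).2, (e _).2, h2.1]
        exact ⟨rfl, h3, h2.2.1 h3⟩
      · left
        refine ⟨not_le.1 hx, not_le.1 fun hx' => hx ?_⟩
        have h1 : η' x ≤ A.bound x := le_self_add.trans hx'
        have h2 := h.1.2 x ((h.1.le_iff x).2 h1) h1
        obtain ⟨k, hk⟩ := Int.fract_eq_zero_iff.1 hf.symm
        have hk0 : 0 ≤ k := by
          have : (0 : ℝ) ≤ k := hk ▸ t.coe_nonneg
          exact_mod_cast this
        lift k to ℕ using hk0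
        have hk' : t = k := by
          apply NNReal.coe_injective
          rw [← hk]
          simp
        simp only [Val.delay, hk'] at hx' ⊢
        have h3 : k ≤ A.bound x := by
          have : (k : ℝ≥0) ≤ A.bound x := le_add_self.trans hx'
          exact_mod_cast this
        obtain ⟨b, hb⟩ := Nat.exists_eq_add_of_le' h3
        have h4 := (h.1.cmpEquiv x b (by omega)).1
        rw [hb, Nat.cast_add, add_le_add_iff_right] at hx' ⊢
        exact h4.2 hx'
    · rw [hcoe, hcoe, hcoe, hcoe, (e _).2, (e _).2, (e _).2, (e _).2]
      exact h.fract_lt_iff (hact x hx) (hact y hy)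
  · classical
    set f := Int.fract (t : ℝ) with hfdef
    -- The new delay keeps the integer part of `t` and gets a fractional part f'. It must carry
    -- exactly those clocks of η' past the next integer that `t` carries past it in η: f' lies above
    -- the thresholds in `lo` and below those in `hi`. The common order of fractional parts
    -- separates the two sets; 0 and 1 confine f' to the open unit interval.
    let lo : Finset ℝ := insert 0 ((Finset.univ.filter fun x => η x ≤ A.bound x ∧
      1 < Int.fract (η x : ℝ) + f).image fun x => 1 - Int.fract (η' x : ℝ))
    let hi : Finset ℝ := insert 1 ((Finset.univ.filter fun x => η x ≤ A.bound x ∧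
      Int.fract (η x : ℝ) + f < 1).image fun x => 1 - Int.fract (η' x : ℝ))
    have hf1 : f < 1 := Int.fract_lt_one _
    have hlohi : ∀ a ∈ lo, ∀ b ∈ hi, a < b := by
      intro a ha b hb
      simp only [lo, hi, Finset.mem_insert, Finset.mem_image, Finset.mem_filter,
        Finset.mem_univ, true_and] at ha hb
      rcases ha with rfl | ⟨x, ⟨hx, hx1⟩, rfl⟩ <;> rcases hb with rfl | ⟨y, ⟨hy, hy1⟩, rfl⟩
      · exact one_pos
      · exact sub_pos.2 (Int.fract_lt_one _)
      · have := (h.1.2 x hx ((h.1.le_iff x).1 hx)).2.1 (by linarith)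
        linarith
      · have := (h.fract_lt_iff hy hx).1 (by linarith)
        linarith
    obtain ⟨f', hlo, hhi⟩ := Order.exists_between_finsets lo hi hlohi
    have hf0' : 0 < f' := hlo 0 (Finset.mem_insert_self _ _)
    have hf1' : f' < 1 := hhi 1 (Finset.mem_insert_self _ _)
    have hk0 : (0 : ℝ) ≤ ⌊(t : ℝ)⌋ := by
      exact_mod_cast Int.floor_nonneg.2 t.coe_nonneg
    let t' : ℝ≥0 := ⟨⌊(t : ℝ)⌋ + f', by positivity⟩
    have ht' : (t' : ℝ) = ⌊(t : ℝ)⌋ + f' := rfl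
    have hfl' : ⌊(t' : ℝ)⌋ = ⌊(t : ℝ)⌋ := by
      rw [Int.floor_eq_iff, ht']
      constructor <;> linarith
    have hfr' : Int.fract (t' : ℝ) = f' := by
      rw [← Int.self_sub_floor, hfl', ht']
      ring
    have key : ∀ x, η x ≤ A.bound x →
        (1 < Int.fract (η x : ℝ) + f → 1 < Int.fract (η' x : ℝ) + f') ∧
        (Int.fract (η x : ℝ) + f < 1 → Int.fract (η' x : ℝ) + f' < 1) := by
      intro x hx
      refine ⟨fun h1 => ?_, fun h1 => ?_⟩
      · have := hlo (1 - Int.fract (η' x : ℝ)) (Finset.mem_insert_of_mem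
          (Finset.mem_image.2 ⟨x, Finset.mem_filter.2 ⟨Finset.mem_univ _, hx, h1⟩, rfl⟩))
        linarith
      · have := hhi (1 - Int.fract (η' x : ℝ)) (Finset.mem_insert_of_mem
          (Finset.mem_image.2 ⟨x, Finset.mem_filter.2 ⟨Finset.mem_univ _, hx, h1⟩, rfl⟩))
        linarith
    have hne : ∀ x, (η.delay t) x ≤ A.bound x → Int.fract (η x : ℝ) + f ≠ 1 := by
      intro x hx hc
      have h1 := (floor_fract_add_of_le (a := η x) (t := t) hc.ge).2
      have h2 := hm' x hx
      rw [hcoe, h1, ← hfdef, hc] at h2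
      linarith
    refine ⟨t', ?_, regionEquiv_of_forall (fun x => ?_) fun x y hx hy => ?_⟩
    · rw [← NNReal.coe_pos, ht']
      positivity
    · by_cases hx : η x ≤ A.bound x
      · have hfl := (h.1.2 x hx ((h.1.le_iff x).1 hx)).1
        have hn := Int.fract_nonneg (η x : ℝ)
        have hn' := Int.fract_nonneg (η' x : ℝ)
        rcases lt_trichotomy (Int.fract (η x : ℝ) + f) 1 with h1 | h1 | h1
        · right
          have h2 := (key x hx).2 h1
          obtain ⟨e1, e2⟩ := floor_fract_add_of_lt (a := η x) (t := t) h1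
          obtain ⟨e3, e4⟩ := floor_fract_add_of_lt (a := η' x) (t := t') (by rw [hfr']; exact h2)
          rw [hcoe, hcoe, e1, e2, e3, e4, hfl, hfl', hfr']
          exact ⟨rfl, by linarith, by linarith⟩
        -- Landing on an integer is possible only beyond the bound. The integer is then at least T_x
        -- + 1, and since f' > 0 the clock of η' exceeds T_x as well.
        · left
          have h2 : A.bound x < (η.delay t) x := not_le.1 fun hc => hne x hc h1
          refine ⟨h2, ?_⟩
          obtain ⟨e1, e2⟩ := floor_fract_add_of_le (a := η x) (t := t) h1.ge
          rw [← NNReal.coe_lt_coe, NNReal.coe_natCast, hcoe] at h2 ⊢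
          have e3 := Int.floor_add_fract ((η x : ℝ) + t)
          rw [e1, e2, ← hfdef, h1, hfl] at e3
          have h3 : ((A.bound x : ℤ) : ℝ) < ((⌊(η' x : ℝ)⌋ + ⌊(t : ℝ)⌋ + 1 : ℤ) : ℝ) := by
            push_cast at e3 ⊢
            linarith
          have h4 : ((A.bound x : ℤ) : ℝ) ≤ ((⌊(η' x : ℝ)⌋ + ⌊(t : ℝ)⌋ : ℤ) : ℝ) := by
            exact_mod_cast Int.lt_add_one_iff.1 (by exact_mod_cast h3)
          push_cast at h4
          have h5 := Int.floor_add_fract (η' x : ℝ)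
          rw [ht']
          linarith
        · right
          have h2 := (key x hx).1 h1
          obtain ⟨e1, e2⟩ := floor_fract_add_of_le (a := η x) (t := t) h1.le
          obtain ⟨e3, e4⟩ := floor_fract_add_of_le (a := η' x) (t := t') (by rw [hfr']; exact h2.le)
          rw [hcoe, hcoe, e1, e2, e3, e4, hfl, hfl', hfr']
          exact ⟨rfl, by linarith, by linarith⟩
      · left
        have hx' : ¬ η' x ≤ A.bound x := mt (h.1.le_iff x).2 hx
        exact ⟨(not_le.1 hx).trans_le le_self_add, (not_le.1 hx').trans_le le_self_add⟩
    · have hx0 := hact x hx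
      have hy0 := hact y hy
      have hxy := h.fract_lt_iff hx0 hy0
      have a1 := Int.fract_nonneg (η x : ℝ)
      have a2 := Int.fract_nonneg (η y : ℝ)
      have a3 := Int.fract_nonneg (η' x : ℝ)
      have a4 := Int.fract_nonneg (η' y : ℝ)
      have b1 := Int.fract_lt_one (η x : ℝ)
      have b2 := Int.fract_lt_one (η y : ℝ)
      have b3 := Int.fract_lt_one (η' x : ℝ)
      have b4 := Int.fract_lt_one (η' y : ℝ)
      have ev : ∀ z, η z ≤ A.bound z → Int.fract (η z : ℝ) + f ≠ 1 →
          (Int.fract (η z : ℝ) + f < 1 ∧ Int.fract ((η.delay t) z : ℝ) = Int.fract (η z : ℝ) + f ∧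
            Int.fract ((η'.delay t') z : ℝ) = Int.fract (η' z : ℝ) + f') ∨
          (1 < Int.fract (η z : ℝ) + f ∧
            Int.fract ((η.delay t) z : ℝ) = Int.fract (η z : ℝ) + f - 1 ∧
            Int.fract ((η'.delay t') z : ℝ) = Int.fract (η' z : ℝ) + f' - 1) := by
        intro z hz hz1
        rcases lt_or_gt_of_ne hz1 with h1 | h1
        · left
          have h2 := (key z hz).2 h1
          refine ⟨h1, (floor_fract_add_of_lt (a := η z) (t := t) h1).2, ?_⟩
          rw [hcoe, (floor_fract_add_of_lt (a := η' z) (t := t') (by rw [hfr']; exact h2)).2, hfr']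
        · right
          have h2 := (key z hz).1 h1
          refine ⟨h1, (floor_fract_add_of_le (a := η z) (t := t) h1.le).2, ?_⟩
          rw [hcoe, (floor_fract_add_of_le (a := η' z) (t := t')
            (by rw [hfr']; exact h2.le)).2, hfr']
      rcases ev x hx0 (hne x hx) with ⟨c1, c2, c3⟩ | ⟨c1, c2, c3⟩ <;>
        rcases ev y hy0 (hne y hy) with ⟨d1, d2, d3⟩ | ⟨d1, d2, d3⟩ <;>
        rw [c2, c3, d2, d3]
      · rw [add_lt_add_iff_right, add_lt_add_iff_right]
        exact hxy
      · exact iff_of_false (by linarith) (by linarith)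
      · exact iff_of_true (by linarith) (by linarith)
      · rw [sub_lt_sub_iff_right, sub_lt_sub_iff_right, add_lt_add_iff_right,
          add_lt_add_iff_right]
        exact hxy

end DTA

/-! ### Repetition-free paths, windows of grid times, concrete runs -/

/-- A reachable element of a finite type is reached by a path without repetitions. -/
theorem Relation.ReflTransGen.exists_path_lt_card {V : Type*} [Finite V] {R : V → V → Prop}
    {a b : V} (h : Relation.ReflTransGen R a b) :
    ∃ n, n + 1 ≤ Nat.card V ∧ ∃ f : ℕ → V, f 0 = a ∧ f n = b ∧ ∀ i < n, R (f i) (f (i + 1)) := by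
  classical
  have hex : ∃ n, ∃ f : ℕ → V, f 0 = a ∧ f n = b ∧ ∀ i < n, R (f i) (f (i + 1)) := by
    induction h with
    | refl => exact ⟨0, fun _ => a, rfl, rfl, fun i hi => absurd hi (Nat.not_lt_zero i)⟩
    | @tail b c _ hbc ih =>
      obtain ⟨n, f, h0, hn, hf⟩ := ih
      refine ⟨n + 1, fun i => if i ≤ n then f i else c, by simp [h0], by simp, fun i hi => ?_⟩
      rcases Nat.lt_succ_iff_lt_or_eq.1 hi with h1 | rfl
      · simpa [h1.le, Nat.succ_le_of_lt h1] using hf i h1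
      · simpa [hn] using hbc
  obtain ⟨f, h0, hn, hf⟩ := Nat.find_spec hex
  set n := Nat.find hex with hndef
  -- A path of minimal length has no repetition, as the loop between two equal vertices could be cut
  -- out.
  have hinj : ∀ i j, i < j → j ≤ n → f i ≠ f j := by
    intro i j hij hj he
    refine Nat.find_min hex (m := n - (j - i)) (by omega)
      ⟨fun k => if k ≤ i then f k else f (k + (j - i)), by simp [h0], ?_, fun k hk => ?_⟩
    · by_cases hni : n - (j - i) ≤ i
      · have e1 : n - (j - i) = i := by omega
        have e2 : j = n := by omega
        simp only [e1, le_refl, if_true]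
        rw [he, e2, hn]
      · simp only [hni, if_false]
        rw [Nat.sub_add_cancel (by omega), hn]
    · rcases lt_trichotomy k i with hki | rfl | hki
      · simpa [hki.le, Nat.succ_le_of_lt hki] using hf k (by omega)
      · have h1 := hf j (by omega)
        rw [← he] at h1
        have e1 : k + 1 + (j - k) = j + 1 := by omega
        simpa [e1] using h1
      · have h1 := hf (k + (j - i)) (by omega)
        have e1 : k + 1 + (j - i) = k + (j - i) + 1 := by omega
        simpa [hki.not_ge, (hki.trans k.lt_succ_self).not_ge, e1] using h1
  refine ⟨n, ?_, f, h0, hn, hf⟩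
  have : Function.Injective fun i : Fin (n + 1) => f i := by
    intro i j hij
    by_contra hne
    rcases lt_or_gt_of_ne (Fin.val_injective.ne hne) with h1 | h1
    · exact hinj _ _ h1 (Nat.le_of_lt_succ j.2) hij
    · exact hinj _ _ h1 (Nat.le_of_lt_succ i.2) hij.symm
  simpa using Nat.card_le_card_of_injective _ this

/-- Replace real times by windows of `m / N` grid points each, so that all comparisons of time
differences with integers are kept. -/
theorem exists_windows {n N m : ℕ} (hn : n + 1 ≤ N) (τ : ℕ → ℝ≥0) :
    ∃ b : ℕ → ℕ, ∀ i ≤ n, ∀ j ≤ n, ∀ c d k l : ℕ, τ i + d < τ j + c →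
      k < b i + m / N → b j ≤ l → k + m * d < l + m * c := by
  classical
  set φ : ℕ → ℝ := fun i => Int.fract (τ i : ℝ) with hφ
  set F : ℕ → ℕ := fun i => ⌊(τ i : ℝ)⌋₊ with hF
  have hFφ : ∀ i, (F i : ℝ) + φ i = τ i := by
    intro i
    have h1 := Int.floor_add_fract (τ i : ℝ)
    rwa [← Int.natCast_floor_eq_floor (τ i).coe_nonneg, Int.cast_natCast] at h1
  let less : ℕ → ℕ → Prop := fun j i => φ j < φ i ∨ (φ j = φ i ∧ j < i)
  let rank : ℕ → ℕ := fun i => ((Finset.range (n + 1)).filter fun j => less j i).card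
  have hrank : ∀ i ≤ n, rank i + 1 ≤ N := by
    intro i hi
    refine le_trans (Nat.succ_le_of_lt ?_) hn
    conv_rhs => rw [← Finset.card_range (n + 1)]
    refine Finset.card_lt_card (Finset.filter_ssubset.2 ⟨i, Finset.mem_range.2 (by omega), ?_⟩)
    simp [less]
  have hrank_lt : ∀ i ≤ n, ∀ j, φ i < φ j → rank i + 1 ≤ rank j := by
    intro i hi j hij
    refine Nat.succ_le_of_lt (Finset.card_lt_card (Finset.ssubset_iff_subset_ne.2 ⟨?_, ?_⟩))
    · intro l hl
      rw [Finset.mem_filter] at hl ⊢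
      refine ⟨hl.1, Or.inl ?_⟩
      rcases hl.2 with h | ⟨h, -⟩
      · exact h.trans hij
      · rw [h]; exact hij
    · intro he
      have h1 : i ∈ (Finset.range (n + 1)).filter fun l => less l j :=
        Finset.mem_filter.2 ⟨Finset.mem_range.2 (by omega), Or.inl hij⟩
      rw [← he, Finset.mem_filter] at h1
      simp [less] at h1
  -- Each unit of time, that is `m` grid steps, has room for `N` slots of length `m / N`. The window
  -- of τ i is the slot numbered by the rank of its fractional part, in the unit given by its
  -- integer part.
  refine ⟨fun i => m * F i + rank i * (m / N), fun i hi j hj c d k l h hk hl => ?_⟩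
  have h1 : (F i : ℝ) + φ i + d < F j + φ j + c := by
    rw [hFφ, hFφ]
    exact_mod_cast h
  have h2 : 0 ≤ φ i := Int.fract_nonneg _
  have h3 : φ j < 1 := Int.fract_lt_one _
  have h4 : F i + d < F j + c + 1 := by
    have : (F i : ℝ) + d < F j + c + 1 := by linarith
    exact_mod_cast this
  -- Either the integer parts decide, because windows stay inside their units, or they agree and the
  -- fractional parts, hence the slots, decide.
  rcases Nat.lt_succ_iff_lt_or_eq.1 h4 with h5 | h5
  · have h6 : (rank i + 1) * (m / N) ≤ m :=
      (Nat.mul_le_mul_right _ (hrank i hi)).trans (Nat.mul_div_le m N)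
    have h7 : m * (F i + d + 1) ≤ m * (F j + c) := Nat.mul_le_mul_left m h5
    simp only [mul_add, add_mul, mul_one, one_mul] at h6 h7
    dsimp only at hk hl
    generalize m * F i = x1 at *
    generalize m * F j = x2 at *
    generalize rank i * (m / N) = x3 at *
    generalize rank j * (m / N) = x4 at *
    omega
  · have h6 : φ i < φ j := by
      have : (F i : ℝ) + d = F j + c := by exact_mod_cast h5
      linarith
    have h7 : (rank i + 1) * (m / N) ≤ rank j * (m / N) :=
      Nat.mul_le_mul_right _ (hrank_lt i hi j h6)
    have h8 : m * (F i + d) = m * (F j + c) := by rw [h5]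
    simp only [mul_add, add_mul, one_mul] at h7 h8
    dsimp only at hk hl
    generalize m * F i = x1 at *
    generalize m * F j = x2 at *
    generalize rank i * (m / N) = x3 at *
    generalize rank j * (m / N) = x4 at *
    omega

namespace Product

variable {S L Q X : Type*} [Fintype S]

/-- An edge only provides a step from some valuation of the source region; region equivalence
carries it over to the given one, with a possibly different delay. -/
theorem Edge.exists_step [Finite X] {M : CTMC S L} {A : DTA Q L X} {a b : Vertex S A}
    (h : Edge M A a b) {η : Val X} (hη : A.region η = a.2.2) :
    ∃ (t : ℝ≥0) (η' : Val X), 0 < t ∧ ¬ A.Marginal (η.delay t) ∧ A.region η' = b.2.2 ∧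
      A.step (a.2.1, η) (M.label a.1, t) = (b.2.1, η') := by
  obtain ⟨-, ζ, ζ', t, h1, h2, ht, hm, h3⟩ := h
  have h4 : A.RegionEquiv ζ η := Quotient.exact (s := A.regionSetoid) (h1.trans hη.symm)
  obtain ⟨t', ht', h5⟩ := h4.exists_delay ht hm
  have hr := h5.1.cmpEquiv.ruleAt_eq a.2.1 (M.label a.1)
  simp only [DTA.step, Prod.mk.injEq] at h3
  refine ⟨t', (η.delay t').reset (A.ruleAt a.2.1 (M.label a.1) (η.delay t')).resets, ht',
    fun hm' => hm ((A.regionSetoid.symm h5).marginal hm'), ?_, ?_⟩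
  · rw [← h2, h3.2, hr]
    exact (Quotient.sound (s := A.regionSetoid) (h5.reset _)).symm
  · simp only [DTA.step, h3.1, hr]

/-- A path in the region graph is followed by a concrete run. -/
theorem exists_run [Finite X] {M : CTMC S L} {A : DTA Q L X} {n : ℕ} {f : ℕ → Vertex S A}
    (hf : ∀ i < n, Edge M A (f i) (f (i + 1))) {ζ₀ : Val X} (h0 : A.region ζ₀ = (f 0).2.2) :
    ∃ (ζ : ℕ → Val X) (t : ℕ → ℝ≥0), ζ 0 = ζ₀ ∧ ∀ i < n, 0 < t i ∧
      ¬ A.Marginal ((ζ i).delay (t i)) ∧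
      A.step ((f i).2.1, ζ i) (M.label (f i).1, t i) = ((f (i + 1)).2.1, ζ (i + 1)) := by
  -- Stated for all indices and valuations so that the choices become total functions, which can be
  -- iterated; the values where the hypotheses fail are dummies.
  have H : ∀ (i : ℕ) (η : Val X), ∃ (t : ℝ≥0) (η' : Val X), i < n → A.region η = (f i).2.2 →
      0 < t ∧ ¬ A.Marginal (η.delay t) ∧ A.region η' = (f (i + 1)).2.2 ∧
        A.step ((f i).2.1, η) (M.label (f i).1, t) = ((f (i + 1)).2.1, η') := by
    intro i η
    by_cases h : i < n ∧ A.region η = (f i).2.2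
    · obtain ⟨t, η', h1⟩ := (hf i h.1).exists_step h.2
      exact ⟨t, η', fun _ _ => h1⟩
    · exact ⟨0, η, fun h1 h2 => absurd ⟨h1, h2⟩ h⟩
  choose T Z hZ using H
  let ζ : ℕ → Val X := fun i => Nat.rec ζ₀ (fun i η => Z i η) i
  have hr : ∀ i ≤ n, A.region (ζ i) = (f i).2.2 := by
    intro i
    induction i with
    | zero => exact fun _ => h0
    | succ i ih => exact fun hi => (hZ i (ζ i) hi (ih (Nat.le_of_succ_le hi))).2.2.1
  refine ⟨ζ, fun i => T i (ζ i), rfl, fun i hi => ?_⟩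
  obtain ⟨h1, h2, -, h3⟩ := hZ i (ζ i) hi (hr i hi.le)
  exact ⟨h1, h2, h3⟩

end Product

/-! ### Waiting and jumping in the discrete scheme -/

namespace Product

variable {S L Q X : Type*}

theorem Grid.delay_iterate {A : DTA Q L X} {m : ℕ+} (v : Grid S A m) (k : ℕ) :
    (Grid.delay^[k] v).1 =
      (v.1.1, v.1.2.1, A.oplus v.1.2.2 ((k : ℝ≥0) * ((m : ℕ) : ℝ≥0)⁻¹)) := by
  induction k with
  | zero =>
    obtain ⟨⟨s, q, η⟩, hη⟩ := v
    have : A.oplus η (((0 : ℕ) : ℝ≥0) * ((m : ℕ) : ℝ≥0)⁻¹) = η := by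
      funext x
      simp only [DTA.oplus, Nat.cast_zero, zero_mul, add_zero]
      exact min_eq_right (hη x).1
    simp only [Function.iterate_zero, id, this]
  | succ k ih =>
    have e : ∀ w : Grid S A m, w.delay.1 =
        (w.1.1, w.1.2.1, A.oplus w.1.2.2 ((m : ℕ) : ℝ≥0)⁻¹) := fun _ => rfl
    rw [Function.iterate_succ_apply', e, ih]
    refine Prod.ext rfl (Prod.ext rfl ?_)
    funext x
    simp only [DTA.oplus, Nat.cast_succ, add_mul, one_mul, ← add_assoc]
    rw [← min_add_add_right, ← min_assoc, min_eq_left (le_self_add : (A.bound x : ℝ≥0) ≤ _)]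

theorem Grid.delay_iterate_val {A : DTA Q L X} {m : ℕ+} (v : Grid S A m) (k : ℕ) (x : X) :
    (Grid.delay^[k] v).1.2.2 x =
      min (A.bound x : ℝ≥0) (v.1.2.2 x + (k : ℝ≥0) * ((m : ℕ) : ℝ≥0)⁻¹) := by
  rw [Grid.delay_iterate]
  rfl

theorem Grid.delay_iterate_state {A : DTA Q L X} {m : ℕ+} (v : Grid S A m) (k : ℕ) :
    (Grid.delay^[k] v).1.1 = v.1.1 := by
  rw [Grid.delay_iterate]

theorem Grid.atMax_delay_iterate [Fintype X] {A : DTA Q L X} {m : ℕ+} (v : Grid S A m) {k : ℕ}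
    (hk : A.maxBound * m ≤ k) : AtMax (Grid.delay^[k] v) := by
  intro x
  rw [Grid.delay_iterate_val]
  have hm0 : ((m : ℕ) : ℝ≥0) ≠ 0 := by exact_mod_cast m.ne_zero
  refine min_eq_left (le_add_left ?_)
  calc (A.bound x : ℝ≥0) ≤ A.maxBound := by exact_mod_cast A.bound_le_maxBound x
    _ = (A.maxBound * (m : ℕ)) * ((m : ℕ) : ℝ≥0)⁻¹ := by rw [mul_assoc, mul_inv_cancel₀ hm0, mul_one]
    _ ≤ (k : ℝ≥0) * ((m : ℕ) : ℝ≥0)⁻¹ := by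
      gcongr
      exact_mod_cast hk

theorem AtMax.delay_eq {A : DTA Q L X} {m : ℕ+} {v : Grid S A m} (hv : AtMax v) :
    v.delay = v := by
  obtain ⟨⟨s, q, η⟩, hη⟩ := v
  refine Subtype.ext (Prod.ext rfl (Prod.ext rfl ?_))
  funext x
  change min (A.bound x : ℝ≥0) (η x + _) = η x
  rw [show η x = A.bound x from hv x]
  exact min_eq_left le_self_add

/-- After T_max · m steps every clock is at its bound, where further waiting has no effect. -/
theorem Grid.delay_iterate_min [Fintype X] {A : DTA Q L X} {m : ℕ+} (v : Grid S A m) (k : ℕ) :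
    Grid.delay^[k] v = Grid.delay^[min k (A.maxBound * m)] v := by
  rcases le_total k (A.maxBound * m) with h | h
  · rw [min_eq_left h]
  · rw [min_eq_right h]
    obtain ⟨d, rfl⟩ := Nat.exists_eq_add_of_le' h
    rw [Function.iterate_add_apply]
    exact Function.iterate_fixed (v.atMax_delay_iterate le_rfl).delay_eq d

variable [Fintype S]

/-- The probability of no jump during one step of the scheme. -/
noncomputable def stay (M : CTMC S L) (m : ℕ+) (s : S) : ℝ := 1 / (1 + (m : ℝ)⁻¹ * M.rate s)

theorem one_lt_one_add_mul_rate (M : CTMC S L) (m : ℕ+) (s : S) :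
    1 < 1 + (m : ℝ)⁻¹ * M.rate s := by
  have hm : (0 : ℝ) < m := by exact_mod_cast m.pos
  exact lt_add_of_pos_right _ (mul_pos (inv_pos.2 hm) (M.rate_pos s))

theorem stay_pos (M : CTMC S L) (m : ℕ+) (s : S) : 0 < stay M m s :=
  one_div_pos.2 (zero_lt_one.trans (one_lt_one_add_mul_rate M m s))

theorem stay_le_one (M : CTMC S L) (m : ℕ+) (s : S) : stay M m s ≤ 1 :=
  (div_le_one (zero_lt_one.trans (one_lt_one_add_mul_rate M m s))).2
    (one_lt_one_add_mul_rate M m s).le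

theorem one_sub_stay (M : CTMC S L) (m : ℕ+) (s : S) :
    (m : ℝ)⁻¹ * M.rate s / (1 + (m : ℝ)⁻¹ * M.rate s) = 1 - stay M m s := by
  have := (zero_lt_one.trans (one_lt_one_add_mul_rate M m s)).ne'
  rw [stay, eq_sub_iff_add_eq, ← add_div, add_comm, div_self this]

/-- (1 + x)^k ≤ exp(kx), with kx = kρλ(s) ≤ λ_max T. -/
theorem exp_le_stay_pow (M : CTMC S L) (m : ℕ+) (s : S) {T k : ℕ} (hk : k ≤ T * m) :
    Real.exp (-(rateMax M * T)) ≤ stay M m s ^ k := by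
  have hm : (0 : ℝ) < m := by exact_mod_cast m.pos
  have h0 := one_lt_one_add_mul_rate M m s
  rw [stay, one_div, inv_pow, Real.exp_neg]
  refine inv_anti₀ (pow_pos (zero_lt_one.trans h0) _) ?_
  calc (1 + (m : ℝ)⁻¹ * M.rate s) ^ k ≤ Real.exp ((m : ℝ)⁻¹ * M.rate s) ^ k := by
        refine pow_le_pow_left₀ (zero_le_one.trans h0.le) ?_ k
        rw [add_comm]
        exact Real.add_one_le_exp _
    _ = Real.exp (k * ((m : ℝ)⁻¹ * M.rate s)) := by rw [← Real.exp_nat_mul]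
    _ ≤ Real.exp (rateMax M * T) := by
        refine Real.exp_le_exp.2 ?_
        have h1 : (k : ℝ) ≤ T * m := by exact_mod_cast hk
        calc (k : ℝ) * ((m : ℝ)⁻¹ * M.rate s) ≤ (T * m) * ((m : ℝ)⁻¹ * M.rate s) :=
              mul_le_mul_of_nonneg_right h1 (mul_pos (inv_pos.2 hm) (M.rate_pos s)).le
          _ = M.rate s * T := by field_simp
          _ ≤ rateMax M * T :=
              mul_le_mul_of_nonneg_right (rate_le_rateMax M s) (Nat.cast_nonneg _)

/-- With k = ⌊m/N⌋, the assumption 2N² < m gives m ≤ 2N²k, hence kρλ(s) ≥ λ_min/(2N²). Bernoulli's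
inequality then bounds the probability of no jump in k steps by 1/(1 + kρλ(s)). -/
theorem le_one_sub_stay_pow (M : CTMC S L) {m : ℕ+} {N : ℕ} (hN : 1 ≤ N)
    (hm : 2 * N ^ 2 < (m : ℕ)) (s : S) (hmin : 0 < rateMin M) :
    rateMin M / (2 * (N : ℝ) ^ 2 + rateMin M) ≤ 1 - stay M m s ^ ((m : ℕ) / N) := by
  have hm0 : (0 : ℝ) < m := by exact_mod_cast m.pos
  have hN0 : (0 : ℝ) < N := by exact_mod_cast hN
  set k := (m : ℕ) / N with hk
  have h1 : (m : ℕ) ≤ 2 * N ^ 2 * k := by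
    have h2 := Nat.lt_div_mul_add (a := (m : ℕ)) (show 0 < N from hN)
    rw [← hk] at h2
    nlinarith
  have h1' : (m : ℝ) ≤ 2 * (N : ℝ) ^ 2 * k := by exact_mod_cast h1
  set x := (m : ℝ)⁻¹ * M.rate s with hx
  have hx0 : 0 < x := mul_pos (inv_pos.2 hm0) (M.rate_pos s)
  have h2 : rateMin M ≤ 2 * (N : ℝ) ^ 2 * (k * x) := by
    refine (rateMin_le_rate M s).trans ?_
    calc M.rate s = m * x := by rw [hx]; field_simp
      _ ≤ 2 * (N : ℝ) ^ 2 * k * x := mul_le_mul_of_nonneg_right h1' hx0.le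
      _ = _ := by ring
  have h3 : stay M m s ^ k ≤ 1 / (1 + k * x) := by
    rw [stay, one_div, inv_pow, one_div]
    exact inv_anti₀ (by positivity) (one_add_mul_le_pow (by linarith) k)
  have h4 : 1 / (1 + k * x) ≤ 2 * (N : ℝ) ^ 2 / (2 * (N : ℝ) ^ 2 + rateMin M) := by
    rw [div_le_div_iff₀ (by positivity) (by positivity)]
    nlinarith
  have h5 : rateMin M / (2 * (N : ℝ) ^ 2 + rateMin M) =
      1 - 2 * (N : ℝ) ^ 2 / (2 * (N : ℝ) ^ 2 + rateMin M) := by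
    field_simp
    ring
  rw [h5]
  linarith

theorem rateMin_pos (M : CTMC S L) (s : S) : 0 < rateMin M := by
  have : Nonempty S := ⟨s⟩
  obtain ⟨u, hu⟩ := exists_eq_ciInf_of_finite (f := M.rate)
  rw [rateMin, ← hu]
  exact M.rate_pos u

theorem pMin_le (M : CTMC S L) {s u : S} (h : 0 < M.P s u) : pMin M ≤ M.P s u :=
  csInf_le ⟨0, fun _ hp => hp.1.le⟩ ⟨h, s, u, rfl⟩

theorem pMin_pos (M : CTMC S L) (s : S) : 0 < pMin M := by
  have hfin : {p | 0 < p ∧ ∃ s u, M.P s u = p}.Finite := by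
    refine (Set.finite_range fun a : S × S => M.P a.1 a.2).subset ?_
    rintro p ⟨-, s, u, rfl⟩
    exact ⟨(s, u), rfl⟩
  have hne : {p | 0 < p ∧ ∃ s u, M.P s u = p}.Nonempty := by
    obtain ⟨u, -, hu⟩ := Finset.exists_lt_of_sum_lt (s := Finset.univ) (f := fun _ : S => (0 : ℝ))
      (g := M.P s) (by rw [M.P_sum]; simp)
    exact ⟨_, hu, s, u, rfl⟩
  exact (hne.csInf_mem hfin).1

theorem pMin_le_one (M : CTMC S L) (s : S) : pMin M ≤ 1 := by
  obtain ⟨u, -, hu⟩ := Finset.exists_lt_of_sum_lt (s := Finset.univ) (f := fun _ : S => (0 : ℝ))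
    (g := M.P s) (by rw [M.P_sum]; simp)
  refine (pMin_le M hu).trans ?_
  rw [← M.P_sum s]
  exact Finset.single_le_sum (fun u _ => M.P_nonneg s u) (Finset.mem_univ u)

theorem constC_pos [Fintype X] (M : CTMC S L) (A : DTA Q L X) (s : S) : 0 < constC M A := by
  have h1 := pMin_pos M s
  have h2 := rateMin_pos M s
  rw [constC]
  positivity

theorem constC_le_exp [Fintype X] (M : CTMC S L) (A : DTA Q L X) (s : S) :
    constC M A ≤ Real.exp (-(rateMax M * A.maxBound)) := by
  have h1 := pMin_pos M s
  have h2 := rateMin_pos M s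
  rw [constC, mul_assoc]
  refine mul_le_of_le_one_right (Real.exp_pos _).le (mul_le_one₀ (pMin_le_one M s) (by positivity) ?_)
  exact (div_le_one (by positivity)).2 (by nlinarith [sq_nonneg (cardV S A : ℝ)])

theorem constC_le_one [Fintype X] (M : CTMC S L) (A : DTA Q L X) (s : S) : constC M A ≤ 1 :=
  (constC_le_exp M A s).trans (Real.exp_le_one_iff.2
    (neg_nonpos.2 (mul_nonneg (rateMax_pos M s).le (Nat.cast_nonneg _))))

/-- A nonnegative function which is bounded by `E`, vanishes outside `B_m` and satisfies the
homogeneous equations as inequalities, up to `ε` at the vertices below the clock bounds. -/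
structure IsErrorBound [Finite X] (M : CTMC S L) (A : DTA Q L X) (m : ℕ+) (e : Grid S A m → ℝ)
    (E ε : ℝ) : Prop where
  eps_nonneg : 0 ≤ ε
  nonneg : ∀ v, 0 ≤ e v
  le : ∀ v, e v ≤ E
  eq_zero : ∀ v, ¬ InB M A m v → e v = 0
  le_rhs : ∀ v, InB M A m v → ¬ AtMax v → e v ≤ rhs M A m e v + ε
  le_rhs_max : ∀ v, InB M A m v → AtMax v → e v ≤ rhs M A m e v

namespace IsErrorBound

variable [Fintype X] {M : CTMC S L} {A : DTA Q L X} {m : ℕ+} {e : Grid S A m → ℝ} {E ε : ℝ}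

theorem sum_le (h : IsErrorBound M A m e E ε) (v : Grid S A m) :
    ∑ u, M.P v.1.1 u * e (v.jump M u) ≤ E := by
  calc ∑ u, M.P v.1.1 u * e (v.jump M u) ≤ ∑ u, M.P v.1.1 u * E :=
        Finset.sum_le_sum fun u _ => mul_le_mul_of_nonneg_left (h.le _) (M.P_nonneg _ u)
    _ = E := by rw [← Finset.sum_mul, M.P_sum, one_mul]

theorem sum_le_of_jump (h : IsErrorBound M A m e E ε) (v : Grid S A m) {u : S} {E' p : ℝ}
    (hu : e (v.jump M u) ≤ E') (hE : E' ≤ E) (hp : p ≤ M.P v.1.1 u) :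
    ∑ u, M.P v.1.1 u * e (v.jump M u) ≤ E - p * (E - E') := by
  classical
  have h1 : ∑ w, M.P v.1.1 w * e (v.jump M w) ≤
      ∑ w, M.P v.1.1 w * (if w = u then E' else E) := by
    refine Finset.sum_le_sum fun w _ => mul_le_mul_of_nonneg_left ?_ (M.P_nonneg _ w)
    split_ifs with hw
    · rw [hw]; exact hu
    · exact h.le _
  have h2 : ∀ w, M.P v.1.1 w * (if w = u then E' else E) =
      M.P v.1.1 w * E - (if w = u then M.P v.1.1 w * (E - E') else 0) := by
    intro w
    split_ifs <;> ring
  have h3 : ∑ w, M.P v.1.1 w * (if w = u then E' else E) = E - M.P v.1.1 u * (E - E') := by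
    simp only [h2, Finset.sum_sub_distrib, ← Finset.sum_mul, M.P_sum, one_mul,
      Finset.sum_ite_eq', Finset.mem_univ, if_true]
  have h4 : p * (E - E') ≤ M.P v.1.1 u * (E - E') :=
    mul_le_mul_of_nonneg_right hp (sub_nonneg.2 hE)
  linarith

theorem rhs_eq (v : Grid S A m) (hv : ¬ AtMax v) : rhs M A m e v =
    stay M m v.1.1 * e v.delay + (1 - stay M m v.1.1) * ∑ u, M.P v.1.1 u * e (v.jump M u) := by
  rw [rhs, if_neg hv, one_sub_stay, stay]

theorem le_delay (h : IsErrorBound M A m e E ε) (v : Grid S A m) :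
    e v ≤ E - stay M m v.1.1 * (E - e v.delay) + ε := by
  have h1 := stay_le_one M m v.1.1
  have h2 := stay_pos M m v.1.1
  have h3 := h.le v.delay
  have h4 := h.nonneg v.delay
  have h5 := h.eps_nonneg
  by_cases hB : InB M A m v
  · by_cases hmax : AtMax v
    · rw [hmax.delay_eq]
      have := h.le v
      nlinarith
    · have h6 := h.le_rhs v hB hmax
      rw [rhs_eq v hmax] at h6
      have h7 := mul_le_mul_of_nonneg_left (h.sum_le v) (sub_nonneg.2 h1)
      linarith
  · rw [h.eq_zero v hB]
    nlinarith

theorem le_delay_iterate (h : IsErrorBound M A m e E ε) (v : Grid S A m) (k : ℕ) :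
    e v ≤ E - stay M m v.1.1 ^ k * (E - e (Grid.delay^[k] v)) + k * ε := by
  induction k generalizing v with
  | zero => simp
  | succ k ih =>
    have h1 := h.le_delay v
    have h2 := ih v.delay
    rw [show v.delay.1.1 = v.1.1 from rfl] at h2
    rw [Function.iterate_succ_apply, pow_succ]
    push_cast
    have h3 := stay_pos M m v.1.1
    have h4 := mul_le_mul_of_nonneg_left h2 h3.le
    have h5 : stay M m v.1.1 * (k * ε) ≤ k * ε :=
      mul_le_of_le_one_left (mul_nonneg (Nat.cast_nonneg _) h.eps_nonneg) (stay_le_one M m v.1.1)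
    linarith

/-- However long the wait, only the first T_max · m steps count, both for the probability of not
jumping and for the accumulated ε. -/
theorem le_wait (h : IsErrorBound M A m e E ε) (v : Grid S A m) (k : ℕ) :
    e v ≤ E - Real.exp (-(rateMax M * A.maxBound)) * (E - e (Grid.delay^[k] v)) +
      A.maxBound * m * ε := by
  rw [v.delay_iterate_min k]
  set K := min k (A.maxBound * m) with hK
  have hK' : K ≤ A.maxBound * m := min_le_right _ _
  have h1 := h.le_delay_iterate v K
  have h2 := mul_le_mul_of_nonneg_right (exp_le_stay_pow M m v.1.1 hK')
    (sub_nonneg.2 (h.le (Grid.delay^[K] v)))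
  have h3 : (K : ℝ) * ε ≤ A.maxBound * m * ε := by
    refine mul_le_mul_of_nonneg_right ?_ h.eps_nonneg
    exact_mod_cast hK'
  linarith

/-- A jump to `u` is favourable at each of the next `k` grid points. One of the steps is a jump with
probability 1 - `stay`^k, or with certainty if the clocks reach their bounds, and it goes to `u`
with probability at least `p`. -/
theorem le_window (h : IsErrorBound M A m e E ε) (v : Grid S A m) (k : ℕ) {u : S} {E' p : ℝ}
    (hE : E' ≤ E) (hp0 : 0 ≤ p) (hp : p ≤ M.P v.1.1 u)
    (hj : ∀ j < k, e ((Grid.delay^[j] v).jump M u) ≤ E') :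
    e v ≤ E - (1 - stay M m v.1.1 ^ k) * (p * (E - E')) + k * ε := by
  induction k generalizing v with
  | zero => simpa using h.le v
  | succ k ih =>
    set a := stay M m v.1.1 with ha
    have ha0 : 0 < a := stay_pos M m v.1.1
    have ha1 : a ≤ 1 := stay_le_one M m v.1.1
    have hak : 0 < a ^ (k + 1) := pow_pos ha0 _
    have hak1 : a ^ (k + 1) ≤ 1 := pow_le_one₀ ha0.le ha1
    have hJ := h.sum_le_of_jump v (hj 0 (Nat.succ_pos k)) hE hp
    have hp1 : 0 ≤ p * (E - E') := mul_nonneg hp0 (sub_nonneg.2 hE)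
    have hε : 0 ≤ ((k + 1 : ℕ) : ℝ) * ε := mul_nonneg (Nat.cast_nonneg _) h.eps_nonneg
    have hJ0 : 0 ≤ ∑ u, M.P v.1.1 u * e (v.jump M u) :=
      Finset.sum_nonneg fun u _ => mul_nonneg (M.P_nonneg _ u) (h.nonneg _)
    have hle : (1 - a ^ (k + 1)) * (p * (E - E')) ≤ p * (E - E') :=
      mul_le_of_le_one_left hp1 (by linarith)
    by_cases hB : InB M A m v
    · by_cases hmax : AtMax v
      · have h1 := h.le_rhs_max v hB hmax
        rw [rhs, if_pos hmax] at h1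
        linarith
      · have h1 := h.le_rhs v hB hmax
        rw [rhs_eq v hmax, ← ha] at h1
        have h2 := ih v.delay hp fun j hj' => by
          have := hj (j + 1) (Nat.succ_lt_succ hj')
          rwa [Function.iterate_succ_apply] at this
        rw [show v.delay.1.1 = v.1.1 from rfl, ← ha] at h2
        have h3 := mul_le_mul_of_nonneg_left h2 ha0.le
        have h4 := mul_le_mul_of_nonneg_left hJ (sub_nonneg.2 ha1)
        have h5 : a * (k * ε) ≤ k * ε :=
          mul_le_of_le_one_left (mul_nonneg (Nat.cast_nonneg _) h.eps_nonneg) ha1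
        rw [pow_succ]
        push_cast
        linarith
    -- The right-hand side is non-negative: the jump average is at least 0 and at most E - p(E -
    -- E').
    · rw [h.eq_zero v hB]
      linarith

/-- Wait `d` steps, then jump within the next ⌊m/|V|⌋ to the prescribed state: the three
probabilities multiply to 𝔠. The local error enters at most T_max · m times while waiting and `m`
times in the window. -/
theorem le_edge (h : IsErrorBound M A m e E ε) (hm : 2 * cardV S A ^ 2 < (m : ℕ))
    (hV : 1 ≤ cardV S A) (v : Grid S A m) (d : ℕ) {u : S} {E' : ℝ} (hP : 0 < M.P v.1.1 u)
    (hj : ∀ j < (m : ℕ) / cardV S A, e ((Grid.delay^[d + j] v).jump M u) ≤ E') :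
    e v ≤ E - constC M A * (E - E') + (A.maxBound + 1) * m * ε := by
  have hε : 0 ≤ (A.maxBound + 1) * m * ε := by
    have := h.eps_nonneg
    positivity
  have hc := constC_pos M A v.1.1
  rcases le_total E E' with hE | hE
  · have := h.le v
    nlinarith
  set w := Grid.delay^[d] v with hw
  have hws : w.1.1 = v.1.1 := v.delay_iterate_state d
  have h1 := h.le_wait v d
  have h2 := h.le_window w ((m : ℕ) / cardV S A) hE (pMin_pos M v.1.1).le
    (by rw [hws]; exact pMin_le M hP) fun j hj' => by
      rw [hw, ← Function.iterate_add_apply, add_comm]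
      exact hj j hj'
  rw [hws] at h2
  rw [← hw] at h1
  have h3 := le_one_sub_stay_pow M hV hm v.1.1 (rateMin_pos M v.1.1)
  have h4 : ((((m : ℕ) / cardV S A : ℕ) : ℝ)) * ε ≤ m * ε := by
    refine mul_le_mul_of_nonneg_right ?_ h.eps_nonneg
    exact_mod_cast Nat.div_le_self _ _
  set β := Real.exp (-(rateMax M * A.maxBound)) with hβ
  set γ := rateMin M / (2 * (cardV S A : ℝ) ^ 2 + rateMin M) with hγ
  have hβ0 : 0 < β := Real.exp_pos _
  have hβ1 : β ≤ 1 := Real.exp_le_one_iff.2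
    (neg_nonpos.2 (mul_nonneg (rateMax_pos M v.1.1).le (Nat.cast_nonneg _)))
  have hp1 : 0 ≤ pMin M * (E - E') := mul_nonneg (pMin_pos M v.1.1).le (sub_nonneg.2 hE)
  have h5 := mul_le_mul_of_nonneg_right h3 hp1
  have h6 : E - e w ≥ γ * (pMin M * (E - E')) - m * ε := by linarith
  have h7 := mul_le_mul_of_nonneg_left h6.le hβ0.le
  have h8 : β * (m * ε) ≤ m * ε :=
    mul_le_of_le_one_left (mul_nonneg (Nat.cast_nonneg _) h.eps_nonneg) hβ1
  have h9 : constC M A * (E - E') = β * (γ * (pMin M * (E - E'))) := by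
    rw [constC, ← hβ, ← hγ]
    ring
  rw [h9]
  linarith

end IsErrorBound

end Product

/-! ### Imitating a concrete run on the grid -/

namespace Product

section Tracking

variable {Q L X : Type*} {A : DTA Q L X} {m : ℕ+} {τ : ℕ → ℝ≥0} {σ : ℕ → ℕ} {i : ℕ}

/-- The grid valuation `η` at grid time `k` tracks the valuation `ζ` at time `a`: every clock is
past its bound in both, or has last been reset at one of the jump times `τ j`, `σ j`. -/
def Tracks (A : DTA Q L X) (m : ℕ+) (τ : ℕ → ℝ≥0) (σ : ℕ → ℕ) (i : ℕ) (a : ℝ≥0) (k : ℕ)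
    (ζ η : Val X) : Prop :=
  ∀ x, ((A.bound x : ℝ≥0) ≤ ζ x ∧ η x = A.bound x) ∨ ∃ j ≤ i, ∃ D : ℕ, ζ x + τ j = a ∧
    D + σ j = k ∧ η x = min (A.bound x : ℝ≥0) ((D : ℝ≥0) * ((m : ℕ) : ℝ≥0)⁻¹)

theorem Tracks.delay {a : ℝ≥0} {k : ℕ} {ζ η : Val X} (h : Tracks A m τ σ i a k ζ η) (t : ℝ≥0)
    (d : ℕ) : Tracks A m τ σ i (a + t) (k + d) (ζ.delay t)
      (A.oplus η ((d : ℝ≥0) * ((m : ℕ) : ℝ≥0)⁻¹)) := by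
  intro x
  rcases h x with ⟨h1, h2⟩ | ⟨j, hj, D, h1, h2, h3⟩
  · left
    refine ⟨h1.trans le_self_add, ?_⟩
    simp only [DTA.oplus, h2]
    exact min_eq_left le_self_add
  · right
    refine ⟨j, hj, D + d, ?_, by omega, ?_⟩
    · rw [← h1, Val.delay]
      ring
    · simp only [DTA.oplus, h3, Nat.cast_add, add_mul]
      rw [← min_add_add_right, ← min_assoc, min_eq_left (le_self_add : (A.bound x : ℝ≥0) ≤ _)]

theorem Tracks.reset {a : ℝ≥0} {k : ℕ} {ζ η : Val X} (h : Tracks A m τ σ i a k ζ η)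
    (Y : Set X) (ha : τ (i + 1) = a) :
    Tracks A m τ (Function.update σ (i + 1) k) (i + 1) a k (ζ.reset Y) (η.reset Y) := by
  intro x
  by_cases hx : x ∈ Y
  · right
    refine ⟨i + 1, le_rfl, 0, ?_, ?_, ?_⟩
    · simp [Val.reset, hx, ha]
    · simp
    · simp [Val.reset, hx]
  · simp only [Val.reset, hx, if_false]
    rcases h x with h1 | ⟨j, hj, D, h1, h2, h3⟩
    · exact Or.inl h1
    · refine Or.inr ⟨j, hj.trans i.le_succ, D, h1, ?_, h3⟩
      rw [Function.update_of_ne (by omega), h2]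

/-- By non-marginality a clock of ζ + t never equals a relevant constant c. If it is below c, the
grid count is at most mc - 1 and a further r < 1/m does not reach c; if above, the count is at least
mc and r > 0 passes c. Hence a weak inequality suffices in `hgt`. -/
theorem Tracks.cmpEquiv {a : ℝ≥0} {k : ℕ} {ζ η : Val X} (h : Tracks A m τ σ i a k ζ η)
    {t : ℝ≥0} (ht : 0 < t) (hm : ¬ A.Marginal (ζ.delay t)) (d : ℕ)
    (hlt : ∀ j ≤ i, ∀ c : ℕ, a + t < τ j + c → k + d < σ j + m * c)
    (hgt : ∀ j ≤ i, ∀ c : ℕ, τ j + c < a + t → σ j + m * c ≤ k + d) {r : ℝ≥0} (hr : 0 < r)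
    (hrm : r * (m : ℕ) < 1) :
    A.CmpEquiv ((A.oplus η ((d : ℝ≥0) * ((m : ℕ) : ℝ≥0)⁻¹)).delay r) (ζ.delay t) := by
  have hm0 : (0 : ℝ≥0) < (m : ℕ) := by exact_mod_cast m.pos
  intro x c hc
  have hc' : (c : ℝ≥0) ≤ A.bound x := by exact_mod_cast hc
  rcases h x with ⟨h1, h2⟩ | ⟨j, hj, D, h1, h2, h3⟩
  · have e1 : (c : ℝ≥0) < (ζ.delay t) x := (hc'.trans h1).trans_lt (lt_add_of_pos_right _ ht)
    have e2 : (c : ℝ≥0) < ((A.oplus η ((d : ℝ≥0) * ((m : ℕ) : ℝ≥0)⁻¹)).delay r) x := by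
      simp only [DTA.oplus, Val.delay, h2]
      rw [min_eq_left le_self_add]
      exact hc'.trans_lt (lt_add_of_pos_right _ hr)
    exact ⟨iff_of_false e2.not_ge e1.not_ge, iff_of_false e2.not_gt e1.not_gt⟩
  · have e : (A.oplus η ((d : ℝ≥0) * ((m : ℕ) : ℝ≥0)⁻¹)) x =
        min (A.bound x : ℝ≥0) (((D + d : ℕ) : ℝ≥0) * ((m : ℕ) : ℝ≥0)⁻¹) := by
      simp only [DTA.oplus, h3, Nat.cast_add, add_mul]
      rw [← min_add_add_right, ← min_assoc, min_eq_left (le_self_add : (A.bound x : ℝ≥0) ≤ _)]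
    have hδ : (ζ.delay t) x + τ j = a + t := by
      rw [← h1, Val.delay]
      ring
    have hne : (ζ.delay t) x ≠ c := by
      intro he
      refine hm ⟨x, he.trans_le hc', ?_⟩
      rw [he, NNReal.coe_natCast, Int.fract_natCast]
    rcases lt_or_gt_of_ne hne with h4 | h4
    · have h5 := hlt j hj c (by rw [← hδ, add_comm (τ j)]; gcongr)
      have h6 : D + d + 1 ≤ m * c := by omega
      have h7 : ((A.oplus η ((d : ℝ≥0) * ((m : ℕ) : ℝ≥0)⁻¹)).delay r) x < c := by
        change (A.oplus η ((d : ℝ≥0) * ((m : ℕ) : ℝ≥0)⁻¹)) x + r < c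
        rw [e]
        refine lt_of_le_of_lt (add_le_add_left (min_le_right _ _) r) ?_
        rw [← mul_lt_mul_iff_left₀ hm0, add_mul, mul_assoc, inv_mul_cancel₀ hm0.ne', mul_one]
        calc ((D + d : ℕ) : ℝ≥0) + r * (m : ℕ) < ((D + d : ℕ) : ℝ≥0) + 1 := by gcongr
          _ ≤ c * (m : ℕ) := by
            rw [mul_comm]
            exact_mod_cast h6
      exact ⟨iff_of_true h7.le h4.le, iff_of_true h7 h4⟩
    · have h5 := hgt j hj c (by rw [← hδ, add_comm (τ j)]; gcongr)
      have h6 : m * c ≤ D + d := by omega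
      have h7 : c < ((A.oplus η ((d : ℝ≥0) * ((m : ℕ) : ℝ≥0)⁻¹)).delay r) x := by
        change c < (A.oplus η ((d : ℝ≥0) * ((m : ℕ) : ℝ≥0)⁻¹)) x + r
        rw [e]
        refine lt_of_le_of_lt (le_min hc' ?_) (lt_add_of_pos_right _ hr)
        rw [le_mul_inv_iff₀ hm0, mul_comm]
        exact_mod_cast h6
      exact ⟨iff_of_false h7.not_ge h4.not_ge, iff_of_false h7.not_gt h4.not_gt⟩

end Tracking

variable {S L Q X : Type*} [Fintype S] [Fintype X] {M : CTMC S L} {A : DTA Q L X} {m : ℕ+}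
  {e : Grid S A m → ℝ} {E ε : ℝ}

/-- Induction on the number of edges still ahead. The claim covers every choice of past grid jump
times inside their windows, since `le_edge` needs a bound that is uniform over the moment of the
jump. -/
theorem IsErrorBound.le_of_run (h : IsErrorBound M A m e E ε)
    (hm : 2 * cardV S A ^ 2 < (m : ℕ)) (hV : 1 ≤ cardV S A) {n : ℕ} {f : ℕ → Vertex S A}
    {ζ : ℕ → Val X} {t : ℕ → ℝ≥0} (hfin : IsFinal (f n))
    (hP : ∀ i < n, 0 < M.P (f i).1 (f (i + 1)).1)
    (hrun : ∀ i < n, 0 < t i ∧ ¬ A.Marginal ((ζ i).delay (t i)) ∧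
      A.step ((f i).2.1, ζ i) (M.label (f i).1, t i) = ((f (i + 1)).2.1, ζ (i + 1)))
    {τ : ℕ → ℝ≥0} (hτ : ∀ i, τ (i + 1) = τ i + t i) {b : ℕ → ℕ}
    (hb : ∀ i ≤ n, ∀ j ≤ n, ∀ c d k l : ℕ, τ i + d < τ j + c →
      k < b i + m / cardV S A → b j ≤ l → k + m * d < l + m * c)
    (k i : ℕ) (hi : i + k = n) (σ : ℕ → ℕ)
    (hσ : ∀ j ≤ i, b j ≤ σ j ∧ σ j < b j + m / cardV S A) (v : Grid S A m)
    (hs : v.1.1 = (f i).1) (hq : v.1.2.1 = (f i).2.1)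
    (hv : Tracks A m τ σ i (τ i) (σ i) (ζ i) v.1.2.2) :
    e v ≤ E - constC M A ^ k * E + k * ((A.maxBound + 1) * m * ε) := by
  have hκ : 0 ≤ (A.maxBound + 1) * m * ε := by
    have := h.eps_nonneg
    positivity
  induction k generalizing i σ v with
  | zero =>
    have hi' : i = n := hi
    have hB : ¬ InB M A m v := fun hB => hB.1 (by
      change v.1.2.1 ∈ A.final
      rw [hq, hi']
      exact hfin)
    rw [h.eq_zero v hB]
    simp
  | succ k ih =>
    have hin : i < n := by omega
    have hc0 := constC_pos M A v.1.1
    have hc1 := constC_le_one M A v.1.1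
    obtain ⟨ht, hmarg, hstep⟩ := hrun i hin
    -- Successive windows are disjoint and in order because the concrete delay is positive; so the
    -- natural subtraction in the waiting time below is not truncated.
    have hσb : σ i < b (i + 1) := by
      have := hb i hin.le (i + 1) hin 0 0 (σ i) (b (i + 1))
        (by rw [hτ]; simpa using ht) (hσ i le_rfl).2 le_rfl
      simpa using this
    have hedge := h.le_edge hm hV v (b (i + 1) - σ i) (u := (f (i + 1)).1)
      (E' := E - constC M A ^ k * E + k * ((A.maxBound + 1) * m * ε))
      (by rw [hs]; exact hP i hin) fun j hj => ?_
    · have h1 : constC M A * (k * ((A.maxBound + 1) * m * ε)) ≤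
          k * ((A.maxBound + 1) * m * ε) :=
        mul_le_of_le_one_left (mul_nonneg (Nat.cast_nonneg _) hκ) hc1
      rw [pow_succ]
      push_cast
      linarith
    · set d := b (i + 1) - σ i + j with hd
      have hσd : σ i + d = b (i + 1) + j := by omega
      have hw := v.delay_iterate d
      set w := Grid.delay^[d] v with hwdef
      have hσd' : σ i + d < b (i + 1) + m / cardV S A := by omega
      have hσd'' : b (i + 1) ≤ σ i + d := by omega
      obtain ⟨r₁, hr₁, hplus⟩ := A.exists_ruleAt_plus w.1.2.2
      have hm0 : (0 : ℝ≥0) < (m : ℕ) := by exact_mod_cast m.pos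
      -- A delay small enough to represent η⁺ and shorter than one grid step.
      obtain ⟨r, hr0, hr⟩ := exists_between (lt_min hr₁ (inv_pos.2 hm0))
      have hrm : r * (m : ℕ) < 1 := by
        have := mul_lt_mul_of_pos_right (hr.trans_le (min_le_right _ _)) hm0
        rwa [inv_mul_cancel₀ hm0.ne'] at this
      have hcmp := hv.cmpEquiv ht hmarg d
        (fun j' hj' c hc => by
          have := hb (i + 1) hin j' (by omega) c 0 (σ i + d) (σ j')
            (by rw [hτ]; simpa using hc) hσd' (hσ j' hj').1
          simpa using this)
        (fun j' hj' c hc => by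
          have := hb j' (by omega) (i + 1) hin 0 c (σ j') (σ i + d)
            (by rw [hτ]; simpa using hc) (hσ j' hj').2 hσd''
          simpa using this.le) hr0 hrm
      have hrule : A.ruleAt w.1.2.1 (M.label w.1.1) (A.plus w.1.2.2) =
          A.ruleAt (f i).2.1 (M.label (f i).1) ((ζ i).delay (t i)) := by
        rw [hplus r hr0 (hr.trans_le (min_le_left _ _)), hw]
        dsimp only
        rw [hcmp.ruleAt_eq, hs, hq]
      have hstep1 := (Prod.ext_iff.1 hstep).1
      have hstep2 : _ = ζ (i + 1) := (Prod.ext_iff.1 hstep).2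
      refine ih (i + 1) (by omega) (Function.update σ (i + 1) (σ i + d)) (fun j' hj' => ?_)
        (w.jump M (f (i + 1)).1) rfl ?_ ?_
      · rcases Nat.lt_succ_iff_lt_or_eq.1 (Nat.lt_succ_of_le hj') with h1 | rfl
        · rw [Function.update_of_ne (by omega)]
          exact hσ j' (by omega)
        · rw [Function.update_self]
          exact ⟨hσd'', hσd'⟩
      · change (A.ruleAt w.1.2.1 (M.label w.1.1) (A.plus w.1.2.2)).tgt = _
        rw [hrule]
        exact hstep1
      · have h1 := (hv.delay (t i) d).reset
          (A.ruleAt (f i).2.1 (M.label (f i).1) ((ζ i).delay (t i))).resets (hτ i)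
        change Tracks A m τ _ (i + 1) _ _ _
          (w.1.2.2.reset (A.ruleAt w.1.2.1 (M.label w.1.1) (A.plus w.1.2.2)).resets)
        rw [hrule, ← hstep2, Function.update_self, hτ]
        have h2 : w.1.2.2 = A.oplus v.1.2.2 ((d : ℝ≥0) * ((m : ℕ) : ℝ≥0)⁻¹) := by rw [hw]
        rw [h2]
        exact h1

/-- Waiting until all clocks are at their bounds makes the grid valuation track itself, with no
reset times to account for. This wait contributes a factor of at least 𝔠, and the path that follows
has at most |V| - 1 edges. -/
theorem IsErrorBound.le_sub_pow [Finite Q] (h : IsErrorBound M A m e E ε)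
    (hm : 2 * cardV S A ^ 2 < (m : ℕ)) (v : Grid S A m) :
    e v ≤ E - constC M A ^ cardV S A * E + cardV S A * ((A.maxBound + 1) * m * ε) := by
  have hV : 1 ≤ cardV S A := by
    have : Nonempty (Vertex S A) := ⟨vertex A v.1⟩
    exact Nat.card_pos
  have hc0 := constC_pos M A v.1.1
  have hc1 := constC_le_one M A v.1.1
  have hcβ := constC_le_exp M A v.1.1
  have hE : 0 ≤ E := (h.nonneg v).trans (h.le v)
  set β := Real.exp (-(rateMax M * A.maxBound)) with hβ
  have hβ1 : β ≤ 1 := Real.exp_le_one_iff.2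
    (neg_nonpos.2 (mul_nonneg (rateMax_pos M v.1.1).le (Nat.cast_nonneg _)))
  set κ := (A.maxBound + 1) * m * ε with hκdef
  have hκ : 0 ≤ κ := by
    have := h.eps_nonneg
    positivity
  have hκ' : A.maxBound * m * ε ≤ κ := by
    have : 0 ≤ m * ε := mul_nonneg (Nat.cast_nonneg _) h.eps_nonneg
    rw [hκdef]
    linarith
  have hwait := h.le_wait v (A.maxBound * m)
  rw [← hβ] at hwait
  have hwmax := v.atMax_delay_iterate (k := A.maxBound * m) le_rfl
  set w := Grid.delay^[A.maxBound * m] v with hw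
  suffices hkey : ∃ n, n + 1 ≤ cardV S A ∧ e w ≤ E - constC M A ^ n * E + n * κ by
    obtain ⟨n, hn, h1⟩ := hkey
    have h2 : constC M A ^ cardV S A ≤ constC M A ^ (n + 1) :=
      pow_le_pow_of_le_one hc0.le hc1 hn
    have h3 : constC M A ^ (n + 1) ≤ β * constC M A ^ n := by
      rw [pow_succ']
      exact mul_le_mul_of_nonneg_right hcβ (pow_pos hc0 n).le
    have h4 := mul_le_mul_of_nonneg_right (h2.trans h3) hE
    have h5 := mul_le_mul_of_nonneg_left h1 (Real.exp_pos (-(rateMax M * A.maxBound))).le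
    rw [← hβ] at h5
    have h6 : β * (n * κ) ≤ n * κ :=
      mul_le_of_le_one_left (mul_nonneg (Nat.cast_nonneg _) hκ) hβ1
    have h7 : ((n : ℝ) + 1) * κ ≤ cardV S A * κ :=
      mul_le_mul_of_nonneg_right (by exact_mod_cast hn) hκ
    linarith
  by_cases hB : InB M A m w
  · obtain ⟨z, hz, hzfin⟩ := hB.2
    obtain ⟨n, hn, f, hf0, hfn, hf⟩ := hz.exists_path_lt_card
    obtain ⟨ζ, t, hζ0, hrun⟩ := exists_run hf (ζ₀ := w.1.2.2) (by rw [hf0]; rfl)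
    let τ : ℕ → ℝ≥0 := fun i => ∑ j ∈ Finset.range i, t j
    obtain ⟨b, hb⟩ := exists_windows (m := m) (N := cardV S A) hn τ
    have hpos : 0 < (m : ℕ) / cardV S A := by
      refine Nat.div_pos ?_ hV
      nlinarith
    refine ⟨n, hn, h.le_of_run hm hV (hfn ▸ hzfin) (fun i hi => (hf i hi).1) hrun (τ := τ)
      (fun i => Finset.sum_range_succ _ _) hb n 0 (zero_add n) b
      (fun j _ => ⟨le_rfl, by omega⟩) w (by rw [hf0]; rfl) (by rw [hf0]; rfl) fun x => ?_⟩
    left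
    rw [hζ0]
    exact ⟨(hwmax x).ge, hwmax x⟩
  · refine ⟨0, hV, ?_⟩
    rw [h.eq_zero w hB]
    simp

end Product

/-! ### The linear system and the global error -/

namespace Product

variable {S L Q X : Type*} [Fintype S] {M : CTMC S L} {A : DTA Q L X} {m : ℕ+}

open Classical in
/-- Extend a vector over `B_m` by the known values outside of `B_m`. -/
noncomputable def extend (M : CTMC S L) (A : DTA Q L X) (m : ℕ+) (μ : B M A m → ℝ) :
    Grid S A m → ℝ :=
  fun w => if h : InB M A m w then μ ⟨w, h⟩ else if IsFinal (vertex A w.1) then 1 else 0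

theorem extend_coe (μ : B M A m → ℝ) (v : B M A m) : extend M A m μ v.1 = μ v := by
  rw [extend, dif_pos v.2]

theorem not_inB_iff {v : Grid S A m} :
    ¬ InB M A m v ↔ IsFinal (vertex A v.1) ∨ ¬ ReachesFinal M A (vertex A v.1) := by
  rw [InB, not_and_or, not_not]

variable [Fintype X]

/-- The right-hand side of the discretised equations as a linear form. -/
noncomputable def rhsLin (M : CTMC S L) (A : DTA Q L X) (m : ℕ+) (v : Grid S A m) :
    (Grid S A m → ℝ) →ₗ[ℝ] ℝ where
  toFun h := rhs M A m h v
  map_add' h k := by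
    simp only [rhs, Pi.add_apply, mul_add, Finset.sum_add_distrib]
    split_ifs <;> ring
  map_smul' c h := by
    have : ∀ u, M.P v.1.1 u * (c * h (v.jump M u)) = c * (M.P v.1.1 u * h (v.jump M u)) :=
      fun u => mul_left_comm _ _ _
    simp only [rhs, Pi.smul_apply, smul_eq_mul, this, ← Finset.mul_sum, RingHom.id_apply]
    split_ifs <;> ring

theorem rhs_sub (h k : Grid S A m → ℝ) (v : Grid S A m) :
    rhs M A m (fun w => h w - k w) v = rhs M A m h v - rhs M A m k v :=
  map_sub (rhsLin M A m v) h k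

theorem abs_rhs_le (h : Grid S A m → ℝ) (v : Grid S A m) :
    |rhs M A m h v| ≤ rhs M A m (fun w => |h w|) v := by
  have hsum : |∑ u, M.P v.1.1 u * h (v.jump M u)| ≤ ∑ u, M.P v.1.1 u * |h (v.jump M u)| := by
    refine (Finset.abs_sum_le_sum_abs _ _).trans (Finset.sum_le_sum fun u _ => ?_)
    rw [abs_mul, abs_of_nonneg (M.P_nonneg _ u)]
  by_cases hv : AtMax v
  · simp only [rhs, if_pos hv]
    exact hsum
  · rw [IsErrorBound.rhs_eq v hv, IsErrorBound.rhs_eq v hv]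
    refine (abs_add_le _ _).trans (add_le_add ?_ ?_)
    · rw [abs_mul, abs_of_pos (stay_pos M m _)]
    · rw [abs_mul, abs_of_nonneg (sub_nonneg.2 (stay_le_one M m _))]
      exact mul_le_mul_of_nonneg_left hsum (sub_nonneg.2 (stay_le_one M m _))

/-- A function which vanishes outside `B_m` and satisfies the homogeneous equations up to `ε` below
the clock bounds is small. -/
theorem abs_le_of_abs_sub_rhs_le [Finite Q] (hm : 2 * cardV S A ^ 2 < (m : ℕ))
    {g : Grid S A m → ℝ} {ε : ℝ} (hε : 0 ≤ ε) (h0 : ∀ v, ¬ InB M A m v → g v = 0)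
    (h1 : ∀ v, InB M A m v → ¬ AtMax v → |g v - rhs M A m g v| ≤ ε)
    (h2 : ∀ v, InB M A m v → AtMax v → g v = rhs M A m g v) (v : Grid S A m) :
    |g v| ≤ cardV S A * (constC M A ^ cardV S A)⁻¹ * (2 * A.maxBound * m * ε) := by
  -- At a maximum, the estimate of `le_sub_pow` bounds the maximum itself.
  obtain ⟨v₀, hv₀⟩ := @Finite.exists_max _ _ _ ⟨v⟩ _ fun w => |g w|
  have key : ∀ δ : ℝ, 0 ≤ δ → (∀ v, InB M A m v → ¬ AtMax v → |g v - rhs M A m g v| ≤ δ) →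
      constC M A ^ cardV S A * |g v₀| ≤ cardV S A * ((A.maxBound + 1) * m * δ) := by
    intro δ hδ h1'
    have hb : IsErrorBound M A m (fun w => |g w|) |g v₀| δ :=
      { eps_nonneg := hδ
        nonneg := fun w => abs_nonneg _
        le := hv₀
        eq_zero := fun w hw => by rw [h0 w hw, abs_zero]
        le_rhs := fun w hw hmax => by
          have e1 := abs_rhs_le (M := M) g w
          have e2 := abs_add_le (rhs M A m g w) (g w - rhs M A m g w)
          rw [add_sub_cancel] at e2
          linarith [h1' w hw hmax]
        le_rhs_max := fun w hw hmax => by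
          have e1 := abs_rhs_le (M := M) g w
          rwa [← h2 w hw hmax] at e1 }
    have := hb.le_sub_pow hm v₀
    linarith
  have hc := pow_pos (constC_pos M A v.1.1) (cardV S A)
  refine (hv₀ v).trans ?_
  rw [mul_right_comm, ← div_eq_mul_inv, le_div_iff₀ hc, mul_comm]
  -- If T_max = 0, all grid points have their clocks at the bounds and the local error may be taken
  -- to be 0; otherwise T_max + 1 ≤ 2 T_max.
  rcases Nat.eq_zero_or_pos A.maxBound with hT | hT
  · have hall : ∀ w : Grid S A m, AtMax w := by
      intro w x
      have hx : A.bound x = 0 := Nat.le_zero.1 (hT ▸ A.bound_le_maxBound x)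
      have := (w.2 x).1
      rw [hx, Nat.cast_zero] at this ⊢
      exact le_antisymm this zero_le
    have := key 0 le_rfl fun w _ hw => absurd (hall w) hw
    simpa [hT] using this
  · refine (key ε hε h1).trans (mul_le_mul_of_nonneg_left ?_ (Nat.cast_nonneg _))
    have hT' : (1 : ℝ) ≤ A.maxBound := by exact_mod_cast hT
    have : 0 ≤ m * ε := mul_nonneg (Nat.cast_nonneg _) hε
    nlinarith

/-- The extended vector is a combination of unit vectors at points of B_m plus the indicator of the
final vertices, which vanishes on B_m; the equations are linear in it. -/
theorem matC_mulVec_add_vecD [Finite Q] (μ : B M A m → ℝ) (v : B M A m) :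
    (matC M A m *ᵥ μ + vecD M A m) v = rhs M A m (extend M A m μ) v.1 := by
  classical
  have h : extend M A m μ = (∑ w : B M A m, μ w • (Pi.single w.1 1 : Grid S A m → ℝ)) +
      fun w => if IsFinal (vertex A w.1) then 1 else 0 := by
    funext z
    rw [Pi.add_apply, Finset.sum_apply]
    by_cases hz : InB M A m z
    · rw [extend, dif_pos hz, if_neg hz.1, add_zero, Finset.sum_eq_single ⟨z, hz⟩]
      · simp
      · intro w _ hw
        have : z ≠ w.1 := fun h => hw (Subtype.ext h.symm)
        simp [this]
      · simp
    · rw [extend, dif_neg hz, Finset.sum_eq_zero, zero_add]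
      intro w _
      have : z ≠ w.1 := fun h => hz (h ▸ w.2)
      simp [this]
  change _ = rhsLin M A m v.1 (extend M A m μ)
  rw [h, map_add, map_sum, Pi.add_apply]
  congr 1
  · simp only [Matrix.mulVec, dotProduct, map_smul, smul_eq_mul]
    refine Finset.sum_congr rfl fun w _ => ?_
    rw [mul_comm]
    congr 1
    simp only [matC, Matrix.of_apply, rhsLin, LinearMap.coe_mk, AddHom.coe_mk]
    congr!

theorem isSolution_extend [Finite Q] {μ : B M A m → ℝ}
    (hμ : μ = matC M A m *ᵥ μ + vecD M A m) : IsSolution M A m (extend M A m μ) where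
  zero v hv := by
    have h1 : ¬ IsFinal (vertex A v.1) := fun h => hv ⟨_, Relation.ReflTransGen.refl, h⟩
    rw [extend, dif_neg (not_inB_iff.2 (Or.inr hv)), if_neg h1]
  one v hv := by
    rw [extend, dif_neg (not_inB_iff.2 (Or.inl hv)), if_pos hv]
  eq v hv := by
    rw [← matC_mulVec_add_vecD μ ⟨v, hv⟩, ← hμ]
    exact extend_coe μ ⟨v, hv⟩

/-- The difference of two solutions has no local error, so the stability estimate applies with ε =
0. -/
theorem IsSolution.unique [Finite Q] (hm : 2 * cardV S A ^ 2 < (m : ℕ)) {h k : Grid S A m → ℝ}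
    (hh : IsSolution M A m h) (hk : IsSolution M A m k) : h = k := by
  funext v
  have := abs_le_of_abs_sub_rhs_le (M := M) hm (g := fun w => h w - k w) le_rfl
    (fun w hw => by
      rcases not_inB_iff.1 hw with h1 | h1
      · rw [hh.one w h1, hk.one w h1, sub_self]
      · rw [hh.zero w h1, hk.zero w h1, sub_self])
    (fun w hw _ => by rw [rhs_sub, ← hh.eq w hw, ← hk.eq w hw, sub_self, abs_zero])
    (fun w hw _ => by rw [rhs_sub, ← hh.eq w hw, ← hk.eq w hw]) v
  rw [mul_zero, mul_zero] at this
  exact sub_eq_zero.1 (abs_eq_zero.1 (le_antisymm this (abs_nonneg _)))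

/-- Stability with ε = 0 makes the identity minus `matC` injective, hence surjective in finite
dimension. -/
theorem exists_eq_mulVec_add [Finite Q] (hm : 2 * cardV S A ^ 2 < (m : ℕ)) :
    ∃ μ : B M A m → ℝ, μ = matC M A m *ᵥ μ + vecD M A m := by
  classical
  have hdiff : ∀ μ ν : B M A m → ℝ, μ - matC M A m *ᵥ μ = ν - matC M A m *ᵥ ν → μ = ν := by
    intro μ ν h
    have hval : ∀ w, rhs M A m (fun w => extend M A m μ w - extend M A m ν w) w =
        rhs M A m (extend M A m μ) w - rhs M A m (extend M A m ν) w := rhs_sub _ _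
    have heq : ∀ w, InB M A m w → extend M A m μ w - extend M A m ν w =
        rhs M A m (fun w => extend M A m μ w - extend M A m ν w) w := by
      intro w hw
      rw [hval, ← matC_mulVec_add_vecD μ ⟨w, hw⟩, ← matC_mulVec_add_vecD ν ⟨w, hw⟩,
        extend_coe μ ⟨w, hw⟩, extend_coe ν ⟨w, hw⟩]
      have := congrFun h ⟨w, hw⟩
      simp only [Pi.sub_apply, Pi.add_apply] at this ⊢
      linarith
    funext v
    have := abs_le_of_abs_sub_rhs_le (M := M) hm
      (g := fun w => extend M A m μ w - extend M A m ν w) le_rfl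
      (fun w hw => by simp only [extend, dif_neg hw, sub_self])
      (fun w hw _ => by rw [← heq w hw, sub_self, abs_zero]) (fun w hw _ => heq w hw) v.1
    rw [mul_zero, mul_zero] at this
    have := sub_eq_zero.1 (abs_eq_zero.1 (le_antisymm this (abs_nonneg _)))
    rwa [extend_coe, extend_coe] at this
  let T : (B M A m → ℝ) →ₗ[ℝ] (B M A m → ℝ) := LinearMap.id - (matC M A m).mulVecLin
  have hinj : Function.Injective T := fun μ ν h => hdiff μ ν h
  obtain ⟨μ, hμ⟩ := LinearMap.injective_iff_surjective.1 hinj (vecD M A m)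
  refine ⟨μ, ?_⟩
  have : μ - matC M A m *ᵥ μ = vecD M A m := hμ
  rw [← this, add_sub_cancel]

/-- The discretisation error of a solution of the linear system. -/
theorem IsSolution.abs_sub_prob_le [MeasurableSpace S] [DiscreteMeasurableSpace S] [Finite Q]
    (hm : 2 * cardV S A ^ 2 < (m : ℕ)) {h : Grid S A m → ℝ} (hh : IsSolution M A m h)
    (v : Grid S A m) : |h v - prob M A v.1| ≤
      cardV S A * (constC M A ^ cardV S A)⁻¹ * (M₃ M A * (m : ℝ)⁻¹) := by
  have hΛ : 0 < rateMax M := rateMax_pos M v.1.1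
  set K := rateMax M * (Fintype.card X * A.maxBound : ℝ) with hK
  have hK0 : 0 ≤ K := by positivity
  have hm0 : (0 : ℝ) < m := by exact_mod_cast m.pos
  refine (abs_le_of_abs_sub_rhs_le (M := M) hm (g := fun w => h w - prob M A w.1)
    (ε := rateMax M * K * (m : ℝ)⁻¹ ^ 2) (by positivity) (fun w hw => ?_) (fun w hw hmax => ?_)
    (fun w hw hmax => ?_) v).trans ?_
  · rcases not_inB_iff.1 hw with h1 | h1
    · rw [hh.one w h1, prob_of_final M h1, sub_self]
    · rw [hh.zero w h1, prob_of_not_reachesFinal M A w.1 h1, sub_self]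
  · rw [rhs_sub, ← hh.eq w hw, sub_sub_sub_cancel_left, abs_sub_comm]
    exact abs_prob_sub_rhs_le M A w hw.1 hmax
  · rw [rhs_sub, ← hh.eq w hw, prob_of_atMax M A w hw.1 hmax, rhs, if_pos hmax]
  · have hc := pow_pos (constC_pos M A v.1.1) (cardV S A)
    refine mul_le_mul_of_nonneg_left ?_ (by positivity)
    -- The Lipschitz constant obtained from `gap` is M₁ without its exponential factor.
    have hKM : K ≤ M₁ M A := by
      have h1 : 1 ≤ Real.exp (rateMax M * A.maxBound) := Real.one_le_exp (by positivity)
      calc K = Fintype.card X * (rateMax M * A.maxBound) * 1 := by rw [hK]; ring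
        _ ≤ M₁ M A := mul_le_mul_of_nonneg_left h1 (by positivity)
    calc 2 * (A.maxBound : ℝ) * m * (rateMax M * K * (m : ℝ)⁻¹ ^ 2)
        = A.maxBound * (2 * rateMax M * K) * (m : ℝ)⁻¹ := by field_simp
      _ ≤ A.maxBound * (2 * rateMax M * M₁ M A) * (m : ℝ)⁻¹ := by gcongr
      _ = M₃ M A * (m : ℝ)⁻¹ := rfl

end Product

open Product in
theorem mainTheorem1 {S L Q X : Type*} [Fintype S] [MeasurableSpace S] [DiscreteMeasurableSpace S]
    [Finite L] [Finite Q] [Fintype X] (M : CTMC S L) (A : DTA Q L X) (m : ℕ+)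
    (hm : 2 * cardV S A ^ 2 < (m : ℕ)) :
    ∃ μ : B M A m → ℝ,
      (μ = matC M A m *ᵥ μ + vecD M A m ∧
        ∀ μ' : B M A m → ℝ, μ' = matC M A m *ᵥ μ' + vecD M A m → μ' = μ) ∧
      (∃! h : Grid S A m → ℝ, IsSolution M A m h) ∧
      (∀ h : Grid S A m → ℝ, IsSolution M A m h → ∀ v : B M A m, h v.1 = μ v) ∧
      ∀ v : B M A m, |μ v - prob M A v.1.1| ≤
        cardV S A * (constC M A ^ cardV S A)⁻¹ * (M₃ M A * (m : ℝ)⁻¹) := by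
  obtain ⟨μ, hμ⟩ := exists_eq_mulVec_add (M := M) (A := A) hm
  have hsol := isSolution_extend hμ
  refine ⟨μ, ⟨hμ, fun μ' hμ' => ?_⟩, ⟨_, hsol, fun h hh => hh.unique hm hsol⟩,
    fun h hh v => ?_, fun v => ?_⟩
  · funext v
    rw [← extend_coe μ', (isSolution_extend hμ').unique hm hsol, extend_coe]
  · rw [hh.unique hm hsol, extend_coe]
  · rw [← extend_coe μ]
    exact hsol.abs_sub_prob_le hm v.1
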